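/- Let $L,\Lambda,\alpha>0$. Let the photon modes be the pairs $(k,\lambda)$ with $k\in\frac{2\pi}{L}\mathbb Z^3$, $0<|k|<\Lambda$, $\lambda\in\{1,2\}$, let $\mathcal F$ be the bosonic Fock space over these modes with annihilation and creation operators $a_\lambda(k),a^*_\lambda(k)$ satisfying $[a_\lambda(k),a^*_{\lambda'}(k')]=\delta_{\lambda\lambda'}\delta_{kk'}$ (all other commutators vanish), and let $\varepsilon_\lambda(k)\in\mathbb R^3$ be polarization vectors, $\varepsilon_\lambda(k)\cdot\varepsilon_{\lambda'}(k)=\delta_{\lambda\lambda'}$, $\varepsilon_\lambda(k)\cdot k=0$. Put $$A(x)=\frac1{\sqrt{2L^3}}\sum_{0<|k|<\Lambda}\ \sum_{\lambda=1,2}\frac{1}{\sqrt{|k|}}\,\varepsilon_\lambda(k)\bigl[a_\lambda(k)e^{ik\cdot x}+a^*_\lambda(k)e^{-ik\cdot x}\bigr],\qquad H_f=\sum_{0<|k|<\Lambda}\ \sum_{\lambda=1,2}|k|\,a^*_\lambda(k)a_\lambda(k),$$ and, on $L^2(\mathbb R^3)\otimes\mathcal F$ with $p=-i\nabla$, let $$H=\tfrac12\bigl[p^2+\alpha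 A(x)^2\bigr]+H_f .$$ Let $E_0=\inf_{\Psi\ne0}\langle\Psi,H\Psi\rangle/\langle\Psi,\Psi\rangle$ be its ground state energy, where $\langle\Psi,H\Psi\rangle$ is understood as the quadratic form of $H$ and $\Psi$ ranges over its form domain. Then there are universal constants $C_1,C_2>0$ such that for every $\alpha>0$ and every $L_0>0$ there is $\Lambda_0=\Lambda_0(\alpha,L_0)>0$ such that for all $\Lambda\ge\Lambda_0$, all $L\ge L_0$ and every choice of the polarization vectors, $$C_1\,\alpha^{2/7}\Lambda^{12/7}\ \le\ E_0\ \le\ C_2\,\alpha^{2/7}\Lambda^{12/7}.$$ -/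

import Mathlib

open MeasureTheory
open scoped ContDiff ENNReal

noncomputable section

namespace RadiationField

/-- Three-dimensional Euclidean space, with its Euclidean norm. -/
abbrev Space : Type := EuclideanSpace ℝ (Fin 3)

/-- The wave vector `k = 2π n / L` belonging to the integer vector `n`. -/
def waveVector (L : ℝ) (n : Fin 3 → ℤ) : Space :=
  WithLp.toLp 2 fun i => 2 * Real.pi * (n i : ℝ) / L

/-- The photon modes `(k, lam)` below the cutoff: `k = 2π n / L` with `n ∈ ℤ³`, `|k| < Λ`,
and a polarization index with two values. The vector `k = 0` is left out, since
`A(x)` has a factor `1 / √|k|`. -/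
abbrev Mode (L Λ : ℝ) : Type :=
  {n : Fin 3 → ℤ // n ≠ 0 ∧ ‖waveVector L n‖ < Λ} × Fin 2

/-- The wave vector of a mode. -/
def Mode.k {L Λ : ℝ} (m : Mode L Λ) : Space := waveVector L m.1.1

/-- There are finitely many modes, so that every sum over modes below is a finite sum. -/
theorem finite_mode {L : ℝ} (hL : 0 < L) (Λ : ℝ) : Finite (Mode L Λ) := by
  have h : {n : Fin 3 → ℤ | n ≠ 0 ∧ ‖waveVector L n‖ < Λ}.Finite := by
    refine (Set.finite_Icc (fun _ : Fin 3 => -⌈Λ * L⌉) (fun _ => ⌈Λ * L⌉)).subset ?_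
    rintro n ⟨-, hn⟩
    have key : ∀ i, |(n i : ℝ)| ≤ Λ * L := by
      intro i
      have h1 : ‖(waveVector L n) i‖ < Λ := lt_of_le_of_lt (PiLp.norm_apply_le _ i) hn
      have h2 : |2 * Real.pi * (n i : ℝ) / L| < Λ := h1
      rw [abs_div, abs_of_pos hL, div_lt_iff₀ hL, abs_mul,
        abs_of_pos (by positivity : (0 : ℝ) < 2 * Real.pi)] at h2
      have h3 : (1 : ℝ) ≤ 2 * Real.pi := by linarith [Real.pi_gt_three]
      nlinarith [abs_nonneg (n i : ℝ)]
    refine ⟨fun i => ?_, fun i => ?_⟩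
    · have h4 := (abs_le.1 (key i)).1
      have h5 := Int.le_ceil (Λ * L)
      have h6 : (-(⌈Λ * L⌉ : ℤ) : ℝ) ≤ (n i : ℝ) := by linarith
      exact_mod_cast h6
    · have h4 := (abs_le.1 (key i)).2
      have h5 := Int.le_ceil (Λ * L)
      have h6 : (n i : ℝ) ≤ ((⌈Λ * L⌉ : ℤ) : ℝ) := by linarith
      exact_mod_cast h6
  have := h.to_subtype
  exact inferInstanceAs
    (Finite ({n : Fin 3 → ℤ | n ≠ 0 ∧ ‖waveVector L n‖ < Λ} × Fin 2))

/-- Real polarization vectors: for each `k ≠ 0`, `ε k 0` and `ε k 1` are orthonormal and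
perpendicular to `k`. -/
def IsPolarization (ε : Space → Fin 2 → Space) : Prop :=
  ∀ k : Space, k ≠ 0 → Orthonormal ℝ (ε k) ∧ ∀ s : Fin 2, inner ℝ (ε k s) k = 0

/-- Occupation numbers of the modes. -/
abbrev Occ (L Λ : ℝ) : Type := Mode L Λ →₀ ℕ

/-- The photon Fock space, written in the orthonormal basis of normalized vectors
`∏ (a*_m) ^ n_m |0⟩ / √(n_m!)`: the square summable families indexed by
occupation numbers `n`. -/
abbrev Fock (L Λ : ℝ) : Type := lp (fun _ : Occ L Λ => ℂ) 2

/-- The Hilbert space `L²(ℝ³) ⊗ Fock`, as the space of square integrable Fock-valued functions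
of the position of the electron. -/
abbrev StateSpace (L Λ : ℝ) : Type := Lp (Fock L Λ) 2 (volume : Measure Space)

/-- The annihilation operator of the mode `m`, on families of coefficients. -/
def annihilate {L Λ : ℝ} (m : Mode L Λ) (f : Occ L Λ → ℂ) : Occ L Λ → ℂ :=
  fun n => (Real.sqrt ((n m : ℝ) + 1) : ℂ) * f (n + Finsupp.single m 1)

/-- The creation operator of the mode `m`, on families of coefficients; the value is `0` at
occupation numbers `n` with `n m = 0`. -/
def create {L Λ : ℝ} (m : Mode L Λ) (f : Occ L Λ → ℂ) : Occ L Λ → ℂ :=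
  fun n => (Real.sqrt (n m : ℝ) : ℂ) * f (n - Finsupp.single m 1)

/-- The `j`-th component of the cutoff vector potential at the point `x`,
`A(x) = (2 L³)^(-1/2) ∑ |k|^(-1/2) ε_lam(k) (a_lam(k) e^{i x·k} + a_lam(k)* e^{-i x·k})`,
on families of coefficients. -/
def vectorPotential {L Λ : ℝ} (ε : Space → Fin 2 → Space) (j : Fin 3) (x : Space)
    (f : Occ L Λ → ℂ) : Occ L Λ → ℂ :=
  fun n => ((1 / Real.sqrt (2 * L ^ 3) : ℝ) : ℂ) * ∑ᶠ m : Mode L Λ,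
    ((1 / Real.sqrt ‖m.k‖ * ε m.k m.2 j : ℝ) : ℂ) *
      (Complex.exp (Complex.I * (inner ℝ x m.k : ℝ)) * annihilate m f n +
        Complex.exp (-Complex.I * (inner ℝ x m.k : ℝ)) * create m f n)

/-- `Ψ` is in the domain of `p_j = -i ∂_j` (weak derivative) and `p_j Ψ = Φ`. -/
def IsMomentum {L Λ : ℝ} (j : Fin 3) (Ψ Φ : StateSpace L Λ) : Prop :=
  ∀ φ : Space → ℂ, ContDiff ℝ ∞ φ → HasCompactSupport φ →
    ∫ x, φ x • Φ x = Complex.I • ∫ x, fderiv ℝ φ x (EuclideanSpace.single j 1) • Ψ x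

/-- `Ψ` is in the (maximal) domain of `a_m` and `a_m Ψ = Φ`. -/
def IsAnnihilation {L Λ : ℝ} (m : Mode L Λ) (Ψ Φ : StateSpace L Λ) : Prop :=
  ∀ᵐ x, ∀ n, Φ x n = annihilate m (Ψ x : Occ L Λ → ℂ) n

/-- `Ψ` is in the (maximal) domain of `A_j(x)` and `A_j(x) Ψ = Φ`. -/
def IsPotential {L Λ : ℝ} (ε : Space → Fin 2 → Space) (j : Fin 3) (Ψ Φ : StateSpace L Λ) :
    Prop :=
  ∀ᵐ x, ∀ n, Φ x n = vectorPotential ε j x (Ψ x : Occ L Λ → ℂ) n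

/-- `Ψ` is in the form domain of `H = (1/2) (p² + α A(x)²) + H_f`, where
`H_f = ∑ |k| a_lam(k)* a_lam(k)`, and `⟨Ψ, H Ψ⟩ = q`. That is, `p_j Ψ`, `A_j(x) Ψ` and `a_m Ψ`
are all in the Hilbert space, and
`q = (1/2) (∑ ‖p_j Ψ‖² + α ∑ ‖A_j(x) Ψ‖²) + ∑ |k| ‖a_lam(k) Ψ‖²`. -/
def HasEnergy {L Λ : ℝ} (α : ℝ) (ε : Space → Fin 2 → Space) (Ψ : StateSpace L Λ) (q : ℝ) :
    Prop :=
  ∃ (P B : Fin 3 → StateSpace L Λ) (D : Mode L Λ → StateSpace L Λ),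
    (∀ j, IsMomentum j Ψ (P j)) ∧ (∀ j, IsPotential ε j Ψ (B j)) ∧
    (∀ m, IsAnnihilation m Ψ (D m)) ∧
    q = 1 / 2 * (∑ j, ‖P j‖ ^ 2 + α * ∑ j, ‖B j‖ ^ 2) + ∑ᶠ m : Mode L Λ, ‖m.k‖ * ‖D m‖ ^ 2

/-- The ground state energy `inf ⟨Ψ, H Ψ⟩ / ⟨Ψ, Ψ⟩` of `H = (1/2) (p² + α A(x)²) + H_f`, over all
nonzero `Ψ` in the form domain. -/
def groundStateEnergy (α L Λ : ℝ) (ε : Space → Fin 2 → Space) : ℝ :=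
  sInf {e : ℝ | ∃ Ψ : StateSpace L Λ, Ψ ≠ 0 ∧ ∃ q : ℝ, HasEnergy α ε Ψ q ∧ e = q / ‖Ψ‖ ^ 2}

end RadiationField

end

/-! Everything happens at the length ℓ = α^(-1/7) Λ^(-6/7), for which ℓ^7 α Λ^6 = 1 and ℓ^(-2) =
α^(2/7) Λ^(12/7) (`eventually_scale`). An electron confined to a region of size ℓ pays ℓ^(-2) in
kinetic energy. In that region live about (ℓΛ)^3 field modes; squeezing them until α A² is of order
ℓ^(-2) costs field energy of order ℓ^5 α Λ^6, which is again ℓ^(-2).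

Lower bound. For y in [0, ℓ]^3 the vectors Ψ(x) and Ψ(x + y) differ in L² by at most a constant
times ℓ‖pΨ‖ (`norm_translate_sub_sq_le`). Let T be the field conjugate to A_0 at the point x + y,
with [A_0, T] = iκ and κ of order Λ^3. If A_0 Ψ(x + y) is small, then exp(itT) makes Ψ(x + y) nearly
orthogonal to itself, although it moves Ψ(x) by no more than t‖TΨ(x)‖. This is the uncertainty
relation `norm_sq_le_of_inDomain`; the vectors Ψ(x + y) and Ψ(x) may differ in it. Because T acts on
Ψ(x) and not on Ψ(x + y), y enters its annihilation part through plane waves only, and an average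
over the cube together with Parseval on the torus bounds that part by the field energy divided by
ℓ^3 (`exists_norm_sum_planeWave_sq_le`). With t² = ℓ^5 all terms become ℓ² times a part of the
energy, except for the vacuum fluctuation of T, of order ℓ^5 Λ^4, which tends to 0 and is absorbed
(`norm_sq_le_of_hasEnergy`). Since T is unbounded, the exponential is taken of truncations in the
photon number, whose error vanishes in the limit (`norm_sq_le_of_degreeLT`).

Upper bound. The trial state is a wave packet of width ℓ times one Gaussian photon state Ω. For a
positive matrix Z compatible with the real structure of the fields, `exists_squeezedState` gives an
Ω in which A(F) has variance ⟨(1 + Z)⁻¹F, F⟩ and mode m holds at most Z_mm / 4 photons. Here Z is a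
weighted sum of the projections on the coefficient vectors of A at the points of the lattice Λ⁻¹ℤ³,
so the variance at these points is bounded directly. The variance is a band-limited function of x
and the packet has a band-limited density, so by Poisson summation the integral of A² against the
density equals its lattice sum (`hasSum_quadratic`, `integral_quadratic_le`), and nothing between
the lattice points has to be controlled. -/

noncomputable section

namespace RadiationField

/-! ### Canonical commutation relations on coefficient families -/

section FockAlgebra

variable {L Λ : ℝ}

theorem annihilate_add (m : Mode L Λ) (f g : Occ L Λ → ℂ) :
    annihilate m (f + g) = annihilate m f + annihilate m g := by
  funext n; simp [annihilate, mul_add]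

theorem annihilate_smul (m : Mode L Λ) (c : ℂ) (f : Occ L Λ → ℂ) :
    annihilate m (c • f) = c • annihilate m f := by
  funext n; simp [annihilate]; ring

theorem create_add (m : Mode L Λ) (f g : Occ L Λ → ℂ) :
    create m (f + g) = create m f + create m g := by
  funext n; simp [create, mul_add]

theorem create_smul (m : Mode L Λ) (c : ℂ) (f : Occ L Λ → ℂ) :
    create m (c • f) = c • create m f := by
  funext n; simp [create]; ring

/-- Subtraction of occupation numbers is truncated, which is why n j ≠ 0 is needed. In the remaining
case the factor √(n j) in `create` vanishes, so the truncation never matters. -/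
theorem occ_add_sub_comm {i j : Mode L Λ} (n : Occ L Λ) (h : n j ≠ 0) :
    n + Finsupp.single i 1 - Finsupp.single j 1 =
      n - Finsupp.single j 1 + Finsupp.single i 1 := by
  classical
  ext l
  simp only [Finsupp.coe_add, Finsupp.coe_tsub, Pi.add_apply, Pi.sub_apply, Finsupp.single_apply]
  by_cases h1 : j = l
  · subst h1; simp; omega
  · simp [h1]

theorem occ_sub_add_cancel {j : Mode L Λ} (n : Occ L Λ) (h : n j ≠ 0) :
    n - Finsupp.single j 1 + Finsupp.single j 1 = n := by
  rw [← occ_add_sub_comm n h, add_tsub_cancel_right]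

theorem annihilate_comm (i j : Mode L Λ) (f : Occ L Λ → ℂ) :
    annihilate i (annihilate j f) = annihilate j (annihilate i f) := by
  classical
  funext n
  simp only [annihilate, Finsupp.coe_add, Pi.add_apply, Finsupp.single_apply]
  rw [add_right_comm]
  by_cases h : i = j
  · subst h; rfl
  · simp [h, Ne.symm h]; ring

theorem create_comm (i j : Mode L Λ) (f : Occ L Λ → ℂ) :
    create i (create j f) = create j (create i f) := by
  classical
  funext n
  simp only [create, Finsupp.coe_tsub, Pi.sub_apply, Finsupp.single_apply]
  rw [tsub_right_comm]
  by_cases h : i = j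
  · subst h; rfl
  · simp [h, Ne.symm h]; ring

theorem annihilate_create_of_ne {i j : Mode L Λ} (hij : i ≠ j) (f : Occ L Λ → ℂ) :
    annihilate i (create j f) = create j (annihilate i f) := by
  classical
  funext n
  simp only [annihilate, create, Finsupp.coe_add, Finsupp.coe_tsub, Pi.add_apply, Pi.sub_apply,
    Finsupp.single_apply, if_neg hij, if_neg (Ne.symm hij), add_zero, tsub_zero]
  by_cases h : n j = 0
  · simp [h]
  · rw [occ_add_sub_comm n h]; ring

theorem annihilate_create_self (i : Mode L Λ) (f : Occ L Λ → ℂ) :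
    annihilate i (create i f) = create i (annihilate i f) + f := by
  classical
  funext n
  simp only [annihilate, create, Finsupp.coe_add, Finsupp.coe_tsub, Pi.add_apply, Pi.sub_apply,
    Finsupp.single_eq_same, add_tsub_cancel_right]
  have h1 : (((Real.sqrt ((n i : ℝ) + 1) : ℝ) : ℂ)) * ((Real.sqrt ((n i + 1 : ℕ) : ℝ) : ℝ) : ℂ)
      = (n i : ℂ) + 1 := by
    push_cast
    rw [← Complex.ofReal_mul, Real.mul_self_sqrt (by positivity)]; push_cast; rfl
  rw [← mul_assoc, h1]
  by_cases h : n i = 0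
  · simp [h]
  · rw [occ_sub_add_cancel n h]
    have h2 : ((n i - 1 : ℕ) : ℝ) + 1 = n i := by
      rw [← Nat.cast_succ]; congr 1; omega
    rw [h2, ← mul_assoc, ← Complex.ofReal_mul, Real.mul_self_sqrt (by positivity)]
    push_cast; ring

theorem annihilate_create [DecidableEq (Mode L Λ)] (i j : Mode L Λ) (f : Occ L Λ → ℂ) :
    annihilate i (create j f) = create j (annihilate i f) + (if i = j then (1 : ℂ) else 0) • f := by
  by_cases h : i = j
  · subst h; simp [annihilate_create_self]
  · simp [h, annihilate_create_of_ne h]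

variable [Fintype (Mode L Λ)]

/-- The operator `∑ (b_m a_m + c_m a*_m)` on families of coefficients. -/
def field (b c : Mode L Λ → ℂ) (f : Occ L Λ → ℂ) : Occ L Λ → ℂ :=
  ∑ m, (b m • annihilate m f + c m • create m f)

theorem field_apply (b c : Mode L Λ → ℂ) (f : Occ L Λ → ℂ) (n : Occ L Λ) :
    field b c f n = ∑ m, (b m * annihilate m f n + c m * create m f n) := by
  simp [field]

theorem field_add (b c : Mode L Λ → ℂ) (f g : Occ L Λ → ℂ) :
    field b c (f + g) = field b c f + field b c g := by
  simp only [field, annihilate_add, create_add, smul_add, ← Finset.sum_add_distrib]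
  exact Finset.sum_congr rfl fun m _ => by abel

theorem field_smul (b c : Mode L Λ → ℂ) (z : ℂ) (f : Occ L Λ → ℂ) :
    field b c (z • f) = z • field b c f := by
  simp only [field, annihilate_smul, create_smul, Finset.smul_sum, smul_add]
  exact Finset.sum_congr rfl fun m _ => by rw [smul_comm z (b m), smul_comm z (c m)]

theorem field_zero (b c : Mode L Λ → ℂ) : field b c 0 = 0 := by
  simpa using field_smul b c 0 0

theorem field_sum {ι : Type*} (s : Finset ι) (b c : Mode L Λ → ℂ) (f : ι → Occ L Λ → ℂ) :
    field b c (∑ i ∈ s, f i) = ∑ i ∈ s, field b c (f i) := by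
  classical
  induction s using Finset.induction_on with
  | empty => simp [field_zero]
  | insert i s hi ih => rw [Finset.sum_insert hi, field_add, ih, Finset.sum_insert hi]

theorem annihilate_field (i : Mode L Λ) (b c : Mode L Λ → ℂ) (f : Occ L Λ → ℂ) :
    annihilate i (field b c f) = field b c (annihilate i f) + c i • f := by
  classical
  have h : ∀ s : Finset (Mode L Λ), annihilate i (∑ m ∈ s, (b m • annihilate m f + c m • create m f))
      = ∑ m ∈ s, (b m • annihilate m (annihilate i f) + c m • create m (annihilate i f))
        + ∑ m ∈ s, (c m * if i = m then 1 else 0) • f := by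
    intro s
    induction s using Finset.induction_on with
    | empty => funext n; simp [annihilate]
    | insert m s hm ih =>
      rw [Finset.sum_insert hm, annihilate_add, ih, Finset.sum_insert hm, Finset.sum_insert hm,
        annihilate_add, annihilate_smul, annihilate_smul, annihilate_create, annihilate_comm i m,
        smul_add, smul_smul]
      abel
  unfold field
  rw [h]
  simp

theorem create_field (i : Mode L Λ) (b c : Mode L Λ → ℂ) (f : Occ L Λ → ℂ) :
    create i (field b c f) = field b c (create i f) - b i • f := by
  classical
  have h : ∀ s : Finset (Mode L Λ), create i (∑ m ∈ s, (b m • annihilate m f + c m • create m f))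
      = ∑ m ∈ s, (b m • annihilate m (create i f) + c m • create m (create i f))
        - ∑ m ∈ s, (b m * if m = i then 1 else 0) • f := by
    intro s
    induction s using Finset.induction_on with
    | empty => funext n; simp [create]
    | insert m s hm ih =>
      rw [Finset.sum_insert hm, create_add, ih, Finset.sum_insert hm, Finset.sum_insert hm,
        create_add, create_smul, create_smul, annihilate_create, create_comm i m,
        smul_add, smul_smul]
      abel
  unfold field
  rw [h]
  simp

/-- This is an algebraic identity on arbitrary families: each coefficient of a field is a finite
sum, so no domain is involved. Square summability enters only when norms are taken. -/
theorem field_comm (b c b' c' : Mode L Λ → ℂ) (f : Occ L Λ → ℂ) :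
    field b c (field b' c' f) =
      field b' c' (field b c f) + (∑ m, (b m * c' m - c m * b' m)) • f := by
  have h : field b' c' (field b c f) =
      ∑ m, (b m • field b' c' (annihilate m f) + c m • field b' c' (create m f)) := by
    conv_lhs => rw [field.eq_1 b c]
    rw [field_sum]
    simp only [field_add, field_smul]
  rw [h, field.eq_1 b c]
  simp only [annihilate_field, create_field]
  rw [Finset.sum_smul, ← Finset.sum_add_distrib]
  refine Finset.sum_congr rfl fun m _ => ?_
  rw [smul_add, smul_sub, sub_smul, smul_smul, smul_smul]
  abel

end FockAlgebra

/-! ### Bounded weighted shifts on ℓ² -/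

section WeightedShift

variable {ι : Type*}

theorem memℓp_two_iff {f : ι → ℂ} : Memℓp f 2 ↔ Summable fun i => ‖f i‖ ^ 2 := by
  rw [memℓp_gen_iff (by norm_num)]
  simp

theorem lp_hasSum_norm_sq (f : lp (fun _ : ι => ℂ) 2) :
    HasSum (fun i => ‖f i‖ ^ 2) (‖f‖ ^ 2) := by
  have := lp.hasSum_norm (p := 2) (by norm_num) f
  simpa using this

/-- Injectivity of σ is asked only where the weight is nonzero, because the truncated subtraction in
`create` is injective only on occupation numbers with n m ≠ 0. -/
theorem hasSum_weighted_comp {w : ι → ℂ} {σ : ι → ι} {C : ℝ} (hC : ∀ i, ‖w i‖ ≤ C)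
    (hσ : Set.InjOn σ {i | w i ≠ 0}) {f : ι → ℂ} (hf : Summable fun i => ‖f i‖ ^ 2) :
    (Summable fun i => ‖w i * f (σ i)‖ ^ 2) ∧
      ∑' i, ‖w i * f (σ i)‖ ^ 2 ≤ C ^ 2 * ∑' i, ‖f i‖ ^ 2 := by
  have hinj : Function.Injective fun i : {i | w i ≠ 0} => σ i := fun i j h =>
    Subtype.ext (hσ i.2 j.2 h)
  have hs : Summable fun i : {i | w i ≠ 0} => ‖f (σ i)‖ ^ 2 := hf.comp_injective hinj
  have hle : ∑' i : {i | w i ≠ 0}, ‖f (σ i)‖ ^ 2 ≤ ∑' i, ‖f i‖ ^ 2 :=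
    tsum_comp_le_tsum_of_inj hf (fun _ => by positivity) hinj
  have hb : ∀ i, ‖w i * f (σ i)‖ ^ 2 ≤
      {i | w i ≠ 0}.indicator (fun i => C ^ 2 * ‖f (σ i)‖ ^ 2) i := by
    intro i
    by_cases h : w i = 0
    · simp [h]
    · rw [Set.indicator_of_mem (by exact h), norm_mul, mul_pow]
      gcongr
      exact hC i
  have hs2 : Summable ({i | w i ≠ 0}.indicator (fun i => C ^ 2 * ‖f (σ i)‖ ^ 2)) :=
    summable_subtype_iff_indicator.1 (hs.mul_left _)
  refine ⟨Summable.of_nonneg_of_le (fun _ => by positivity) hb hs2, ?_⟩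
  calc _ ≤ ∑' i, {i | w i ≠ 0}.indicator (fun i => C ^ 2 * ‖f (σ i)‖ ^ 2) i :=
        Summable.tsum_le_tsum hb (Summable.of_nonneg_of_le (fun _ => by positivity) hb hs2) hs2
    _ = C ^ 2 * ∑' i : {i | w i ≠ 0}, ‖f (σ i)‖ ^ 2 := by rw [← tsum_subtype, tsum_mul_left]
    _ ≤ _ := by gcongr

theorem exists_weightedShift (w : ι → ℂ) (σ : ι → ι) {C : ℝ} (hC0 : 0 ≤ C) (hC : ∀ i, ‖w i‖ ≤ C)
    (hσ : Set.InjOn σ {i | w i ≠ 0}) :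
    ∃ T : lp (fun _ : ι => ℂ) 2 →L[ℂ] lp (fun _ : ι => ℂ) 2,
      (∀ f i, T f i = w i * f (σ i)) ∧ ‖T‖ ≤ C := by
  have hmem : ∀ f : lp (fun _ : ι => ℂ) 2, Memℓp (fun i => w i * f (σ i)) 2 := fun f =>
    memℓp_two_iff.2 (hasSum_weighted_comp hC hσ (lp_hasSum_norm_sq f).summable).1
  let T0 : lp (fun _ : ι => ℂ) 2 →ₗ[ℂ] lp (fun _ : ι => ℂ) 2 :=
    { toFun := fun f => ⟨fun i => w i * f (σ i), hmem f⟩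
      map_add' := fun f g => lp.ext (funext fun i => mul_add _ _ _)
      map_smul' := fun c f => lp.ext (funext fun i => mul_left_comm _ _ _) }
  refine ⟨T0.mkContinuous C fun f => ?_, fun f i => rfl, T0.mkContinuous_norm_le hC0 _⟩
  refine abs_le_of_sq_le_sq' ?_ (by positivity) |>.2
  rw [mul_pow, ← (lp_hasSum_norm_sq (T0 f)).tsum_eq, ← (lp_hasSum_norm_sq f).tsum_eq]
  exact (hasSum_weighted_comp hC hσ (lp_hasSum_norm_sq f).summable).2

end WeightedShift

/-! ### Fields cut off in the photon number -/

section TruncatedField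

variable {L Λ : ℝ}

theorem degree_add_single (n : Occ L Λ) (m : Mode L Λ) :
    (n + Finsupp.single m 1).degree = n.degree + 1 := by
  simp

theorem degree_sub_single (n : Occ L Λ) {m : Mode L Λ} (h : n m ≠ 0) :
    (n - Finsupp.single m 1).degree + 1 = n.degree := by
  rw [← degree_add_single, occ_sub_add_cancel n h]

theorem injOn_sub_single (m : Mode L Λ) :
    Set.InjOn (fun n : Occ L Λ => n - Finsupp.single m 1) {n | n m ≠ 0} := by
  intro n hn n' hn' h
  have := congrArg (· + Finsupp.single m 1) h
  simpa [occ_sub_add_cancel n hn, occ_sub_add_cancel n' hn'] using this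

/-- The cutoff is imposed on the larger of the two photon numbers joined by the operator: n + e_m
here, n in the creation operator. This makes the two truncations adjoint to each other and bounds
all matrix elements by √N. -/
theorem exists_truncAnnihilate (N : ℕ) (m : Mode L Λ) :
    ∃ T : Fock L Λ →L[ℂ] Fock L Λ,
      (∀ f n, T f n = (if n.degree + 1 ≤ N then (Real.sqrt ((n m : ℝ) + 1) : ℂ) else 0)
        * f (n + Finsupp.single m 1)) ∧ ‖T‖ ≤ Real.sqrt N := by
  refine exists_weightedShift _ _ (Real.sqrt_nonneg _) (fun n => ?_)
    ((add_left_injective _).injOn)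
  split_ifs with h
  · rw [Complex.norm_real, Real.norm_of_nonneg (Real.sqrt_nonneg _)]
    apply Real.sqrt_le_sqrt
    have := Finsupp.le_degree m n
    exact_mod_cast (by omega : n m + 1 ≤ N)
  · simp

theorem exists_truncCreate (N : ℕ) (m : Mode L Λ) :
    ∃ T : Fock L Λ →L[ℂ] Fock L Λ,
      (∀ f n, T f n = (if n.degree ≤ N then (Real.sqrt (n m : ℝ) : ℂ) else 0)
        * f (n - Finsupp.single m 1)) ∧ ‖T‖ ≤ Real.sqrt N := by
  refine exists_weightedShift _ _ (Real.sqrt_nonneg _) (fun n => ?_) ?_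
  · split_ifs with h
    · rw [Complex.norm_real, Real.norm_of_nonneg (Real.sqrt_nonneg _)]
      apply Real.sqrt_le_sqrt
      have := Finsupp.le_degree m n
      exact_mod_cast (by omega : n m ≤ N)
    · simp
  · refine (injOn_sub_single m).mono fun n hn => ?_
    intro h0
    exact hn (by simp [h0])

/-- The annihilation operator restricted to occupation numbers with total at most `N`. -/
def truncAnnihilate (N : ℕ) (m : Mode L Λ) : Fock L Λ →L[ℂ] Fock L Λ :=
  (exists_truncAnnihilate N m).choose

/-- The creation operator restricted to occupation numbers with total at most `N`. -/
def truncCreate (N : ℕ) (m : Mode L Λ) : Fock L Λ →L[ℂ] Fock L Λ :=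
  (exists_truncCreate N m).choose

theorem truncAnnihilate_apply (N : ℕ) (m : Mode L Λ) (f : Fock L Λ) (n : Occ L Λ) :
    truncAnnihilate N m f n = (if n.degree + 1 ≤ N then (Real.sqrt ((n m : ℝ) + 1) : ℂ) else 0)
        * f (n + Finsupp.single m 1) := (exists_truncAnnihilate N m).choose_spec.1 f n

theorem truncCreate_apply (N : ℕ) (m : Mode L Λ) (f : Fock L Λ) (n : Occ L Λ) :
    truncCreate N m f n = (if n.degree ≤ N then (Real.sqrt (n m : ℝ) : ℂ) else 0)
        * f (n - Finsupp.single m 1) := (exists_truncCreate N m).choose_spec.1 f n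

theorem norm_truncAnnihilate_le (N : ℕ) (m : Mode L Λ) :
    ‖truncAnnihilate N m‖ ≤ Real.sqrt N := (exists_truncAnnihilate N m).choose_spec.2

theorem norm_truncCreate_le (N : ℕ) (m : Mode L Λ) :
    ‖truncCreate N m‖ ≤ Real.sqrt N := (exists_truncCreate N m).choose_spec.2

theorem inner_truncAnnihilate (N : ℕ) (m : Mode L Λ) (f g : Fock L Λ) :
    inner ℂ (truncAnnihilate N m f) g = inner ℂ f (truncCreate N m g) := by
  rw [lp.inner_eq_tsum, lp.inner_eq_tsum]
  have hinj : Function.Injective fun n : Occ L Λ => n + Finsupp.single m 1 :=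
    add_left_injective _
  symm
  rw [← hinj.tsum_eq]
  · refine tsum_congr fun n => ?_
    simp only [truncAnnihilate_apply, truncCreate_apply, RCLike.inner_apply,
      degree_add_single, add_tsub_cancel_right]
    simp only [Finsupp.coe_add, Pi.add_apply, Finsupp.single_eq_same]
    push_cast
    split_ifs
    · simp; ring
    · simp
  · intro n hn
    have h0 : n m ≠ 0 := by
      intro h0
      apply hn
      simp [truncCreate_apply, h0]
    exact ⟨n - Finsupp.single m 1, occ_sub_add_cancel n h0⟩

theorem inner_truncCreate (N : ℕ) (m : Mode L Λ) (f g : Fock L Λ) :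
    inner ℂ (truncCreate N m f) g = inner ℂ f (truncAnnihilate N m g) := by
  rw [← inner_conj_symm, ← inner_truncAnnihilate, inner_conj_symm]

/-- The family `f` vanishes at occupation numbers with total at least `M`. -/
def DegreeLT (M : ℕ) (f : Occ L Λ → ℂ) : Prop := ∀ n, M ≤ n.degree → f n = 0

variable [Fintype (Mode L Λ)]

/-- The operator `∑ (b_m a_m + c_m a*_m)` restricted to occupation numbers with total at
most `N`. -/
def truncField (N : ℕ) (b c : Mode L Λ → ℂ) : Fock L Λ →L[ℂ] Fock L Λ :=
  ∑ m, (b m • truncAnnihilate N m + c m • truncCreate N m)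

theorem truncField_apply (N : ℕ) (b c : Mode L Λ → ℂ) (f : Fock L Λ) :
    truncField N b c f = ∑ m, (b m • truncAnnihilate N m f + c m • truncCreate N m f) := by
  simp [truncField]

theorem norm_truncField_le (N : ℕ) (b c : Mode L Λ → ℂ) :
    ‖truncField N b c‖ ≤ (∑ m, (‖b m‖ + ‖c m‖)) * Real.sqrt N := by
  rw [Finset.sum_mul]
  refine norm_sum_le_of_le _ fun m _ => ?_
  refine (norm_add_le _ _).trans ?_
  rw [norm_smul, norm_smul, add_mul]
  gcongr
  · exact norm_truncAnnihilate_le N m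
  · exact norm_truncCreate_le N m

theorem inner_truncField (N : ℕ) {b c : Mode L Λ → ℂ} (h : ∀ m, b m = star (c m))
    (f g : Fock L Λ) : inner ℂ (truncField N b c f) g = inner ℂ f (truncField N b c g) := by
  have key : ∀ m, inner ℂ ((b m • truncAnnihilate N m + c m • truncCreate N m) f) g =
      inner ℂ f ((b m • truncAnnihilate N m + c m • truncCreate N m) g) := by
    intro m
    simp only [add_apply, smul_apply, inner_add_left, inner_add_right, inner_smul_left,
      inner_smul_right, inner_truncAnnihilate, inner_truncCreate, h m]
    rw [add_comm]
    simp
  have h1 : ∀ v : Fock L Λ, truncField N b c v =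
      ∑ m, (b m • truncAnnihilate N m + c m • truncCreate N m) v := fun v =>
    sum_apply _ _ _
  rw [h1, h1]
  refine (sum_inner (𝕜 := ℂ) Finset.univ _ _).trans (Eq.trans ?_ (inner_sum Finset.univ _ _).symm)
  exact Finset.sum_congr rfl fun m _ => key m

theorem DegreeLT.field {M : ℕ} {f : Occ L Λ → ℂ} (hf : DegreeLT M f) (b c : Mode L Λ → ℂ) :
    DegreeLT (M + 1) (field b c f) := by
  intro n hn
  rw [field_apply]
  refine Finset.sum_eq_zero fun m _ => ?_
  have h1 : annihilate m f n = 0 := by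
    rw [annihilate, hf _ (by rw [degree_add_single]; omega), mul_zero]
  have h2 : create m f n = 0 := by
    by_cases h : n m = 0
    · simp [create, h]
    · rw [create, hf _ (by have := degree_sub_single n h; omega), mul_zero]
  simp [h1, h2]

/-- Degrees below M are at most M - 1, so a field leads to degrees at most M ≤ N and the cutoff
removes nothing. -/
theorem truncField_coe {M N : ℕ} (hMN : M ≤ N) {f : Fock L Λ} (hf : DegreeLT M (f : Occ L Λ → ℂ))
    (b c : Mode L Λ → ℂ) : (truncField N b c f : Occ L Λ → ℂ) = field b c f := by
  funext n
  rw [truncField_apply, field_apply, lp.coeFn_sum, Finset.sum_apply]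
  refine Finset.sum_congr rfl fun m _ => ?_
  simp only [lp.coeFn_add, lp.coeFn_smul, Pi.add_apply, Pi.smul_apply, smul_eq_mul,
    truncAnnihilate_apply, truncCreate_apply]
  congr 2
  · rw [annihilate]
    split_ifs with h
    · rfl
    · rw [hf _ (by rw [degree_add_single]; omega)]; simp
  · rw [create]
    split_ifs with h
    · rfl
    · by_cases h0 : n m = 0
      · simp [h0]
      · rw [hf _ (by have := degree_sub_single n h0; omega)]; simp

end TruncatedField

/-! ### Uncertainty relation for bounded operators -/

section UnitaryGroup

variable {H : Type*} [NormedAddCommGroup H] [InnerProductSpace ℂ H]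

theorem norm_pow_apply_le (T : H →L[ℂ] H) (j : ℕ) (v : H) : ‖(T ^ j) v‖ ≤ ‖T‖ ^ j * ‖v‖ := by
  induction j with
  | zero => simp
  | succ j ih =>
    rw [pow_succ', mul_apply_eq_comp, pow_succ', mul_assoc]
    exact (T.le_opNorm _).trans (by gcongr)

variable [CompleteSpace H]

theorem exp_mul_I_smul_mem_unitary {T : H →L[ℂ] H} (hT : IsSelfAdjoint T) (t : ℝ) :
    NormedSpace.exp (((t : ℂ) * Complex.I) • T) ∈ unitary (H →L[ℂ] H) := by
  have h : IsSelfAdjoint ((t : ℂ) • T) := by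
    refine IsSelfAdjoint.smul ?_ hT
    simp [IsSelfAdjoint]
  have := (selfAdjoint.expUnitary ⟨(t : ℂ) • T, h⟩).2
  rw [selfAdjoint.expUnitary_coe] at this
  rwa [smul_smul, mul_comm] at this

theorem norm_exp_mul_I_smul_apply {T : H →L[ℂ] H} (hT : IsSelfAdjoint T) (t : ℝ) (v : H) :
    ‖NormedSpace.exp (((t : ℂ) * Complex.I) • T) v‖ = ‖v‖ :=
  ContinuousLinearMap.norm_map_of_mem_unitary (exp_mul_I_smul_mem_unitary hT t) v

theorem norm_exp_mul_I_smul_apply_sub_le {T : H →L[ℂ] H} (hT : IsSelfAdjoint T) {t : ℝ}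
    (ht : 0 ≤ t) (v : H) :
    ‖NormedSpace.exp (((t : ℂ) * Complex.I) • T) v - v‖ ≤ t * ‖T v‖ := by
  have hd : ∀ s : ℝ, HasDerivAt (fun s : ℝ => NormedSpace.exp (((s : ℂ) * Complex.I) • T) v)
      (NormedSpace.exp (((s : ℂ) * Complex.I) • T) (Complex.I • T v)) s := by
    intro s
    have h1 := (hasDerivAt_exp_smul_const (𝕂 := ℂ) (Complex.I • T) (s : ℂ)).scomp s
      Complex.ofRealCLM.hasDerivAt
    simp only [Function.comp_def, smul_smul] at h1
    have h2 := ((ContinuousLinearMap.apply ℂ H v).restrictScalars ℝ).hasFDerivAt.comp_hasDerivAt s h1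
    simpa [Function.comp_def] using h2
  have h := (convex_Icc (0 : ℝ) t).norm_image_sub_le_of_norm_hasDerivWithin_le (C := ‖T v‖)
    (fun s _ => (hd s).hasDerivWithinAt) (fun s _ => by
      rw [norm_exp_mul_I_smul_apply hT, norm_smul]; simp) (Set.left_mem_Icc.2 ht)
      (Set.right_mem_Icc.2 ht)
  simpa [abs_of_nonneg ht, mul_comm] using h

theorem hasSum_inner_exp_apply (T : H →L[ℂ] H) (z : ℂ) (w v : H) :
    HasSum (fun j : ℕ => z ^ j / (j.factorial : ℂ) * inner ℂ w ((T ^ j) v))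
      (inner ℂ w (NormedSpace.exp (z • T) v)) := by
  have h := NormedSpace.exp_series_hasSum_exp' (𝕂 := ℂ) (z • T)
  have h2 := (ContinuousLinearMap.apply ℂ H v).hasSum h
  have h3 := (innerSL ℂ w).hasSum h2
  refine h3.congr_fun fun j => ?_
  rw [innerSL_apply_apply, ContinuousLinearMap.apply_apply,
    smul_pow, smul_smul, smul_apply, inner_smul_right]
  ring

/-- Expand the exponentials. For j < J the commutation relation makes the term of order j + 1 in the
difference of the first two series cancel the term of order j in the third, and the term of order 0
vanishes by symmetry of A. What is left is a tail with j ≥ J, where inserting 1 ≤ e^(j - J) produces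
the factor e^(-J) at the price of replacing t‖T‖ by e t‖T‖. -/
theorem norm_inner_exp_commutator_le {A T : H →L[ℂ] H}
    (hA : ∀ x y, inner ℂ (A x) y = inner ℂ x (A y)) {u : H} {κ t : ℝ} (hκ : 0 ≤ κ) (ht : 0 ≤ t)
    {J : ℕ} (hcomm : ∀ j < J, A ((T ^ (j + 1)) u) =
      (T ^ (j + 1)) (A u) + (((j + 1 : ℕ) : ℂ) * (Complex.I * κ)) • (T ^ j) u) :
    ‖inner ℂ (A u) (NormedSpace.exp (((t : ℂ) * Complex.I) • T) u)
      - inner ℂ u (NormedSpace.exp (((t : ℂ) * Complex.I) • T) (A u))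
      + (t * κ : ℂ) * inner ℂ u (NormedSpace.exp (((t : ℂ) * Complex.I) • T) u)‖
      ≤ Real.exp (-J) * (2 * ‖A u‖ * ‖u‖ + t * κ * ‖u‖ ^ 2)
        * Real.exp (Real.exp 1 * (t * ‖T‖)) := by
  set z : ℂ := (t : ℂ) * Complex.I with hz
  have hzn : ‖z‖ = t := by simp [hz, abs_of_nonneg ht]
  set a : ℕ → ℂ := fun j => z ^ j / (j.factorial : ℂ) * inner ℂ (A u) ((T ^ j) u)
    - z ^ j / (j.factorial : ℂ) * inner ℂ u ((T ^ j) (A u)) with ha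
  set b : ℕ → ℂ := fun j => (t * κ : ℂ) * (z ^ j / (j.factorial : ℂ) * inner ℂ u ((T ^ j) u)) with hb
  have h0 : HasSum a _ := (hasSum_inner_exp_apply T z (A u) u).sub
    (hasSum_inner_exp_apply T z u (A u))
  have ha0 : a 0 = 0 := by simp [ha, hA]
  have h1 := (hasSum_nat_add_iff' 1).2 h0
  rw [Finset.sum_range_one, ha0, sub_zero] at h1
  have h2 : HasSum b _ := (hasSum_inner_exp_apply T z u u).mul_left (t * κ : ℂ)
  have h3 := h1.add h2
  set x : ℝ := t * ‖T‖ with hx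
  set e : ℝ := Real.exp 1
  have hE : HasSum (fun j : ℕ => (e * x) ^ j / (j.factorial : ℝ)) (Real.exp (e * x)) := by
    rw [Real.exp_eq_exp_ℝ]; exact NormedSpace.expSeries_div_hasSum_exp (e * x)
  have hE1 := (hasSum_nat_add_iff' 1).2 hE
  have h4 := ((hE1.mul_left (2 * ‖A u‖ * ‖u‖)).add (hE.mul_left (t * κ * ‖u‖ ^ 2))).mul_left
    (Real.exp (-J))
  have hxe : 0 ≤ x := by positivity
  have hpow : ∀ j : ℕ, J ≤ j → x ^ j / (j.factorial : ℝ) ≤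
      Real.exp (-J) * ((e * x) ^ j / (j.factorial : ℝ)) := by
    intro j hj
    have : (1 : ℝ) ≤ Real.exp (-J) * e ^ j := by
      rw [← Real.exp_nat_mul, ← Real.exp_add]
      apply Real.one_le_exp
      have : (J : ℝ) ≤ j := by exact_mod_cast hj
      linarith
    rw [mul_pow e]
    calc x ^ j / (j.factorial : ℝ) = 1 * (x ^ j / (j.factorial : ℝ)) := by ring
      _ ≤ (Real.exp (-J) * e ^ j) * (x ^ j / (j.factorial : ℝ)) := by gcongr
      _ = _ := by ring
  have hbound : ∀ j, ‖a (j + 1) + b j‖ ≤ Real.exp (-J) *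
      (2 * ‖A u‖ * ‖u‖ * ((e * x) ^ (j + 1) / ((j + 1).factorial : ℝ))
        + t * κ * ‖u‖ ^ 2 * ((e * x) ^ j / (j.factorial : ℝ))) := by
    intro j
    by_cases hj : j < J
    · have : a (j + 1) + b j = 0 := by
        simp only [ha, hb]
        rw [hA u, hcomm j hj, inner_add_right, inner_smul_right, Nat.factorial_succ, pow_succ z]
        generalize inner ℂ u ((T ^ j) u) = p
        generalize inner ℂ u ((T ^ (j + 1)) (A u)) = p'
        have h1 : ((j + 1 : ℕ) : ℂ) ≠ 0 := by exact_mod_cast Nat.succ_ne_zero j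
        have h2 : (j.factorial : ℂ) ≠ 0 := by exact_mod_cast Nat.factorial_ne_zero j
        push_cast at h1 ⊢
        field_simp
        rw [hz]
        linear_combination ((t : ℂ) * ((t : ℂ) * Complex.I) ^ j * κ * p * (j + 1)) * Complex.I_sq
      rw [this, norm_zero]
      have : 0 ≤ e := (Real.exp_pos 1).le
      positivity
    · have hz1 : ∀ i : ℕ, ‖z ^ i / (i.factorial : ℂ)‖ = t ^ i / (i.factorial : ℝ) := by
        intro i; rw [norm_div, norm_pow, hzn, Complex.norm_natCast]
      have e1 : ‖a (j + 1)‖ ≤ 2 * ‖A u‖ * ‖u‖ * (x ^ (j + 1) / ((j + 1).factorial : ℝ)) := by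
        simp only [ha]
        rw [← mul_sub, norm_mul, hz1]
        have i1 : ‖inner ℂ (A u) ((T ^ (j + 1)) u)‖ ≤ ‖A u‖ * (‖T‖ ^ (j + 1) * ‖u‖) :=
          (norm_inner_le_norm _ _).trans (by gcongr; exact norm_pow_apply_le T _ _)
        have i2 : ‖inner ℂ u ((T ^ (j + 1)) (A u))‖ ≤ ‖u‖ * (‖T‖ ^ (j + 1) * ‖A u‖) :=
          (norm_inner_le_norm _ _).trans (by gcongr; exact norm_pow_apply_le T _ _)
        calc _ ≤ t ^ (j + 1) / ((j + 1).factorial : ℝ) *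
              (‖A u‖ * (‖T‖ ^ (j + 1) * ‖u‖) + ‖u‖ * (‖T‖ ^ (j + 1) * ‖A u‖)) := by
              gcongr
              exact (norm_sub_le _ _).trans (add_le_add i1 i2)
          _ = _ := by rw [hx, mul_pow]; ring
      have e2 : ‖b j‖ ≤ t * κ * ‖u‖ ^ 2 * (x ^ j / (j.factorial : ℝ)) := by
        simp only [hb]
        rw [norm_mul, norm_mul, norm_mul (z ^ j / _), hz1, Complex.norm_real, Complex.norm_real,
          Real.norm_of_nonneg ht, Real.norm_of_nonneg hκ]
        have i1 : ‖inner ℂ u ((T ^ j) u)‖ ≤ ‖u‖ * (‖T‖ ^ j * ‖u‖) :=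
          (norm_inner_le_norm _ _).trans (by gcongr; exact norm_pow_apply_le T _ _)
        calc _ ≤ t * κ * (t ^ j / (j.factorial : ℝ) * (‖u‖ * (‖T‖ ^ j * ‖u‖))) := by gcongr
          _ = _ := by rw [hx, mul_pow]; ring
      refine (norm_add_le _ _).trans ((add_le_add e1 e2).trans ?_)
      rw [mul_add, mul_left_comm (Real.exp (-J)), mul_left_comm (Real.exp (-J))]
      gcongr
      · exact hpow _ (by omega)
      · exact hpow _ (by omega)
  have h5 := h3.norm_le_of_bounded h4 hbound
  refine h5.trans ?_
  rw [mul_assoc (Real.exp (-J)), add_mul]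
  gcongr
  simp

/-- Write U = exp(itT). The commutator bounds ⟨u, Uu⟩ by 2‖Au‖‖u‖ / (tκ) up to the error, so a small
Au makes Uu almost orthogonal to u. But U moves u by at most 2‖u - ψ‖ + t‖Tψ‖. Passing through ψ in
this way lets A act on u alone and T on ψ alone. -/
theorem norm_sq_le_of_commutator {A T : H →L[ℂ] H} (hT : IsSelfAdjoint T)
    (hA : ∀ x y, inner ℂ (A x) y = inner ℂ x (A y)) {u ψ : H} {κ t : ℝ} (hκ : 0 < κ) (ht : 0 < t)
    {J : ℕ} (hcomm : ∀ j < J, A ((T ^ (j + 1)) u) =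
      (T ^ (j + 1)) (A u) + (((j + 1 : ℕ) : ℂ) * (Complex.I * κ)) • (T ^ j) u) :
    ‖ψ‖ ^ 2 ≤ 18 * ‖u - ψ‖ ^ 2 + 4 * t ^ 2 * ‖T ψ‖ ^ 2 + 8 * ‖A u‖ ^ 2 / (t * κ) ^ 2 +
      4 * (Real.exp (-J) * (2 * ‖A u‖ * ‖u‖ + t * κ * ‖u‖ ^ 2)
        * Real.exp (Real.exp 1 * (t * ‖T‖))) / (t * κ) := by
  set U := NormedSpace.exp (((t : ℂ) * Complex.I) • T) with hU
  set R := Real.exp (-J) * (2 * ‖A u‖ * ‖u‖ + t * κ * ‖u‖ ^ 2)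
        * Real.exp (Real.exp 1 * (t * ‖T‖)) with hR
  have h1 := norm_inner_exp_commutator_le hA hκ.le ht.le hcomm
  rw [← hU, ← hR] at h1
  have hn : ∀ v, ‖U v‖ = ‖v‖ := fun v => norm_exp_mul_I_smul_apply hT t v
  have htk : 0 < t * κ := by positivity
  have h2 : t * κ * ‖inner ℂ u (U u)‖ ≤ 2 * ‖A u‖ * ‖u‖ + R := by
    have e1 : ‖inner ℂ (A u) (U u)‖ ≤ ‖A u‖ * ‖u‖ := by
      simpa [hn] using norm_inner_le_norm (𝕜 := ℂ) (A u) (U u)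
    have e2 : ‖inner ℂ u (U (A u))‖ ≤ ‖u‖ * ‖A u‖ := by
      simpa [hn] using norm_inner_le_norm (𝕜 := ℂ) u (U (A u))
    have e3 : ‖(t * κ : ℂ) * inner ℂ u (U u)‖ = t * κ * ‖inner ℂ u (U u)‖ := by
      rw [norm_mul, norm_mul, Complex.norm_real, Complex.norm_real, Real.norm_of_nonneg ht.le,
        Real.norm_of_nonneg hκ.le]
    rw [← e3]
    calc _ = ‖(inner ℂ (A u) (U u) - inner ℂ u (U (A u)) + (t * κ : ℂ) * inner ℂ u (U u))
          - inner ℂ (A u) (U u) + inner ℂ u (U (A u))‖ := by congr 1; ring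
      _ ≤ R + ‖A u‖ * ‖u‖ + ‖u‖ * ‖A u‖ :=
        (norm_add_le _ _).trans (add_le_add ((norm_sub_le _ _).trans (add_le_add h1 e1)) e2)
      _ = _ := by ring
  have h3 : ‖U u - u‖ ≤ 2 * ‖u - ψ‖ + t * ‖T ψ‖ := by
    calc ‖U u - u‖ = ‖U (u - ψ) + (U ψ - ψ) - (u - ψ)‖ := by congr 1; rw [map_sub]; abel
      _ ≤ ‖U (u - ψ)‖ + ‖U ψ - ψ‖ + ‖u - ψ‖ :=
        (norm_sub_le _ _).trans (add_le_add (norm_add_le _ _) le_rfl)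
      _ ≤ ‖u - ψ‖ + t * ‖T ψ‖ + ‖u - ψ‖ := by
        rw [hn]; gcongr; exact norm_exp_mul_I_smul_apply_sub_le hT ht.le ψ
      _ = _ := by ring
  have h4 : ‖U u - u‖ ^ 2 = 2 * ‖u‖ ^ 2 - 2 * RCLike.re (inner ℂ u (U u)) := by
    rw [@norm_sub_sq ℂ, hn, inner_re_symm]; ring
  have h5 : RCLike.re (inner ℂ u (U u)) ≤ ‖inner ℂ u (U u)‖ := RCLike.re_le_norm _
  set q := ‖inner ℂ u (U u)‖
  set s := 2 * ‖A u‖ / (t * κ) with hs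
  have h6 : q ≤ s * ‖u‖ + R / (t * κ) := by
    rw [hs, div_mul_eq_mul_div, ← add_div, le_div_iff₀ htk]; linarith
  have h7 : 8 * ‖A u‖ ^ 2 / (t * κ) ^ 2 = 2 * s ^ 2 := by rw [hs]; ring
  have h8 : 4 * R / (t * κ) = 4 * (R / (t * κ)) := by ring
  rw [h7, h8]
  have h9 : ‖U u - u‖ ^ 2 ≤ (2 * ‖u - ψ‖ + t * ‖T ψ‖) ^ 2 := by gcongr
  have h10 : ‖ψ‖ ≤ ‖u‖ + ‖u - ψ‖ := by
    calc ‖ψ‖ = ‖u - (u - ψ)‖ := by congr 1; abel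
      _ ≤ _ := norm_sub_le _ _
  have h11 : ‖ψ‖ ^ 2 ≤ (‖u‖ + ‖u - ψ‖) ^ 2 := by gcongr
  -- With d = ‖u - ψ‖: 2‖u‖² = ‖Uu - u‖² + 2 Re⟨u, Uu⟩ ≤ 8d² + 2t²‖Tψ‖² + 2s‖u‖ + 2R/(tκ). Absorb
  -- 2s‖u‖ ≤ ‖u‖² + s², double, and use ‖ψ‖² ≤ 2‖u‖² + 2d².
  nlinarith [sq_nonneg (‖u‖ - ‖u - ψ‖), sq_nonneg (2 * ‖u - ψ‖ - t * ‖T ψ‖), sq_nonneg (‖u‖ - s)]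

end UnitaryGroup

/-! ### Passage from truncated to unbounded fields -/

section FieldDomain

variable {L Λ : ℝ}

theorem hasSum_norm_annihilate_sq_iff (m : Mode L Λ) (f : Occ L Λ → ℂ) (s : ℝ) :
    HasSum (fun n => ‖annihilate m f n‖ ^ 2) s ↔ HasSum (fun n => (n m : ℝ) * ‖f n‖ ^ 2) s := by
  have hinj : Function.Injective fun n : Occ L Λ => n + Finsupp.single m 1 := add_left_injective _
  rw [← hinj.hasSum_iff (f := fun n => (n m : ℝ) * ‖f n‖ ^ 2)]
  · have : (fun n => ‖annihilate m f n‖ ^ 2) =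
        (fun n : Occ L Λ => (n m : ℝ) * ‖f n‖ ^ 2) ∘ fun n : Occ L Λ => n + Finsupp.single m 1 := by
      funext n
      simp only [annihilate, Function.comp_apply, norm_mul, mul_pow, Complex.norm_real,
        Real.norm_eq_abs, sq_abs, Finsupp.coe_add, Pi.add_apply, Finsupp.single_eq_same]
      rw [Real.sq_sqrt (by positivity)]
      push_cast; rfl
    rw [this]
  · intro n hn
    by_cases h : n m = 0
    · simp [h]
    · exact absurd ⟨n - Finsupp.single m 1, occ_sub_add_cancel n h⟩ hn

theorem hasSum_norm_create_sq_iff (m : Mode L Λ) (f : Occ L Λ → ℂ) (s : ℝ) :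
    HasSum (fun n => ‖create m f n‖ ^ 2) s ↔
      HasSum (fun n => ((n m : ℝ) + 1) * ‖f n‖ ^ 2) s := by
  have hinj : Function.Injective fun n : Occ L Λ => n + Finsupp.single m 1 := add_left_injective _
  rw [← hinj.hasSum_iff (f := fun n => ‖create m f n‖ ^ 2)]
  · have : (fun n : Occ L Λ => ‖create m f n‖ ^ 2) ∘ (fun n : Occ L Λ => n + Finsupp.single m 1) =
        (fun n : Occ L Λ => ((n m : ℝ) + 1) * ‖f n‖ ^ 2) := by
      funext n
      simp only [create, Function.comp_apply, norm_mul, mul_pow, Complex.norm_real,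
        Real.norm_eq_abs, sq_abs, Finsupp.coe_add, Pi.add_apply, Finsupp.single_eq_same,
        add_tsub_cancel_right]
      rw [Real.sq_sqrt (by positivity)]
      push_cast; rfl
    rw [this]
  · intro n hn
    by_cases h : n m = 0
    · simp [create, h]
    · exact absurd ⟨n - Finsupp.single m 1, occ_sub_add_cancel n h⟩ hn

/-- The canonical commutation relation `‖a* f‖² = ‖a f‖² + ‖f‖²` for the norms. -/
theorem hasSum_norm_create_sq {m : Mode L Λ} {f : Occ L Λ → ℂ} {s t : ℝ}
    (hf : HasSum (fun n => ‖f n‖ ^ 2) s) (ha : HasSum (fun n => ‖annihilate m f n‖ ^ 2) t) :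
    HasSum (fun n => ‖create m f n‖ ^ 2) (t + s) := by
  rw [hasSum_norm_create_sq_iff]
  rw [hasSum_norm_annihilate_sq_iff] at ha
  convert ha.add hf using 2 with n
  ring

/-- The common domain of all annihilation operators. -/
def InDomain (f : Fock L Λ) : Prop := ∀ m, Memℓp (annihilate m (f : Occ L Λ → ℂ)) 2

theorem InDomain.memℓp_create {f : Fock L Λ} (hf : InDomain f) (m : Mode L Λ) :
    Memℓp (create m (f : Occ L Λ → ℂ)) 2 :=
  memℓp_two_iff.2 (hasSum_norm_create_sq (lp_hasSum_norm_sq f)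
    (memℓp_two_iff.1 (hf m)).hasSum).summable

theorem exists_truncate (M : ℕ) :
    ∃ T : Fock L Λ →L[ℂ] Fock L Λ,
      (∀ f n, T f n = (if n.degree < M then (1 : ℂ) else 0) * f n) ∧ ‖T‖ ≤ 1 :=
  exists_weightedShift _ id zero_le_one (fun n => by split_ifs <;> simp)
    Function.injective_id.injOn

/-- The projection to occupation numbers with total less than `M`. -/
def truncate (M : ℕ) : Fock L Λ →L[ℂ] Fock L Λ := (exists_truncate M).choose

theorem truncate_apply (M : ℕ) (f : Fock L Λ) (n : Occ L Λ) :
    truncate M f n = (if n.degree < M then (1 : ℂ) else 0) * f n :=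
  (exists_truncate M).choose_spec.1 f n

theorem degreeLT_truncate (M : ℕ) (f : Fock L Λ) : DegreeLT M (truncate M f : Occ L Λ → ℂ) := by
  intro n hn
  rw [truncate_apply, if_neg (by omega), zero_mul]

theorem tendsto_truncate (f : Fock L Λ) :
    Filter.Tendsto (fun M => truncate M f) Filter.atTop (nhds f) := by
  rw [tendsto_iff_norm_sub_tendsto_zero]
  have h : ∀ M, ‖truncate M f - f‖ = Real.sqrt (∑' n, ‖(truncate M f - f) n‖ ^ 2) := fun M => by
    rw [(lp_hasSum_norm_sq _).tsum_eq, Real.sqrt_sq (norm_nonneg _)]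
  simp only [h]
  rw [← Real.sqrt_zero]
  refine (Real.continuous_sqrt.tendsto 0).comp ?_
  rw [← tsum_zero (α := ℝ) (β := Occ L Λ)]
  refine tendsto_tsum_of_dominated_convergence (lp_hasSum_norm_sq f).summable (fun n => ?_) ?_
  · refine tendsto_const_nhds.congr' ?_
    filter_upwards [Filter.eventually_gt_atTop n.degree] with M hM
    simp [truncate_apply, hM]
  · refine Filter.Eventually.of_forall fun M n => ?_
    simp only [lp.coeFn_sub, Pi.sub_apply, truncate_apply]
    split_ifs <;> simp

theorem annihilate_truncate (M : ℕ) (m : Mode L Λ) {f : Fock L Λ} (af : Fock L Λ)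
    (h : (af : Occ L Λ → ℂ) = annihilate m f) :
    annihilate m (truncate (M + 1) f : Occ L Λ → ℂ) = truncate M af := by
  funext n
  rw [truncate_apply, h, annihilate, annihilate, truncate_apply, degree_add_single]
  simp

theorem create_truncate (M : ℕ) (m : Mode L Λ) {f : Fock L Λ} (cf : Fock L Λ)
    (h : (cf : Occ L Λ → ℂ) = create m f) :
    create m (truncate M f : Occ L Λ → ℂ) = truncate (M + 1) cf := by
  funext n
  rw [truncate_apply, h, create, create, truncate_apply]
  by_cases h0 : n m = 0
  · simp [h0]
  · have := degree_sub_single n h0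
    rw [mul_left_comm]
    congr 2
    simp; omega

variable [Fintype (Mode L Λ)]

/-- Truncation commutes with `annihilate` and `create` up to a shift of the level by one, so a field
of a truncated vector is a combination of truncations of the vectors a_m f and a*_m f, each of which
converges. -/
theorem tendsto_truncField_truncate {f : Fock L Λ} (hf : InDomain f) (b c : Mode L Λ → ℂ)
    {v : Fock L Λ} (hv : (v : Occ L Λ → ℂ) = field b c f) :
    Filter.Tendsto (fun M => truncField (M + 1) b c (truncate (M + 1) f)) Filter.atTop (nhds v) := by
  set af : Mode L Λ → Fock L Λ := fun m => ⟨_, hf m⟩ with haf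
  set cf : Mode L Λ → Fock L Λ := fun m => ⟨_, hf.memℓp_create m⟩ with hcf
  have h1 : ∀ M, truncField (M + 1) b c (truncate (M + 1) f) =
      ∑ m, (b m • truncate M (af m) + c m • truncate (M + 1 + 1) (cf m)) := by
    intro M
    apply lp.ext
    rw [truncField_coe le_rfl (degreeLT_truncate _ _), field, lp.coeFn_sum]
    refine Finset.sum_congr rfl fun m _ => ?_
    rw [annihilate_truncate M m (af m) rfl, create_truncate (M + 1) m (cf m) rfl]
    rfl
  have h2 : v = ∑ m, (b m • af m + c m • cf m) := by
    apply lp.ext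
    rw [hv, field, lp.coeFn_sum]
    rfl
  simp only [h1]
  rw [h2]
  refine tendsto_finsetSum _ fun m _ => ?_
  exact ((tendsto_truncate _).const_smul _).add
    (((Filter.tendsto_add_atTop_iff_nat 2).2 (tendsto_truncate (cf m))).const_smul _)

theorem iterate_field_comm {b c b' c' : Mode L Λ → ℂ} {z : ℂ}
    (hz : ∑ m, (b m * c' m - c m * b' m) = z) (f : Occ L Λ → ℂ) (j : ℕ) :
    field b c ((field b' c')^[j + 1] f) =
      (field b' c')^[j + 1] (field b c f) + (((j + 1 : ℕ) : ℂ) * z) • (field b' c')^[j] f := by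
  induction j with
  | zero => simp [field_comm b c b' c', hz]
  | succ j ih =>
    rw [Function.iterate_succ_apply', field_comm, hz, ih, field_add, field_smul,
      ← Function.iterate_succ_apply' (field b' c'), ← Function.iterate_succ_apply' (field b' c'),
      add_assoc, ← add_smul]
    congr 2
    push_cast; ring

/-- Every application raises the degree bound by one. The j-th one acts on a vector with bound M + j
- 1, which must not exceed N. -/
theorem truncField_pow_coe {b c : Mode L Λ → ℂ} {M N : ℕ} {f : Fock L Λ}
    (hf : DegreeLT M (f : Occ L Λ → ℂ)) (j : ℕ) (hj : M + j ≤ N + 1) :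
    DegreeLT (M + j) (((truncField N b c) ^ j) f : Occ L Λ → ℂ) ∧
      (((truncField N b c) ^ j) f : Occ L Λ → ℂ) = (field b c)^[j] f := by
  induction j with
  | zero => exact ⟨hf, rfl⟩
  | succ j ih =>
    obtain ⟨h1, h2⟩ := ih (by omega)
    have h3 : (((truncField N b c) ^ (j + 1)) f : Occ L Λ → ℂ) =
        field b c (((truncField N b c) ^ j) f) := by
      rw [pow_succ', mul_apply_eq_comp]
      exact truncField_coe (by omega) h1 b c
    refine ⟨?_, ?_⟩
    · rw [h3]; exact h1.field b c
    · rw [h3, h2, Function.iterate_succ_apply']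

/-- Uncertainty relation for two vectors `u`, `ψ` with finitely many occupation numbers. -/
theorem norm_sq_le_of_degreeLT {F g : Mode L Λ → ℂ} {κ t : ℝ} (hκ : 0 < κ) (ht : 0 < t)
    (hFg : ∑ m, 2 * (star (F m) * g m).re = κ) {M : ℕ} {u ψ : Fock L Λ}
    (hu : DegreeLT M (u : Occ L Λ → ℂ)) (hψ : DegreeLT M (ψ : Occ L Λ → ℂ)) :
    ‖ψ‖ ^ 2 ≤ 18 * ‖u - ψ‖ ^ 2
      + 4 * t ^ 2 * ‖truncField M (fun m => -Complex.I * star (g m)) (fun m => Complex.I * g m) ψ‖ ^ 2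
      + 8 * ‖truncField M (fun m => star (F m)) F u‖ ^ 2 / (t * κ) ^ 2 := by
  set bT : Mode L Λ → ℂ := fun m => -Complex.I * star (g m) with hbT
  set cT : Mode L Λ → ℂ := fun m => Complex.I * g m with hcT
  set bA : Mode L Λ → ℂ := fun m => star (F m) with hbA
  have hz : ∑ m, (bA m * cT m - F m * bT m) = Complex.I * κ := by
    rw [← hFg, Complex.ofReal_sum, Finset.mul_sum]
    refine Finset.sum_congr rfl fun m _ => ?_
    have : ((2 * (star (F m) * g m).re : ℝ) : ℂ) = star (F m) * g m + star (star (F m) * g m) := by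
      rw [← RCLike.re_eq_complex_re]
      have := RCLike.add_conj (star (F m) * g m)
      rw [starRingEnd_apply] at this
      rw [this]; push_cast; rfl
    rw [this, hbA, hbT, hcT]
    simp
    ring
  have hTs : ∀ N, IsSelfAdjoint (truncField N bT cT) := fun N => by
    rw [ContinuousLinearMap.isSelfAdjoint_iff_isSymmetric]
    intro x y
    exact inner_truncField N (fun m => by simp [hbT, hcT]) x y
  have hAs : ∀ N x y, inner ℂ (truncField N bA F x) y = inner ℂ x (truncField N bA F y) :=
    fun N x y => inner_truncField N (fun m => rfl) x y
  have hAu : ∀ N, M ≤ N → truncField N bA F u = truncField M bA F u := fun N hN =>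
    lp.ext ((truncField_coe hN hu _ _).trans (truncField_coe le_rfl hu _ _).symm)
  have hTψ : ∀ N, M ≤ N → truncField N bT cT ψ = truncField M bT cT ψ := fun N hN =>
    lp.ext ((truncField_coe hN hψ _ _).trans (truncField_coe le_rfl hψ _ _).symm)
  have hcomm : ∀ N, M ≤ N → ∀ j < N - M, truncField N bA F (((truncField N bT cT) ^ (j + 1)) u) =
      ((truncField N bT cT) ^ (j + 1)) (truncField N bA F u)
        + (((j + 1 : ℕ) : ℂ) * (Complex.I * κ)) • ((truncField N bT cT) ^ j) u := by
    intro N hN j hj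
    have hAu1 : DegreeLT (M + 1) (truncField N bA F u : Occ L Λ → ℂ) := by
      rw [truncField_coe hN hu]; exact hu.field _ _
    apply lp.ext
    rw [lp.coeFn_add, lp.coeFn_smul,
      truncField_coe (by omega) (truncField_pow_coe hu (j + 1) (by omega)).1,
      (truncField_pow_coe hu (j + 1) (by omega)).2, (truncField_pow_coe hu j (by omega)).2,
      (truncField_pow_coe hAu1 (j + 1) (by omega)).2, truncField_coe hN hu,
      iterate_field_comm hz]
  set C := ∑ m, (‖bT m‖ + ‖cT m‖) with hC
  have hC0 : 0 ≤ C := Finset.sum_nonneg fun m _ => by positivity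
  set X := 2 * ‖truncField M bA F u‖ * ‖u‖ + t * κ * ‖u‖ ^ 2 with hX
  have hX0 : 0 ≤ X := by positivity
  set K := Real.exp 1 * (t * C) with hK
  -- The commutator lemma is used with J = N - M and N → ∞. Since ‖T‖ grows only like √N, its error
  -- contains exp(M - N + K√N), and K√N ≤ N/2 + K²/2.
  have hlim : Filter.Tendsto (fun N : ℕ => 4 * (X * Real.exp (M + K ^ 2 / 2)) / (t * κ) *
      Real.exp (-((N : ℝ) / 2))) Filter.atTop (nhds 0) := by
    rw [← mul_zero (4 * (X * Real.exp (M + K ^ 2 / 2)) / (t * κ))]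
    refine Filter.Tendsto.const_mul _ (Real.tendsto_exp_neg_atTop_nhds_zero.comp ?_)
    exact tendsto_natCast_atTop_atTop.atTop_div_const (by norm_num)
  rw [← add_zero (_ + _ + _)]
  refine ge_of_tendsto (tendsto_const_nhds.add hlim) ?_
  filter_upwards [Filter.eventually_ge_atTop M] with N hN
  have h := norm_sq_le_of_commutator (ψ := ψ) (hTs N) (hAs N) hκ ht (hcomm N hN)
  rw [hAu N hN, hTψ N hN] at h
  refine h.trans ?_
  gcongr
  have hTn : Real.exp 1 * (t * ‖truncField N bT cT‖) ≤ (N : ℝ) / 2 + K ^ 2 / 2 := by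
    calc Real.exp 1 * (t * ‖truncField N bT cT‖) ≤ Real.exp 1 * (t * (C * Real.sqrt N)) := by
          gcongr; exact norm_truncField_le N bT cT
      _ = K * Real.sqrt N := by rw [hK]; ring
      _ ≤ _ := by
        have := Real.sq_sqrt (Nat.cast_nonneg N : (0 : ℝ) ≤ N)
        nlinarith [sq_nonneg (K - Real.sqrt N)]
  rw [← hX, div_mul_eq_mul_div, mul_assoc 4, mul_comm (Real.exp _) X, mul_assoc X, mul_assoc X,
    ← Real.exp_add, ← Real.exp_add]
  have he := Real.exp_le_exp.2 (show -((N - M : ℕ) : ℝ) + Real.exp 1 * (t * ‖truncField N bT cT‖) ≤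
    M + K ^ 2 / 2 + -((N : ℝ) / 2) by rw [Nat.cast_sub hN]; linarith)
  gcongr 4 * (X * ?_) / (t * κ)

/-- Uncertainty relation: if `A(F) u` is small for some `u` close to `ψ`, then the conjugate
field of `g` is large in the state `ψ`. -/
theorem norm_sq_le_of_inDomain {F g : Mode L Λ → ℂ} {κ t : ℝ} (hκ : 0 < κ) (ht : 0 < t)
    (hFg : ∑ m, 2 * (star (F m) * g m).re = κ) {u ψ au pψ : Fock L Λ}
    (hu : InDomain u) (hψ : InDomain ψ)
    (hau : (au : Occ L Λ → ℂ) = field (fun m => star (F m)) F u)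
    (hpψ : (pψ : Occ L Λ → ℂ) =
      field (fun m => -Complex.I * star (g m)) (fun m => Complex.I * g m) ψ) :
    ‖ψ‖ ^ 2 ≤ 18 * ‖u - ψ‖ ^ 2 + 4 * t ^ 2 * ‖pψ‖ ^ 2 + 8 * ‖au‖ ^ 2 / (t * κ) ^ 2 := by
  have tr : ∀ f : Fock L Λ, Filter.Tendsto (fun M : ℕ => truncate (M + 1) f) Filter.atTop (nhds f) :=
    fun f => (Filter.tendsto_add_atTop_iff_nat 1).2 (tendsto_truncate f)
  have h1 := ((tr ψ).norm.pow 2)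
  have h2 := ((((tr u).sub (tr ψ)).norm.pow 2).const_mul 18).add
    (((tendsto_truncField_truncate hψ _ _ hpψ).norm.pow 2).const_mul (4 * t ^ 2))
  have h3 := h2.add ((((tendsto_truncField_truncate hu _ _ hau).norm.pow 2).const_mul 8).div_const
    ((t * κ) ^ 2))
  exact le_of_tendsto_of_tendsto' h1 h3 fun M =>
    norm_sq_le_of_degreeLT hκ ht hFg (degreeLT_truncate _ _) (degreeLT_truncate _ _)

end FieldDomain

/-! ### Translations and the kinetic energy -/

section Translation

variable {L Λ : ℝ}

/-- The translate `x ↦ Ψ (x + y)`. -/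
def translate (y : Space) (Ψ : StateSpace L Λ) : StateSpace L Λ :=
  Lp.compMeasurePreserving (fun x => x + y) (measurePreserving_add_right volume y) Ψ

theorem translate_ae_eq (y : Space) (Ψ : StateSpace L Λ) :
    translate y Ψ =ᵐ[volume] fun x => Ψ (x + y) :=
  Lp.coeFn_compMeasurePreserving _ _

theorem norm_translate (y : Space) (Ψ : StateSpace L Λ) : ‖translate y Ψ‖ = ‖Ψ‖ :=
  Lp.norm_compMeasurePreserving _ _

theorem continuous_translate (Ψ : StateSpace L Λ) : Continuous fun y => translate y Ψ := by
  let g : C(Space, C(Space, Space)) :=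
    (ContinuousMap.mk (fun a : Space × Space => a.2 + a.1) (by fun_prop)).curry
  exact continuous_const.compMeasurePreservingLp (f := fun _ : Space => Ψ) g.continuous
    (fun y => measurePreserving_add_right volume y) (by norm_num)

theorem translate_add (y z : Space) (Ψ : StateSpace L Λ) :
    translate (y + z) Ψ = translate y (translate z Ψ) := by
  apply Lp.ext
  filter_upwards [translate_ae_eq (y + z) Ψ, translate_ae_eq y (translate z Ψ),
    (measurePreserving_add_right volume y).quasiMeasurePreserving.ae (translate_ae_eq z Ψ)]
    with x h1 h2 h3
  rw [h1, h2, h3, add_assoc]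

theorem locallyIntegrable_state (Ψ : StateSpace L Λ) : LocallyIntegrable Ψ volume :=
  (Lp.memLp Ψ).locallyIntegrable (by norm_num)

/-- Integration of a state against a test function. -/
def testIntegral (φ : Lp ℝ 2 (volume : Measure Space)) : StateSpace L Λ →L[ℝ] Fock L Λ :=
  (ContinuousLinearMap.lsmul ℝ ℝ : ℝ →L[ℝ] Fock L Λ →L[ℝ] Fock L Λ).lpPairing volume 2 2 φ

theorem testIntegral_eq {φ : Space → ℝ} (hφ : MemLp φ 2 volume) (Ψ : StateSpace L Λ) :
    testIntegral (hφ.toLp φ) Ψ = ∫ x, φ x • Ψ x := by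
  rw [testIntegral, ContinuousLinearMap.lpPairing_eq_integral]
  refine integral_congr_ae ?_
  filter_upwards [hφ.coeFn_toLp] with x hx
  simp [hx]

theorem integral_smul_translate (φ : Space → ℝ) (y : Space) (Ψ : StateSpace L Λ) :
    ∫ x, φ x • translate y Ψ x = ∫ x, φ (x - y) • Ψ x := by
  rw [integral_congr_ae (g := fun x => φ x • Ψ (x + y))
    ((translate_ae_eq y Ψ).mono fun x hx => by simp only [hx])]
  rw [← integral_add_right_eq_self (fun x => φ (x - y) • Ψ x) y]
  simp

/-- Moving the translation to the test function gives a convolution of Ψ with a smooth compactly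
supported function. The derivative falls on the latter, and the weak formulation in `IsMomentum`
returns it to Ψ. -/
theorem hasDerivAt_integral_translate {j : Fin 3} {Ψ Φ : StateSpace L Λ} (h : IsMomentum j Ψ Φ)
    {φ : Space → ℝ} (hφ : ContDiff ℝ ∞ φ) (hc : HasCompactSupport φ) (s : ℝ) :
    HasDerivAt (fun s : ℝ => ∫ x, φ x • translate (s • EuclideanSpace.single j 1) Ψ x)
      (Complex.I • ∫ x, φ x • translate (s • EuclideanSpace.single j 1) Φ x) s := by
  set e : Space := EuclideanSpace.single j 1 with he
  simp only [integral_smul_translate]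
  set B : Fock L Λ →L[ℝ] ℝ →L[ℝ] Fock L Λ := (ContinuousLinearMap.lsmul ℝ ℝ).flip with hB
  set g : Space → ℝ := fun x => φ (-x) with hg
  have hgd : ContDiff ℝ ∞ g := hφ.comp contDiff_neg
  have hgc : HasCompactSupport g := hc.comp_homeomorph (Homeomorph.neg Space)
  have h1 := hgc.hasFDerivAt_convolution_right B (locallyIntegrable_state Ψ)
    (hgd.of_le (by exact_mod_cast le_top)) (s • e)
  have h2 := h1.comp_hasDerivAt s ((hasDerivAt_id s).smul_const e)
  rw [convolution_precompR_apply B (locallyIntegrable_state Ψ) (hgc.fderiv ℝ)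
    (hgd.continuous_fderiv (by simp))] at h2
  have hfun : (convolution Ψ g B volume ∘ fun y : ℝ => id y • e) =
      fun s : ℝ => ∫ x, φ (x - s • e) • Ψ x := by
    funext r
    simp [convolution_def, hB, hg]
  rw [hfun] at h2
  refine h2.congr_deriv ?_
  have hφs : ContDiff ℝ ∞ fun x => ((φ (x - s • e) : ℝ) : ℂ) :=
    Complex.ofRealCLM.contDiff.comp (hφ.comp (contDiff_id.sub contDiff_const))
  have hcs : HasCompactSupport fun x => ((φ (x - s • e) : ℝ) : ℂ) := by
    have : HasCompactSupport fun x => φ (x - s • e) :=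
      hc.comp_homeomorph (Homeomorph.subRight (s • e))
    exact this.comp_left (g := fun r : ℝ => (r : ℂ)) (by simp)
  have h3 := h _ hφs hcs
  have hfd : ∀ x, fderiv ℝ (fun x => ((φ (x - s • e) : ℝ) : ℂ)) x e =
      ((fderiv ℝ φ (x - s • e) e : ℝ) : ℂ) := by
    intro x
    have h5 : HasFDerivAt (fun x => φ (x - s • e)) (fderiv ℝ φ (x - s • e)) x := by
      have h6 := (hφ.differentiable (by simp) (x - s • e)).hasFDerivAt
      exact (h6.comp x ((hasFDerivAt_id x).sub_const (s • e))).congr_fderiv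
        (ContinuousLinearMap.comp_id _)
    have := (Complex.ofRealCLM.hasFDerivAt (x := φ (x - s • e))).comp x h5
    rw [show (fun x => ((φ (x - s • e) : ℝ) : ℂ)) =
      Complex.ofRealCLM ∘ fun x => φ (x - s • e) from rfl, this.fderiv]
    rfl
  have hgfd : ∀ x, fderiv ℝ g x e = -(fderiv ℝ φ (-x) e) := by
    intro x
    have h6 := (hφ.differentiable (by simp) (-x)).hasFDerivAt.comp x (hasFDerivAt_id x).neg
    have h7 : HasFDerivAt g _ x := h6
    rw [h7.fderiv]
    simp
  simp only [← he, hfd, Complex.coe_smul] at h3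
  refine Eq.trans ?_ (congrArg (Complex.I • ·) h3.symm)
  rw [smul_smul, Complex.I_mul_I, neg_one_smul, ← integral_neg, one_smul, convolution_def]
  refine integral_congr_ae (Filter.Eventually.of_forall fun x => ?_)
  simp [hB, hgfd]
  rfl

/-- The difference is i times the L²-valued integral of the translates of Φ over [0, t], as one sees
by testing against smooth functions. Translations are isometric, so the integrand has norm ‖Φ‖. -/
theorem norm_translate_single_sub_le {j : Fin 3} {Ψ Φ : StateSpace L Λ} (h : IsMomentum j Ψ Φ)
    {t : ℝ} (ht : 0 ≤ t) :
    ‖translate (t • EuclideanSpace.single j 1) Ψ - Ψ‖ ≤ t * ‖Φ‖ := by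
  set e : Space := EuclideanSpace.single j 1 with he
  have hcont : Continuous fun s : ℝ => translate (s • e) Φ :=
    (continuous_translate Φ).comp (continuous_id.smul continuous_const)
  have hz : translate (0 : Space) Ψ = Ψ := by
    apply Lp.ext
    filter_upwards [translate_ae_eq 0 Ψ] with x hx
    rw [hx, add_zero]
  have key : translate (t • e) Ψ - Ψ = Complex.I • ∫ s in (0 : ℝ)..t, translate (s • e) Φ := by
    apply Lp.ext
    refine ae_eq_of_integral_contDiff_smul_eq (locallyIntegrable_state _)
      (locallyIntegrable_state _) fun φ hφ hc => ?_
    have hφ2 : MemLp φ 2 volume := hφ.continuous.memLp_of_hasCompactSupport hc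
    rw [← testIntegral_eq hφ2, ← testIntegral_eq hφ2]
    have hI : testIntegral (L := L) (Λ := Λ) (hφ2.toLp φ)
        (Complex.I • ∫ s in (0 : ℝ)..t, translate (s • e) Φ) =
        Complex.I • testIntegral (hφ2.toLp φ) (∫ s in (0 : ℝ)..t, translate (s • e) Φ) := by
      rw [testIntegral_eq, testIntegral_eq, ← integral_smul]
      refine integral_congr_ae ?_
      filter_upwards [Lp.coeFn_smul Complex.I (∫ s in (0 : ℝ)..t, translate (s • e) Φ)] with x hx
      rw [hx, Pi.smul_apply, smul_comm]
    rw [hI, ← ContinuousLinearMap.intervalIntegral_comp_comm _ (hcont.intervalIntegrable _ _),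
      ← intervalIntegral.integral_smul, map_sub]
    have hd : ∀ s, HasDerivAt (fun s : ℝ => testIntegral (hφ2.toLp φ) (translate (s • e) Ψ))
        (Complex.I • testIntegral (hφ2.toLp φ) (translate (s • e) Φ)) s := by
      intro s
      simp only [testIntegral_eq]
      exact hasDerivAt_integral_translate h hφ hc s
    rw [intervalIntegral.integral_eq_sub_of_hasDerivAt (fun s _ => hd s)]
    · simp [hz]
    · exact (((testIntegral (hφ2.toLp φ)).continuous.comp hcont).const_smul
        Complex.I).intervalIntegrable _ _
  rw [key, norm_smul, Complex.norm_I, one_mul]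
  have := intervalIntegral.norm_integral_le_of_norm_le_const (a := 0) (b := t) (C := ‖Φ‖)
    (f := fun s : ℝ => translate (s • e) Φ) (fun s _ => (norm_translate _ _).le)
  rwa [sub_zero, abs_of_nonneg ht, mul_comm] at this

theorem norm_translate_sub_sq_le {Ψ : StateSpace L Λ} {P : Fin 3 → StateSpace L Λ}
    (h : ∀ j, IsMomentum j Ψ (P j)) {y : Space} {ℓ : ℝ} (hy : ∀ j, y j ∈ Set.Icc 0 ℓ) :
    ‖translate y Ψ - Ψ‖ ^ 2 ≤ 3 * ℓ ^ 2 * ∑ j, ‖P j‖ ^ 2 := by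
  have hℓ : 0 ≤ ℓ := (hy 0).1.trans (hy 0).2
  have hys : y = y 0 • EuclideanSpace.single 0 1 + (y 1 • EuclideanSpace.single 1 1 +
      y 2 • EuclideanSpace.single 2 1) := by
    ext i; fin_cases i <;> simp
  have hj : ∀ j, ‖translate (y j • EuclideanSpace.single j 1) Ψ - Ψ‖ ≤ ℓ * ‖P j‖ := fun j =>
    (norm_translate_single_sub_le (h j) (hy j).1).trans
      (mul_le_mul_of_nonneg_right (hy j).2 (norm_nonneg _))
  have hsub : ∀ z (A B : StateSpace L Λ), translate z (A - B) = translate z A - translate z B :=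
    fun z A B => map_sub (Lp.compMeasurePreserving _ _) A B
  have hstep : ∀ z w, ‖translate (z + w) Ψ - Ψ‖ ≤ ‖translate z Ψ - Ψ‖ + ‖translate w Ψ - Ψ‖ := by
    intro z w
    calc ‖translate (z + w) Ψ - Ψ‖ = ‖translate z (translate w Ψ - Ψ) + (translate z Ψ - Ψ)‖ := by
          rw [translate_add, hsub]; congr 1; abel
      _ ≤ _ := (norm_add_le _ _).trans (by rw [norm_translate, add_comm])
  have hle : ‖translate y Ψ - Ψ‖ ≤ ℓ * (‖P 0‖ + ‖P 1‖ + ‖P 2‖) := by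
    rw [hys]
    refine (hstep _ _).trans ((add_le_add (hj 0) ((hstep _ _).trans
      (add_le_add (hj 1) (hj 2)))).trans (le_of_eq ?_))
    ring
  rw [Fin.sum_univ_three]
  calc ‖translate y Ψ - Ψ‖ ^ 2 ≤ (ℓ * (‖P 0‖ + ‖P 1‖ + ‖P 2‖)) ^ 2 := by gcongr
    _ = ℓ ^ 2 * (‖P 0‖ + ‖P 1‖ + ‖P 2‖) ^ 2 := by ring
    _ ≤ ℓ ^ 2 * (3 * (‖P 0‖ ^ 2 + ‖P 1‖ ^ 2 + ‖P 2‖ ^ 2)) := by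
      gcongr
      nlinarith [sq_nonneg (‖P 0‖ - ‖P 1‖), sq_nonneg (‖P 1‖ - ‖P 2‖), sq_nonneg (‖P 0‖ - ‖P 2‖)]
    _ = _ := by ring

end Translation

/-! ### Commutation relations in terms of norms -/

section Commutation

variable {L Λ : ℝ}

theorem inner_self_eq_ofReal (v : Fock L Λ) : inner ℂ v v = ((‖v‖ ^ 2 : ℝ) : ℂ) := by
  rw [inner_self_eq_norm_sq_to_K]; push_cast; rfl

/-- The vector `a_m f`. -/
def InDomain.ann {f : Fock L Λ} (hf : InDomain f) (m : Mode L Λ) : Fock L Λ := ⟨_, hf m⟩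

/-- The vector `a*_m f`. -/
def InDomain.cre {f : Fock L Λ} (hf : InDomain f) (m : Mode L Λ) : Fock L Λ :=
  ⟨_, hf.memℓp_create m⟩

theorem InDomain.coe_ann {f : Fock L Λ} (hf : InDomain f) (m : Mode L Λ) :
    (hf.ann m : Occ L Λ → ℂ) = annihilate m f := rfl

theorem InDomain.coe_cre {f : Fock L Λ} (hf : InDomain f) (m : Mode L Λ) :
    (hf.cre m : Occ L Λ → ℂ) = create m f := rfl

/-- For f in the common domain, a_i a*_j f need not be square summable. The relation is therefore
obtained by shifting the summation index by e_i + e_j rather than by moving operators across the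
inner product. -/
theorem InDomain.inner_cre_cre_of_ne {f : Fock L Λ} (hf : InDomain f) {i j : Mode L Λ}
    (hij : i ≠ j) : inner ℂ (hf.cre i) (hf.cre j) = inner ℂ (hf.ann j) (hf.ann i) := by
  classical
  rw [lp.inner_eq_tsum, lp.inner_eq_tsum]
  have hinj : Function.Injective fun n : Occ L Λ => n + Finsupp.single i 1 + Finsupp.single j 1 :=
    (add_left_injective _).comp (add_left_injective _)
  rw [← hinj.tsum_eq]
  · refine tsum_congr fun n => ?_
    have e1 : n + Finsupp.single i 1 + Finsupp.single j 1 - Finsupp.single i 1 =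
        n + Finsupp.single j 1 := by rw [add_right_comm, add_tsub_cancel_right]
    simp only [hf.coe_ann, hf.coe_cre, annihilate, create, e1, add_tsub_cancel_right,
      Finsupp.coe_add, Pi.add_apply, Finsupp.single_eq_same, Finsupp.single_eq_of_ne hij,
      Finsupp.single_eq_of_ne hij.symm, add_zero, RCLike.inner_apply]
    push_cast
    simp only [map_mul, Complex.conj_ofReal]
    ring
  · intro n hn
    have hi : n i ≠ 0 := by
      intro h; apply hn; simp [hf.coe_cre, create, h]
    have hj : n j ≠ 0 := by
      intro h; apply hn; simp [hf.coe_cre, create, h]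
    refine ⟨n - Finsupp.single j 1 - Finsupp.single i 1, ?_⟩
    dsimp only
    rw [occ_sub_add_cancel _ (by simpa [Finsupp.single_eq_of_ne hij] using hi),
      occ_sub_add_cancel _ hj]

theorem InDomain.norm_cre_sq {f : Fock L Λ} (hf : InDomain f) (i : Mode L Λ) :
    ‖hf.cre i‖ ^ 2 = ‖hf.ann i‖ ^ 2 + ‖f‖ ^ 2 :=
  (lp_hasSum_norm_sq (hf.cre i)).unique
    (hasSum_norm_create_sq (lp_hasSum_norm_sq f) (lp_hasSum_norm_sq (hf.ann i)))

theorem InDomain.inner_cre_cre [DecidableEq (Mode L Λ)] {f : Fock L Λ} (hf : InDomain f)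
    (i j : Mode L Λ) :
    inner ℂ (hf.cre i) (hf.cre j) = inner ℂ (hf.ann j) (hf.ann i)
      + if i = j then (‖f‖ ^ 2 : ℂ) else 0 := by
  by_cases h : i = j
  · subst h
    have := hf.norm_cre_sq i
    rw [inner_self_eq_ofReal, inner_self_eq_ofReal, if_pos rfl, this]
    push_cast; rfl
  · rw [hf.inner_cre_cre_of_ne h, if_neg h, add_zero]

theorem InDomain.inner_ann_cre {f : Fock L Λ} (hf : InDomain f) (i j : Mode L Λ) :
    inner ℂ (hf.ann i) (hf.cre j) = inner ℂ (hf.ann j) (hf.cre i) := by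
  classical
  by_cases hij : i = j
  · rw [hij]
  have key : ∀ i j : Mode L Λ, i ≠ j → inner ℂ (hf.ann i) (hf.cre j) =
      ∑' n : Occ L Λ, star ((Real.sqrt ((n i : ℝ) + 1) : ℂ)
        * f (n + Finsupp.single i 1 + Finsupp.single j 1))
        * ((Real.sqrt ((n j : ℝ) + 1) : ℂ) * f n) := by
    intro i j hij
    have hinj : Function.Injective fun n : Occ L Λ => n + Finsupp.single j 1 :=
      add_left_injective _
    rw [lp.inner_eq_tsum, ← hinj.tsum_eq]
    · refine tsum_congr fun n => ?_
      simp only [hf.coe_ann, hf.coe_cre, annihilate, create, add_tsub_cancel_right,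
        Finsupp.coe_add, Pi.add_apply, Finsupp.single_eq_same, Finsupp.single_eq_of_ne hij,
        add_zero, RCLike.inner_apply]
      rw [add_right_comm n]
      push_cast
      rw [starRingEnd_apply]
      ring
    · intro n hn
      have hj : n j ≠ 0 := by
        intro h; apply hn; simp [hf.coe_cre, create, h]
      exact ⟨n - Finsupp.single j 1, occ_sub_add_cancel _ hj⟩
  rw [key i j hij, key j i (Ne.symm hij)]
  refine tsum_congr fun n => ?_
  rw [add_right_comm n]
  simp only [star_mul', Complex.star_def, Complex.conj_ofReal]
  ring

variable [Fintype (Mode L Λ)]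

/-- The vector `∑ (b_m a_m + c_m a*_m) f`. -/
def InDomain.field {f : Fock L Λ} (hf : InDomain f) (b c : Mode L Λ → ℂ) : Fock L Λ :=
  ∑ m, (b m • hf.ann m + c m • hf.cre m)

theorem InDomain.coe_field {f : Fock L Λ} (hf : InDomain f) (b c : Mode L Λ → ℂ) :
    (hf.field b c : Occ L Λ → ℂ) = RadiationField.field b c f := by
  rw [InDomain.field, lp.coeFn_sum]
  rfl

theorem InDomain.inner_field_self {f : Fock L Λ} (hf : InDomain f) (b c : Mode L Λ → ℂ) :
    inner ℂ (hf.field b c) (hf.field b c) = ∑ i, ∑ j,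
      (star (b i) * b j * inner ℂ (hf.ann i) (hf.ann j)
        + star (b i) * c j * inner ℂ (hf.ann i) (hf.cre j)
        + star (c i) * b j * inner ℂ (hf.cre i) (hf.ann j)
        + star (c i) * c j * inner ℂ (hf.cre i) (hf.cre j)) := by
  have h1 : ∀ v : Fock L Λ, inner ℂ (hf.field b c) v =
      ∑ i, inner ℂ (b i • hf.ann i + c i • hf.cre i) v := fun v => sum_inner (𝕜 := ℂ) _ _ _
  have h2 : ∀ v : Fock L Λ, inner ℂ v (hf.field b c) =
      ∑ i, inner ℂ v (b i • hf.ann i + c i • hf.cre i) := fun v => inner_sum _ _ _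
  rw [h1]
  refine Finset.sum_congr rfl fun i _ => ?_
  rw [h2]
  refine Finset.sum_congr rfl fun j _ => ?_
  simp only [inner_add_left, inner_add_right, inner_smul_left, inner_smul_right,
    starRingEnd_apply]
  ring

/-- The commutation relation `X X* = X* X + c` for `X = ∑ (b_m a_m + c_m a*_m)`, in terms of
norms. -/
theorem InDomain.norm_field_star_sq {f : Fock L Λ} (hf : InDomain f) (b c : Mode L Λ → ℂ) :
    ‖hf.field (fun m => star (c m)) (fun m => star (b m))‖ ^ 2 =
      ‖hf.field b c‖ ^ 2 + (∑ m, (‖b m‖ ^ 2 - ‖c m‖ ^ 2)) * ‖f‖ ^ 2 := by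
  classical
  have h : ((‖hf.field (fun m => star (c m)) (fun m => star (b m))‖ ^ 2 : ℝ) : ℂ) =
      ((‖hf.field b c‖ ^ 2 + (∑ m, (‖b m‖ ^ 2 - ‖c m‖ ^ 2)) * ‖f‖ ^ 2 : ℝ) : ℂ) := by
    rw [Complex.ofReal_add, ← inner_self_eq_ofReal, ← inner_self_eq_ofReal, hf.inner_field_self, hf.inner_field_self]
    rw [Finset.sum_comm]
    have e2 : ((((∑ m, (‖b m‖ ^ 2 - ‖c m‖ ^ 2)) * ‖f‖ ^ 2 : ℝ)) : ℂ) =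
        ∑ i, ∑ j, (if i = j then (star (b i) * b j - star (c i) * c j) * (‖f‖ ^ 2 : ℂ) else 0) := by
      simp only [Finset.sum_ite_eq, Finset.mem_univ, if_true]
      push_cast
      rw [Finset.sum_mul]
      refine Finset.sum_congr rfl fun m _ => ?_
      rw [← Complex.conj_mul', ← Complex.conj_mul']; rfl
    rw [e2, ← Finset.sum_add_distrib]
    refine Finset.sum_congr rfl fun i _ => ?_
    rw [← Finset.sum_add_distrib]
    refine Finset.sum_congr rfl fun j _ => ?_
    have r3 : inner ℂ (hf.cre j) (hf.ann i) = inner ℂ (hf.cre i) (hf.ann j) := by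
      rw [← inner_conj_symm, hf.inner_ann_cre, inner_conj_symm]
    rw [hf.inner_cre_cre i j, hf.inner_cre_cre j i, hf.inner_ann_cre j i, r3]
    simp only [star_star, eq_comm (a := j) (b := i)]
    by_cases hij : i = j
    · subst hij; simp; ring
    · simp [hij]; ring
  exact_mod_cast h

end Commutation

/-! ### Counting modes and summing over polarizations -/

section Modes

variable {L Λ : ℝ}

/-- The integer vectors labelling the wave vectors below the cutoff. -/
abbrev WaveIndex (L Λ : ℝ) : Type := {n : Fin 3 → ℤ // n ≠ 0 ∧ ‖waveVector L n‖ < Λ}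

theorem finite_waveIndex (hL : 0 < L) (Λ : ℝ) : Finite (WaveIndex L Λ) := by
  have := finite_mode hL Λ
  exact Finite.of_injective (fun n : WaveIndex L Λ => ((n, 0) : Mode L Λ)) fun a b h =>
    (Prod.ext_iff.1 h).1

theorem waveVector_apply (L : ℝ) (n : Fin 3 → ℤ) (i : Fin 3) :
    waveVector L n i = 2 * Real.pi * (n i : ℝ) / L := rfl

theorem waveVector_ne_zero (hL : 0 < L) {n : Fin 3 → ℤ} (hn : n ≠ 0) : waveVector L n ≠ 0 := by
  intro h
  apply hn
  funext i
  have h1 : waveVector L n i = 0 := by rw [h]; rfl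
  rw [waveVector_apply, div_eq_zero_iff] at h1
  have h2 := Real.pi_pos.ne'
  simpa [hL.ne', h2] using h1

/-- The two polarization vectors and k/|k| form an orthonormal basis of ℝ³, so this is Parseval's
identity. -/
theorem polarization_completeness {ε : Space → Fin 2 → Space} (hε : IsPolarization ε) {k : Space}
    (hk : k ≠ 0) (v w : Space) :
    ∑ s, inner ℝ (ε k s) v * inner ℝ (ε k s) w + inner ℝ k v * inner ℝ k w / ‖k‖ ^ 2
      = inner ℝ v w := by
  obtain ⟨h1, h2⟩ := hε k hk
  have hk' : ‖k‖ ≠ 0 := norm_ne_zero_iff.2 hk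
  have ho : Orthonormal ℝ ![ε k 0, ε k 1, ‖k‖⁻¹ • k] := by
    rw [orthonormal_iff_ite]
    have h3 := orthonormal_iff_ite.1 h1
    have h4 : ∀ s, inner ℝ k (ε k s) = 0 := fun s => by rw [real_inner_comm]; exact h2 s
    intro i j
    fin_cases i <;> fin_cases j <;>
      simp [h3, h1.1, inner_smul_left, inner_smul_right, h2, h4]
    left
    rw [norm_smul, norm_inv, norm_norm, inv_mul_cancel₀ hk']
  let B : OrthonormalBasis (Fin 3) ℝ Space :=
    (basisOfOrthonormalOfCardEqFinrank ho (by simp)).toOrthonormalBasis (by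
      rw [coe_basisOfOrthonormalOfCardEqFinrank]; exact ho)
  have hB : (B : Fin 3 → Space) = ![ε k 0, ε k 1, ‖k‖⁻¹ • k] := by simp [B]
  have hs := B.sum_inner_mul_inner v w
  rw [hB, Fin.sum_univ_three] at hs
  rw [Fin.sum_univ_two, ← hs]
  simp only [Matrix.cons_val_zero, Matrix.cons_val_one, Matrix.cons_val_two, Matrix.head_cons,
    Matrix.tail_cons, inner_smul_left, inner_smul_right]
  rw [real_inner_comm (ε k 0) v, real_inner_comm (ε k 1) v, real_inner_comm k v]
  simp
  field_simp

theorem sum_polarization_sq {ε : Space → Fin 2 → Space} (hε : IsPolarization ε) {k : Space}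
    (hk : k ≠ 0) (j : Fin 3) : ∑ s, (ε k s j) ^ 2 = 1 - (k j) ^ 2 / ‖k‖ ^ 2 := by
  have h := polarization_completeness hε hk (EuclideanSpace.single j 1) (EuclideanSpace.single j 1)
  simp only [EuclideanSpace.inner_single_right] at h
  simp at h
  simp only [Fin.sum_univ_two, sq]
  simp only [sq] at h
  linarith

theorem sum_polarization_sq_le {ε : Space → Fin 2 → Space} (hε : IsPolarization ε) {k : Space}
    (hk : k ≠ 0) (j : Fin 3) : ∑ s, (ε k s j) ^ 2 ≤ 1 := by
  rw [sum_polarization_sq hε hk]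
  have : 0 ≤ (k j) ^ 2 / ‖k‖ ^ 2 := by positivity
  linarith

theorem sum_polarization_sq_all {ε : Space → Fin 2 → Space} (hε : IsPolarization ε) {k : Space}
    (hk : k ≠ 0) (s : Fin 2) : ∑ j, (ε k s j) ^ 2 = 1 := by
  have := (hε k hk).1.1 s
  rw [EuclideanSpace.norm_eq, Real.sqrt_eq_one] at this
  simpa using this

theorem abs_waveIndex_lt (hL : 0 < L) (n : WaveIndex L Λ) (i : Fin 3) :
    2 * Real.pi * |(n.1 i : ℝ)| < Λ * L := by
  have h1 : ‖(waveVector L n.1) i‖ < Λ := lt_of_le_of_lt (PiLp.norm_apply_le _ i) n.2.2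
  rw [waveVector_apply, Real.norm_eq_abs, abs_div, abs_of_pos hL, div_lt_iff₀ hL, abs_mul,
    abs_of_pos (by positivity : (0 : ℝ) < 2 * Real.pi)] at h1
  exact h1

theorem card_waveIndex_le [Fintype (WaveIndex L Λ)] (hL : 0 < L) (h : 2 ≤ Λ * L) :
    (Fintype.card (WaveIndex L Λ) : ℝ) ≤ (Λ * L) ^ 3 := by
  set M := ⌊Λ * L / (2 * Real.pi)⌋₊ with hM
  have hmem : ∀ (n : WaveIndex L Λ) i, n.1 i ∈ Finset.Icc (-(M : ℤ)) M := by
    intro n i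
    have h1 := abs_waveIndex_lt hL n i
    have h2 : ((n.1 i).natAbs : ℝ) ≤ Λ * L / (2 * Real.pi) := by
      rw [le_div_iff₀ (by positivity), Nat.cast_natAbs, Int.cast_abs]
      linarith
    have h3 : (n.1 i).natAbs ≤ M := Nat.le_floor h2
    rw [Finset.mem_Icc]
    omega
  have hcard : Fintype.card (WaveIndex L Λ) ≤ (2 * M + 1) ^ 3 := by
    have := Fintype.card_le_of_injective
      (fun (n : WaveIndex L Λ) (i : Fin 3) => (⟨n.1 i, hmem n i⟩ : Finset.Icc (-(M : ℤ)) M))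
      (fun a b hab => Subtype.ext (funext fun i => by
        have := congrFun hab i
        simpa using this))
    refine this.trans (le_of_eq ?_)
    rw [Fintype.card_fun, Fintype.card_fin, Fintype.card_coe, Int.card_Icc]
    congr 1
    omega
  have hM1 : (M : ℝ) ≤ Λ * L / (2 * Real.pi) := Nat.floor_le (by positivity)
  have hM2 : 2 * (M : ℝ) + 1 ≤ Λ * L := by
    have : Λ * L / (2 * Real.pi) ≤ Λ * L / 6 := by
      gcongr
      linarith [Real.pi_gt_three]
    linarith
  calc (Fintype.card (WaveIndex L Λ) : ℝ) ≤ (2 * M + 1 : ℝ) ^ 3 := by exact_mod_cast hcard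
    _ ≤ _ := by gcongr

theorem norm_waveVector_sq (L : ℝ) (n : Fin 3 → ℤ) :
    ‖waveVector L n‖ ^ 2 =
      (2 * Real.pi / L) ^ 2 * ((n 0 : ℝ) ^ 2 + (n 1 : ℝ) ^ 2 + (n 2 : ℝ) ^ 2) := by
  rw [EuclideanSpace.norm_sq_eq, Fin.sum_univ_three]
  simp only [waveVector_apply, Real.norm_eq_abs, sq_abs]
  ring

/-- Take m = ⌊ΛL/20⌋ and the vectors n = (a, m + b, c) with 0 ≤ a, b, c < m. Then |n|² ≤ 6m² keeps
them below the cutoff, and n_0 ≤ n_1 gives 1 - k_0²/|k|² ≥ 1/2. There are m³ ≥ (ΛL/40)³ of them, and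
128000 = 2 · 40³. -/
theorem le_sum_polarization_sq [Fintype (WaveIndex L Λ)] (hL : 0 < L) (h : 40 ≤ Λ * L)
    {ε : Space → Fin 2 → Space} (hε : IsPolarization ε) :
    (Λ * L) ^ 3 / 128000 ≤
      ∑ n : WaveIndex L Λ, ∑ s, (ε (waveVector L n.1) s 0) ^ 2 := by
  classical
  set m := ⌊Λ * L / 20⌋₊ with hm
  have hΛ : 0 < Λ := by
    by_contra hneg
    have := mul_nonpos_of_nonpos_of_nonneg (not_lt.1 hneg) hL.le
    linarith
  have hm1 : (m : ℝ) ≤ Λ * L / 20 := Nat.floor_le (by positivity)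
  have hm2 : Λ * L / 40 ≤ (m : ℝ) := by
    have := Nat.lt_floor_add_one (Λ * L / 20)
    rw [← hm] at this
    linarith
  have hm0 : 0 < m := by
    have : (0 : ℝ) < m := lt_of_lt_of_le (by positivity) hm2
    exact_mod_cast this
  set f : Fin m × Fin m × Fin m → Fin 3 → ℤ := fun a => ![(a.1 : ℤ), m + (a.2.1 : ℤ), (a.2.2 : ℤ)]
    with hf
  have hfm : ∀ a, f a ≠ 0 ∧ ‖waveVector L (f a)‖ < Λ := by
    rintro ⟨a, b, c⟩
    constructor
    · intro h0
      have := congrFun h0 1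
      simp [hf] at this
      omega
    · refine abs_lt_of_sq_lt_sq' ?_ hΛ.le |>.2
      rw [norm_waveVector_sq]
      have ha : (a : ℝ) ≤ m := by exact_mod_cast a.2.le
      have hb : (b : ℝ) ≤ m := by exact_mod_cast b.2.le
      have hc : (c : ℝ) ≤ m := by exact_mod_cast c.2.le
      have h1 : ((f (a, b, c) 0 : ℤ) : ℝ) ^ 2 + ((f (a, b, c) 1 : ℤ) : ℝ) ^ 2 +
          ((f (a, b, c) 2 : ℤ) : ℝ) ^ 2 ≤ 6 * (m : ℝ) ^ 2 := by
        simp only [hf, Matrix.cons_val_zero, Matrix.cons_val_one, Matrix.cons_val]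
        push_cast
        have e1 : (a : ℝ) ^ 2 ≤ (m : ℝ) ^ 2 := by gcongr
        have e2 : ((m : ℝ) + b) ^ 2 ≤ (2 * (m : ℝ)) ^ 2 := by gcongr; linarith
        have e3 : (c : ℝ) ^ 2 ≤ (m : ℝ) ^ 2 := by gcongr
        linarith
      calc _ ≤ (2 * Real.pi / L) ^ 2 * (6 * (m : ℝ) ^ 2) := by gcongr
        _ ≤ (2 * Real.pi / L) ^ 2 * (6 * (Λ * L / 20) ^ 2) := by gcongr
        _ = (6 * Real.pi ^ 2 / 100) * Λ ^ 2 := by field_simp; ring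
        _ < 1 * Λ ^ 2 := by
          gcongr
          have := Real.pi_lt_d2
          nlinarith [Real.pi_pos]
        _ = _ := one_mul _
  let F : Fin m × Fin m × Fin m → WaveIndex L Λ := fun a => ⟨f a, hfm a⟩
  have hF : Function.Injective F := by
    rintro ⟨a, b, c⟩ ⟨a', b', c'⟩ hab
    have h0 : f (a, b, c) = f (a', b', c') := congrArg Subtype.val hab
    have i0 := congrFun h0 0
    have i1 := congrFun h0 1
    have i2 := congrFun h0 2
    simp [hf] at i0 i1 i2
    simp only [Prod.mk.injEq]
    exact ⟨Fin.ext i0, Fin.ext i1, Fin.ext i2⟩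
  have hhalf : ∀ a, (1 / 2 : ℝ) ≤ ∑ s, (ε (waveVector L (F a).1) s 0) ^ 2 := by
    intro a
    have hk := waveVector_ne_zero hL (F a).2.1
    rw [sum_polarization_sq hε hk]
    have hk2 : 0 < ‖waveVector L (F a).1‖ ^ 2 := by positivity
    have : (waveVector L (F a).1 0) ^ 2 / ‖waveVector L (F a).1‖ ^ 2 ≤ 1 / 2 := by
      rw [div_le_iff₀ hk2, norm_waveVector_sq, waveVector_apply]
      have e1 : (((F a).1 0 : ℤ) : ℝ) ≤ (((F a).1 1 : ℤ) : ℝ) := by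
        have : (F a).1 0 ≤ (F a).1 1 := by
          simp [F, hf]; omega
        exact_mod_cast this
      have e0 : (0 : ℝ) ≤ (((F a).1 0 : ℤ) : ℝ) := by
        have : 0 ≤ (F a).1 0 := by simp [F, hf]
        exact_mod_cast this
      have e2 : (((F a).1 0 : ℤ) : ℝ) ^ 2 ≤ (((F a).1 1 : ℤ) : ℝ) ^ 2 := by gcongr
      have e3 : 0 ≤ (2 * Real.pi / L) ^ 2 := by positivity
      calc _ = (2 * Real.pi / L) ^ 2 * (((F a).1 0 : ℤ) : ℝ) ^ 2 := by ring
        _ ≤ (2 * Real.pi / L) ^ 2 * (1 / 2 * ((((F a).1 0 : ℤ) : ℝ) ^ 2 +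
            (((F a).1 1 : ℤ) : ℝ) ^ 2 + (((F a).1 2 : ℤ) : ℝ) ^ 2)) := by
          gcongr
          nlinarith [sq_nonneg (((F a).1 2 : ℤ) : ℝ)]
        _ = _ := by ring
    linarith
  calc (Λ * L) ^ 3 / 128000 = (Λ * L / 40) ^ 3 * (1 / 2) := by ring
    _ ≤ (m : ℝ) ^ 3 * (1 / 2) := by gcongr
    _ = ∑ a : Fin m × Fin m × Fin m, (1 / 2 : ℝ) := by
      simp; ring
    _ ≤ ∑ a, ∑ s, (ε (waveVector L (F a).1) s 0) ^ 2 := Finset.sum_le_sum fun a _ => hhalf a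
    _ = ∑ n ∈ Finset.univ.image F, ∑ s, (ε (waveVector L n.1) s 0) ^ 2 := by
      rw [Finset.sum_image fun a _ b _ h => hF h]
    _ ≤ _ := Finset.sum_le_sum_of_subset_of_nonneg (Finset.subset_univ _) fun n _ _ =>
      Finset.sum_nonneg fun s _ => by positivity

end Modes

/-! ### Parseval on the torus and averages over a small cube -/

section TorusAverage

theorem setIntegral_exp_period {L : ℝ} (hL : 0 < L) (a : ℤ) :
    ∫ t in Set.Icc (0 : ℝ) L, Complex.exp (Complex.I * ((t * (2 * Real.pi * a / L) : ℝ) : ℂ)) =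
      if a = 0 then (L : ℂ) else 0 := by
  rw [integral_Icc_eq_integral_Ioc, ← intervalIntegral.integral_of_le hL.le]
  split_ifs with h
  · subst h; simp
  · have hpi := Real.pi_ne_zero
    have hc : (2 * Real.pi * a / L : ℂ) * Complex.I ≠ 0 := by
      refine mul_ne_zero (div_ne_zero (mul_ne_zero (mul_ne_zero two_ne_zero ?_) ?_) ?_)
        Complex.I_ne_zero
      · exact_mod_cast hpi
      · exact_mod_cast h
      · exact_mod_cast hL.ne'
    have : ∀ t : ℝ, Complex.exp (Complex.I * ((t * (2 * Real.pi * a / L) : ℝ) : ℂ)) =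
        Complex.exp ((2 * Real.pi * a / L : ℂ) * Complex.I * t) := fun t => by
      congr 1; push_cast; ring
    simp only [this]
    rw [integral_exp_mul_complex hc]
    have h1 : (2 * Real.pi * a / L : ℂ) * Complex.I * L = a * (2 * Real.pi * Complex.I) := by
      have : (L : ℂ) ≠ 0 := by exact_mod_cast hL.ne'
      field_simp
    rw [h1, Complex.exp_int_mul_two_pi_mul_I]
    simp

theorem setIntegral_cube_exp {L : ℝ} (hL : 0 < L) (a : Fin 3 → ℤ) :
    ∫ y in Set.Icc (0 : Fin 3 → ℝ) (fun _ => L),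
      ∏ i, Complex.exp (Complex.I * ((y i * (2 * Real.pi * a i / L) : ℝ) : ℂ)) =
      if a = 0 then (L : ℂ) ^ 3 else 0 := by
  have hpi : Set.Icc (0 : Fin 3 → ℝ) (fun _ => L) = Set.univ.pi fun _ => Set.Icc 0 L := by
    rw [Set.pi_univ_Icc]; rfl
  rw [hpi, volume_pi, Measure.restrict_pi_pi]
  rw [integral_fintype_prod_eq_prod (fun (i : Fin 3) (t : ℝ) =>
    Complex.exp (Complex.I * ((t * (2 * Real.pi * a i / L) : ℝ) : ℂ)))]
  simp only [setIntegral_exp_period hL]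
  split_ifs with h
  · subst h; simp
  · obtain ⟨i, hi⟩ := Function.ne_iff.1 h
    exact Finset.prod_eq_zero (Finset.mem_univ i) (if_neg hi)

variable {X : Type*} [NormedAddCommGroup X] [InnerProductSpace ℂ X]

/-- The plane wave of the integer vector `n`, in coordinates. -/
def planeWave (L : ℝ) (n : Fin 3 → ℤ) (y : Fin 3 → ℝ) : ℂ :=
  ∏ i, Complex.exp (Complex.I * ((y i * (2 * Real.pi * n i / L) : ℝ) : ℂ))

theorem continuous_planeWave (L : ℝ) (n : Fin 3 → ℤ) : Continuous (planeWave L n) := by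
  unfold planeWave
  fun_prop

theorem planeWave_eq (L : ℝ) (n : Fin 3 → ℤ) (y : Space) :
    planeWave L n y = Complex.exp (Complex.I * (inner ℝ y (waveVector L n) : ℝ)) := by
  rw [planeWave, ← Complex.exp_sum, ← Finset.mul_sum, ← Complex.ofReal_sum]
  congr 3
  rw [PiLp.inner_apply]
  refine Finset.sum_congr rfl fun i _ => ?_
  rw [waveVector_apply]
  simp; ring

theorem star_planeWave_mul (L : ℝ) (n n' : Fin 3 → ℤ) (y : Fin 3 → ℝ) :
    star (planeWave L n y) * planeWave L n' y = planeWave L (n' - n) y := by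
  rw [planeWave, planeWave, planeWave, Complex.star_def, map_prod, ← Finset.prod_mul_distrib]
  refine Finset.prod_congr rfl fun i _ => ?_
  rw [← Complex.exp_conj, ← Complex.exp_add]
  rw [map_mul, Complex.conj_I, Complex.conj_ofReal, Pi.sub_apply]
  push_cast
  ring_nf

theorem norm_planeWave (L : ℝ) (n : Fin 3 → ℤ) (y : Fin 3 → ℝ) : ‖planeWave L n y‖ = 1 := by
  rw [planeWave, norm_prod]
  refine Finset.prod_eq_one fun i _ => ?_
  rw [mul_comm, Complex.norm_exp_ofReal_mul_I]

theorem setIntegral_norm_sum_planeWave_sq {ι : Type*} [Fintype ι] {κ : ι → Fin 3 → ℤ}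
    (hκ : Function.Injective κ) (w : ι → X) {L : ℝ} (hL : 0 < L) :
    ∫ y in Set.Icc (0 : Fin 3 → ℝ) (fun _ => L), ‖∑ i, planeWave L (κ i) y • w i‖ ^ 2 =
      L ^ 3 * ∑ i, ‖w i‖ ^ 2 := by
  classical
  have h1 : ∀ y, ((‖∑ i, planeWave L (κ i) y • w i‖ ^ 2 : ℝ) : ℂ) =
      ∑ i, ∑ j, planeWave L (κ j - κ i) y * inner ℂ (w i) (w j) := by
    intro y
    have : ((‖∑ i, planeWave L (κ i) y • w i‖ ^ 2 : ℝ) : ℂ) =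
        inner ℂ (∑ i, planeWave L (κ i) y • w i) (∑ i, planeWave L (κ i) y • w i) := by
      rw [inner_self_eq_norm_sq_to_K]; push_cast; rfl
    rw [this, sum_inner]
    refine Finset.sum_congr rfl fun i _ => ?_
    rw [inner_sum]
    refine Finset.sum_congr rfl fun j _ => ?_
    rw [inner_smul_left, inner_smul_right, ← mul_assoc, ← star_planeWave_mul]
    rfl
  have hint : ∀ n, IntegrableOn (fun y => planeWave L n y)
      (Set.Icc (0 : Fin 3 → ℝ) (fun _ => L)) := fun n =>
    (continuous_planeWave L n).continuousOn.integrableOn_compact isCompact_Icc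
  have h2 : (((∫ y in Set.Icc (0 : Fin 3 → ℝ) (fun _ => L),
      ‖∑ i, planeWave L (κ i) y • w i‖ ^ 2) : ℝ) : ℂ) = ((L ^ 3 * ∑ i, ‖w i‖ ^ 2 : ℝ) : ℂ) := by
    rw [← integral_complex_ofReal]
    simp only [h1]
    rw [integral_finsetSum _ fun i _ => integrable_finsetSum _ fun j _ =>
      (hint (κ j - κ i)).mul_const _]
    push_cast
    rw [Finset.mul_sum]
    refine Finset.sum_congr rfl fun i _ => ?_
    rw [integral_finsetSum _ fun j _ => (hint (κ j - κ i)).mul_const _]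
    have h3 : ∀ j, ∫ y in Set.Icc (0 : Fin 3 → ℝ) (fun _ => L),
        planeWave L (κ j - κ i) y * inner ℂ (w i) (w j) =
        if j = i then (L : ℂ) ^ 3 * inner ℂ (w i) (w j) else 0 := by
      intro j
      rw [integral_mul_const]
      unfold planeWave
      rw [setIntegral_cube_exp hL]
      by_cases h : j = i
      · simp [h]
      · simp [h, sub_eq_zero, hκ.eq_iff]
    simp only [h3]
    simp [inner_self_eq_norm_sq_to_K]
  exact_mod_cast h2

/-- Some y does not exceed the mean over the small cube. The integral over that cube is at most the
integral over the period cube, where distinct plane waves are orthogonal; ℓ ≤ L places the one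
inside the other. -/
theorem exists_norm_sum_planeWave_sq_le {ι : Type*} [Fintype ι] {κ : ι → Fin 3 → ℤ}
    (hκ : Function.Injective κ) (w : ι → X) {L ℓ : ℝ} (hℓ : 0 < ℓ) (hL : ℓ ≤ L) :
    ∃ y : Space, (∀ j, y j ∈ Set.Icc 0 ℓ) ∧
      ℓ ^ 3 * ‖∑ i, planeWave L (κ i) y • w i‖ ^ 2 ≤ L ^ 3 * ∑ i, ‖w i‖ ^ 2 := by
  have hL0 : 0 < L := hℓ.trans_le hL
  set S := Set.Icc (0 : Fin 3 → ℝ) (fun _ => ℓ) with hS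
  have hvol : volume S = ENNReal.ofReal ℓ ^ 3 := by
    rw [hS, Real.volume_Icc_pi]; simp
  have hcont : Continuous fun y : Fin 3 → ℝ => ‖∑ i, planeWave L (κ i) y • w i‖ ^ 2 := by
    have := fun i => continuous_planeWave L (κ i)
    fun_prop
  have hint : ∀ r : ℝ, IntegrableOn (fun y : Fin 3 → ℝ => ‖∑ i, planeWave L (κ i) y • w i‖ ^ 2)
      (Set.Icc (0 : Fin 3 → ℝ) (fun _ => r)) := fun r =>
    hcont.continuousOn.integrableOn_compact isCompact_Icc
  obtain ⟨y, hy, hle⟩ := exists_le_setAverage (μ := volume) (s := S)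
    (by rw [hvol]; positivity) (by rw [hvol]; finiteness) (hint ℓ)
  refine ⟨WithLp.toLp 2 y, fun j => ⟨hy.1 j, hy.2 j⟩, ?_⟩
  rw [setAverage_eq, measureReal_def, hvol, ENNReal.toReal_pow, ENNReal.toReal_ofReal hℓ.le,
    smul_eq_mul, inv_mul_eq_div, le_div_iff₀ (by positivity), mul_comm] at hle
  refine hle.trans ?_
  rw [← setIntegral_norm_sum_planeWave_sq hκ w hL0]
  refine setIntegral_mono_set (hint L) (Filter.Eventually.of_forall fun _ => by positivity) ?_
  exact LE.le.eventuallyLE (Set.Icc_subset_Icc le_rfl fun _ => hL)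

end TorusAverage

/-! ### The vector potential and its conjugate field as linear fields -/

section Potential

variable {L Λ : ℝ}

theorem integrable_norm_sq (Ψ : StateSpace L Λ) : Integrable (fun x => ‖Ψ x‖ ^ 2) volume :=
  (memLp_two_iff_integrable_sq_norm (Lp.aestronglyMeasurable Ψ)).1 (Lp.memLp Ψ)

theorem integral_norm_sq (Ψ : StateSpace L Λ) : ∫ x, ‖Ψ x‖ ^ 2 = ‖Ψ‖ ^ 2 := by
  have h : inner ℂ Ψ Ψ = ∫ x, inner ℂ (Ψ x) (Ψ x) := L2.inner_def Ψ Ψ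
  simp only [inner_self_eq_norm_sq_to_K] at h
  have h2 : ∀ x, ((‖Ψ x‖ : ℂ) ^ 2) = ((‖Ψ x‖ ^ 2 : ℝ) : ℂ) := fun x => by push_cast; rfl
  have h3 : ((‖Ψ‖ ^ 2 : ℝ) : ℂ) = ((∫ x, ‖Ψ x‖ ^ 2 : ℝ) : ℂ) := by
    rw [← integral_complex_ofReal]
    simp only [← h2]
    rw [Complex.ofReal_pow]
    exact h
  exact_mod_cast h3.symm

/-- Multiplication of a state by the plane wave of the integer vector `n`. -/
theorem exists_modulate (n : Fin 3 → ℤ) (Ψ : StateSpace L Λ) :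
    ∃ Φ : StateSpace L Λ, (∀ᵐ x, Φ x = planeWave L n x • Ψ x) ∧ ‖Φ‖ = ‖Ψ‖ := by
  have hm : MemLp (fun x : Space => planeWave L n x • Ψ x) 2 volume := by
    refine (Lp.memLp Ψ).of_le ?_ (Filter.Eventually.of_forall fun x => ?_)
    · exact (((continuous_planeWave L n).comp (PiLp.continuous_ofLp 2 _)).aestronglyMeasurable).smul
        (Lp.aestronglyMeasurable Ψ)
    · rw [norm_smul, norm_planeWave, one_mul]
  refine ⟨hm.toLp _, hm.coeFn_toLp, ?_⟩
  rw [Lp.norm_toLp, Lp.norm_def]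
  congr 1
  exact eLpNorm_congr_norm_ae (Filter.Eventually.of_forall fun x => by
    rw [norm_smul, norm_planeWave, one_mul])

/-- The coefficient `(2 L³)^(-1/2) |k|^(-1/2) ε_j` of the vector potential. -/
def potCoef (ε : Space → Fin 2 → Space) (j : Fin 3) (m : Mode L Λ) : ℝ :=
  1 / Real.sqrt (2 * L ^ 3) * (1 / Real.sqrt ‖m.k‖ * ε m.k m.2 j)

/-- The coefficient vector of the vector potential at the point `x`. -/
def potVec (ε : Space → Fin 2 → Space) (j : Fin 3) (x : Space) (m : Mode L Λ) : ℂ :=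
  (potCoef ε j m : ℂ) * star (planeWave L m.1.1 x)

/-- The coefficient `(2 L³)^(-1/2) |k|^(1/2) ε_j` of the field conjugate to the vector
potential. -/
def conjCoef (ε : Space → Fin 2 → Space) (j : Fin 3) (m : Mode L Λ) : ℝ :=
  1 / Real.sqrt (2 * L ^ 3) * (Real.sqrt ‖m.k‖ * ε m.k m.2 j)

/-- The coefficient vector of the field conjugate to the vector potential at the point `x`. -/
def conjVec (ε : Space → Fin 2 → Space) (j : Fin 3) (x : Space) (m : Mode L Λ) : ℂ :=
  (conjCoef ε j m : ℂ) * star (planeWave L m.1.1 x)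

theorem norm_k_pos (hL : 0 < L) (m : Mode L Λ) : 0 < ‖m.k‖ :=
  norm_pos_iff.2 (waveVector_ne_zero hL m.1.2.1)

/-- The powers |k|^(-1/2) and |k|^(1/2) cancel, so the commutator of the two fields counts the modes
with no regard to their frequency. That is why it is of order Λ³. -/
theorem potCoef_mul_conjCoef (hL : 0 < L) (ε : Space → Fin 2 → Space) (j : Fin 3)
    (m : Mode L Λ) : potCoef ε j m * conjCoef ε j m = (ε m.k m.2 j) ^ 2 / (2 * L ^ 3) := by
  have h1 := Real.sq_sqrt (by positivity : (0 : ℝ) ≤ 2 * L ^ 3)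
  have h2 : Real.sqrt ‖m.k‖ ≠ 0 := (Real.sqrt_pos.2 (norm_k_pos hL m)).ne'
  rw [← h1, potCoef, conjCoef]
  have h3 : Real.sqrt (2 * L ^ 3) ≠ 0 := (Real.sqrt_pos.2 (by positivity)).ne'
  rw [h1]
  field_simp
  rw [h1]

theorem conjCoef_sq (hL : 0 < L) (ε : Space → Fin 2 → Space) (j : Fin 3) (m : Mode L Λ) :
    conjCoef ε j m ^ 2 = ‖m.k‖ * (ε m.k m.2 j) ^ 2 / (2 * L ^ 3) := by
  rw [conjCoef, mul_pow, mul_pow, div_pow, Real.sq_sqrt (by positivity),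
    Real.sq_sqrt (by positivity)]
  ring

theorem potCoef_sq (hL : 0 < L) (ε : Space → Fin 2 → Space) (j : Fin 3) (m : Mode L Λ) :
    ‖m.k‖ * potCoef ε j m ^ 2 = (ε m.k m.2 j) ^ 2 / (2 * L ^ 3) := by
  have := (norm_k_pos hL m).ne'
  rw [potCoef, mul_pow, mul_pow, div_pow, div_pow, Real.sq_sqrt (by positivity),
    Real.sq_sqrt (by positivity)]
  field_simp

variable [Fintype (WaveIndex L Λ)]

theorem vectorPotential_eq_field (ε : Space → Fin 2 → Space) (j : Fin 3) (x : Space)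
    (f : Occ L Λ → ℂ) :
    vectorPotential ε j x f = field (fun m => star (potVec ε j x m)) (potVec ε j x) f := by
  funext n
  rw [vectorPotential, field_apply, finsum_eq_sum_of_fintype, Finset.mul_sum]
  refine Finset.sum_congr rfl fun m _ => ?_
  have h : planeWave L m.1.1 x = Complex.exp (Complex.I * (inner ℝ x m.k : ℝ)) :=
    planeWave_eq L m.1.1 x
  have h2 : star (planeWave L m.1.1 x) = Complex.exp (-Complex.I * (inner ℝ x m.k : ℝ)) := by
    rw [h, Complex.star_def, ← Complex.exp_conj, map_mul, Complex.conj_I, Complex.conj_ofReal]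
  rw [potVec, h2, star_mul', ← h2, star_star, h, potCoef, Complex.star_def, Complex.conj_ofReal]
  push_cast
  ring

theorem sum_mode (F : Mode L Λ → ℝ) : ∑ m, F m = ∑ n : WaveIndex L Λ, ∑ s : Fin 2, F (n, s) :=
  Fintype.sum_prod_type F

/-- This sum is the vacuum expectation of the square of the conjugate field. At most (ΛL)³ wave
vectors contribute, each at most Λ/(2L³). -/
theorem sum_conjCoef_sq_le (hL : 0 < L) (h : 2 ≤ Λ * L) {ε : Space → Fin 2 → Space}
    (hε : IsPolarization ε) (j : Fin 3) :
    ∑ m : Mode L Λ, conjCoef ε j m ^ 2 ≤ Λ ^ 4 / 2 := by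
  have hΛ : 0 < Λ := by
    by_contra hneg
    have := mul_nonpos_of_nonpos_of_nonneg (not_lt.1 hneg) hL.le
    linarith
  rw [sum_mode]
  calc _ ≤ ∑ n : WaveIndex L Λ, Λ / (2 * L ^ 3) := by
        refine Finset.sum_le_sum fun n _ => ?_
        have hk := waveVector_ne_zero hL n.2.1
        have h1 := sum_polarization_sq_le hε hk j
        simp only [conjCoef_sq hL]
        calc ∑ s : Fin 2, ‖waveVector L n.1‖ * (ε (waveVector L n.1) s j) ^ 2 / (2 * L ^ 3)
            = ‖waveVector L n.1‖ * (∑ s, (ε (waveVector L n.1) s j) ^ 2) / (2 * L ^ 3) := by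
              rw [Finset.mul_sum, Finset.sum_div]
          _ ≤ Λ * 1 / (2 * L ^ 3) := by
              gcongr
              exact n.2.2.le
          _ = _ := by ring
    _ = Fintype.card (WaveIndex L Λ) * (Λ / (2 * L ^ 3)) := by simp
    _ ≤ (Λ * L) ^ 3 * (Λ / (2 * L ^ 3)) := by gcongr; exact card_waveIndex_le hL h
    _ = _ := by field_simp

theorem sum_norm_modes_le (D : Mode L Λ → ℝ) (q : Mode L Λ → ℝ) {c : WaveIndex L Λ → ℝ}
    (hc : ∀ n, ∑ s, q (n, s) ^ 2 ≤ c n) :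
    ∑ n : WaveIndex L Λ, (∑ s, |q (n, s)| * D (n, s)) ^ 2 ≤ ∑ n, c n * ∑ s, D (n, s) ^ 2 := by
  refine Finset.sum_le_sum fun n _ => ?_
  refine (Finset.sum_mul_sq_le_sq_mul_sq _ _ _).trans ?_
  simp only [sq_abs]
  gcongr
  exact hc n

end Potential

/-! ### The uncertainty relation integrated over the position -/

section LowerBound

variable {L Λ : ℝ}

theorem inDomain_of_isAnnihilation {f : Fock L Λ} {D : Mode L Λ → Fock L Λ}
    (h : ∀ m n, D m n = annihilate m (f : Occ L Λ → ℂ) n) : InDomain f := fun m => by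
  have : annihilate m (f : Occ L Λ → ℂ) = D m := funext fun n => (h m n).symm
  rw [this]
  exact lp.memℓp (D m)

variable [Fintype (WaveIndex L Λ)]

/-- Later f and u are the values of Ψ at two points that differ by y, and x is the point belonging
to u. The vector b is the annihilation part of the conjugate field applied to f, up to a phase. By
`InDomain.norm_field_star_sq` the creation part has the same norm squared plus the vacuum term,
whence 2(2‖b‖² + G‖f‖²) with G the sum of the squared coefficients. -/
theorem norm_sq_le_of_local {f u a : Fock L Λ} (hf : InDomain f) (hu : InDomain u) (hL : 0 < L)
    {ε : Space → Fin 2 → Space} {x : Space} {κ t : ℝ} (ht : 0 < t) (hκ : 0 < κ)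
    (hsum : ∑ m : Mode L Λ, (ε m.k m.2 0) ^ 2 / L ^ 3 = κ)
    (ha : (a : Occ L Λ → ℂ) = vectorPotential ε 0 x u) {b : Fock L Λ}
    (hb : b = ∑ m : Mode L Λ, (conjCoef ε 0 m * planeWave L m.1.1 x : ℂ) • hf.ann m) :
    ‖f‖ ^ 2 ≤ 18 * ‖u - f‖ ^ 2 + 4 * t ^ 2 * (4 * ‖b‖ ^ 2 +
      2 * (∑ m : Mode L Λ, conjCoef ε 0 m ^ 2) * ‖f‖ ^ 2) + 8 * ‖a‖ ^ 2 / (t * κ) ^ 2 := by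
  set g : Mode L Λ → ℂ := conjVec ε 0 x with hg
  set bT : Mode L Λ → ℂ := fun m => -Complex.I * star (g m) with hbT
  set cT : Mode L Λ → ℂ := fun m => Complex.I * g m with hcT
  have hgF : ∑ m, 2 * (star (potVec ε 0 x m) * g m).re = κ := by
    rw [← hsum]
    refine Finset.sum_congr rfl fun m _ => ?_
    have hn : planeWave L m.1.1 x * star (planeWave L m.1.1 x) = 1 := by
      rw [Complex.star_def, Complex.mul_conj', norm_planeWave]; simp
    rw [Complex.star_def] at hn
    have : star (potVec ε 0 x m) * g m = ((potCoef ε 0 m * conjCoef ε 0 m : ℝ) : ℂ) := by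
      rw [hg, potVec, conjVec, star_mul', star_star, Complex.star_def, Complex.conj_ofReal]
      push_cast
      linear_combination (potCoef ε 0 m * conjCoef ε 0 m : ℂ) * hn
    rw [this, Complex.ofReal_re, potCoef_mul_conjCoef hL]
    field_simp
  rw [vectorPotential_eq_field] at ha
  have h1 := norm_sq_le_of_inDomain hκ ht hgF hu hf ha (hf.coe_field bT cT)
  have hsplit : hf.field bT cT = hf.field bT 0 + hf.field (fun m => star ((0 : Mode L Λ → ℂ) m))
      (fun m => star (bT m)) := by
    simp only [InDomain.field, ← Finset.sum_add_distrib]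
    refine Finset.sum_congr rfl fun m _ => ?_
    simp [hbT, hcT]
  have hcre := hf.norm_field_star_sq bT 0
  have hbn : ‖hf.field bT 0‖ = ‖b‖ := by
    have : hf.field bT 0 = (-Complex.I) • b := by
      rw [hb, InDomain.field, Finset.smul_sum]
      refine Finset.sum_congr rfl fun m _ => ?_
      simp only [Pi.zero_apply, zero_smul, add_zero, smul_smul]
      congr 1
      simp only [hbT, hg, conjVec, star_mul', Complex.star_def, Complex.conj_ofReal, Complex.conj_conj]
    rw [this, norm_smul]; simp
  have hG : ∑ m, (‖bT m‖ ^ 2 - ‖(0 : Mode L Λ → ℂ) m‖ ^ 2) = ∑ m : Mode L Λ, conjCoef ε 0 m ^ 2 := by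
    refine Finset.sum_congr rfl fun m _ => ?_
    simp [hbT, hg, conjVec, norm_planeWave]
  rw [hG, hbn] at hcre
  have hle : ‖hf.field bT cT‖ ^ 2 ≤ 4 * ‖b‖ ^ 2 +
      2 * (∑ m : Mode L Λ, conjCoef ε 0 m ^ 2) * ‖f‖ ^ 2 := by
    have h2 := norm_add_le (hf.field bT 0) (hf.field (fun m => star ((0 : Mode L Λ → ℂ) m))
      (fun m => star (bT m)))
    rw [← hsplit, hbn] at h2
    have h3 : ‖hf.field bT cT‖ ^ 2 ≤ (‖b‖ + ‖hf.field (fun m => star ((0 : Mode L Λ → ℂ) m))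
      (fun m => star (bT m))‖) ^ 2 := by gcongr
    nlinarith [sq_nonneg (‖b‖ - ‖hf.field (fun m => star ((0 : Mode L Λ → ℂ) m))
      (fun m => star (bT m))‖)]
  have h4 := mul_le_mul_of_nonneg_left hle (by positivity : 0 ≤ 4 * t ^ 2)
  linarith

/-- A single y has to serve for almost all x. So the phases in x are put into the states D', and the
annihilation part becomes the vector Y of the full Hilbert space, which depends on y through scalar
plane waves only. The averaging lemma then applies in that Hilbert space. -/
theorem norm_sq_le_energy (hL : 0 < L) {ε : Space → Fin 2 → Space} (hε : IsPolarization ε)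
    {Ψ : StateSpace L Λ} {P B : Fin 3 → StateSpace L Λ} {D : Mode L Λ → StateSpace L Λ}
    (hP : ∀ j, IsMomentum j Ψ (P j)) (hB : ∀ j, IsPotential ε j Ψ (B j))
    (hD : ∀ m, IsAnnihilation m Ψ (D m)) {κ t ℓ : ℝ} (ht : 0 < t) (hκ : 0 < κ) (hℓ : 0 < ℓ)
    (hℓL : ℓ ≤ L) (hsum : ∑ m : Mode L Λ, (ε m.k m.2 0) ^ 2 / L ^ 3 = κ) :
    ‖Ψ‖ ^ 2 ≤ 18 * (3 * ℓ ^ 2 * ∑ j, ‖P j‖ ^ 2) +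
      4 * t ^ 2 * (4 * ((∑ m, ‖m.k‖ * ‖D m‖ ^ 2) / (2 * ℓ ^ 3)) +
        2 * (∑ m : Mode L Λ, conjCoef ε 0 m ^ 2) * ‖Ψ‖ ^ 2) + 8 * ‖B 0‖ ^ 2 / (t * κ) ^ 2 := by
  choose D' hD' hDn using fun m : Mode L Λ => exists_modulate m.1.1 (D m)
  set w : WaveIndex L Λ → StateSpace L Λ := fun n => ∑ s : Fin 2, (conjCoef ε 0 (n, s) : ℂ) • D' (n, s)
    with hw
  obtain ⟨y, hy, hle⟩ := exists_norm_sum_planeWave_sq_le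
    (κ := fun n : WaveIndex L Λ => n.1) Subtype.val_injective w hℓ hℓL
  set Y := ∑ n : WaveIndex L Λ, planeWave L n.1 y • w n with hY
  -- Plane waves are orthogonal only for different k, so the two polarizations of one k are grouped
  -- in w n and treated by Cauchy-Schwarz. The factor |k| in the squared coefficients yields exactly
  -- the field energy.
  have hwn : L ^ 3 * ∑ n, ‖w n‖ ^ 2 ≤ (∑ m, ‖m.k‖ * ‖D m‖ ^ 2) / 2 := by
    have e1 : ∀ n, ‖w n‖ ^ 2 ≤ (∑ s, |conjCoef ε 0 (n, s)| * ‖D (n, s)‖) ^ 2 := by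
      intro n
      gcongr
      refine (norm_sum_le _ _).trans (le_of_eq (Finset.sum_congr rfl fun s _ => ?_))
      rw [norm_smul, hDn, Complex.norm_real, Real.norm_eq_abs]
    have e2 := sum_norm_modes_le (fun m => ‖D m‖) (fun m => conjCoef ε 0 m)
      (c := fun n => ‖waveVector L n.1‖ / (2 * L ^ 3)) (fun n => by
        have hk := waveVector_ne_zero hL n.2.1
        simp only [conjCoef_sq hL]
        calc ∑ s : Fin 2, ‖waveVector L n.1‖ * (ε (waveVector L n.1) s 0) ^ 2 / (2 * L ^ 3)
            = ‖waveVector L n.1‖ * (∑ s, (ε (waveVector L n.1) s 0) ^ 2) / (2 * L ^ 3) := by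
              rw [Finset.mul_sum, Finset.sum_div]
          _ ≤ ‖waveVector L n.1‖ * 1 / (2 * L ^ 3) := by
              gcongr
              exact sum_polarization_sq_le hε hk 0
          _ = _ := by ring)
    calc L ^ 3 * ∑ n, ‖w n‖ ^ 2
        ≤ L ^ 3 * ∑ n : WaveIndex L Λ, ‖waveVector L n.1‖ / (2 * L ^ 3) * ∑ s, ‖D (n, s)‖ ^ 2 := by
          exact mul_le_mul_of_nonneg_left ((Finset.sum_le_sum fun n _ => e1 n).trans e2) (by positivity)
      _ = _ := by
          rw [sum_mode, Finset.mul_sum, Finset.sum_div]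
          refine Finset.sum_congr rfl fun n _ => ?_
          rw [Finset.mul_sum, Finset.mul_sum, Finset.sum_div]
          refine Finset.sum_congr rfl fun s _ => ?_
          simp only [Mode.k]
          field_simp
  have hYn : ‖Y‖ ^ 2 ≤ (∑ m, ‖m.k‖ * ‖D m‖ ^ 2) / (2 * ℓ ^ 3) := by
    rw [le_div_iff₀ (by positivity)]
    linarith
  have hYae : ∀ᵐ x, Y x = ∑ m : Mode L Λ,
      (conjCoef ε 0 m * planeWave L m.1.1 (x + y) : ℂ) • D m x := by
    have e0 := Lp.coeFn_finsetSum Finset.univ fun n : WaveIndex L Λ => planeWave L n.1 y • w n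
    have e1 : ∀ᵐ x, ∀ n, (planeWave L n.1 y • w n) x = planeWave L n.1 y • w n x :=
      Filter.eventually_all.2 fun n => Lp.coeFn_smul _ _
    have e2 : ∀ᵐ x, ∀ n, w n x =
        (∑ s : Fin 2, ⇑((conjCoef ε 0 (n, s) : ℂ) • D' (n, s))) x :=
      Filter.eventually_all.2 fun n => Lp.coeFn_finsetSum Finset.univ _
    have e3 : ∀ᵐ x, ∀ m : Mode L Λ, ((conjCoef ε 0 m : ℂ) • D' m) x = (conjCoef ε 0 m : ℂ) • D' m x :=
      Filter.eventually_all.2 fun m => Lp.coeFn_smul _ _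
    have e4 : ∀ᵐ x, ∀ m : Mode L Λ, D' m x = planeWave L m.1.1 x • D m x :=
      Filter.eventually_all.2 hD'
    filter_upwards [e0, e1, e2, e3, e4] with x h0 h1 h2 h3 h4
    rw [hY, h0, Finset.sum_apply, Fintype.sum_prod_type]
    refine Finset.sum_congr rfl fun n _ => ?_
    rw [h1, h2, Finset.sum_apply, Finset.smul_sum]
    refine Finset.sum_congr rfl fun s _ => ?_
    rw [h3, h4, smul_smul, smul_smul]
    congr 1
    have : planeWave L n.1 ((x + y : Space) : Fin 3 → ℝ) =
        planeWave L n.1 x * planeWave L n.1 y := by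
      rw [planeWave_eq, planeWave_eq, planeWave_eq, ← Complex.exp_add, inner_add_left]
      push_cast
      rw [mul_add]
    rw [WithLp.ofLp_add] at this
    dsimp only
    rw [this]
    ring
  have hdiff := norm_translate_sub_sq_le hP hy
  have hpoint : ∀ᵐ x, ‖Ψ x‖ ^ 2 ≤ 18 * ‖(translate y Ψ - Ψ) x‖ ^ 2 + 4 * t ^ 2 * (4 * ‖Y x‖ ^ 2 +
      2 * (∑ m : Mode L Λ, conjCoef ε 0 m ^ 2) * ‖Ψ x‖ ^ 2)
      + 8 * ‖translate y (B 0) x‖ ^ 2 / (t * κ) ^ 2 := by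
    have e0 : ∀ᵐ x, ∀ m n, D m x n = annihilate m (Ψ x : Occ L Λ → ℂ) n :=
      Filter.eventually_all.2 hD
    have qmp := (measurePreserving_add_right (volume : Measure Space) y).quasiMeasurePreserving
    filter_upwards [e0, qmp.ae e0, qmp.ae (hB 0), translate_ae_eq y Ψ, translate_ae_eq y (B 0), hYae,
      Lp.coeFn_sub (translate y Ψ) Ψ] with x h0 h1 h2 h3 h4 h5 h6
    have hf : InDomain (Ψ x) := inDomain_of_isAnnihilation h0
    have hu : InDomain (Ψ (x + y)) := inDomain_of_isAnnihilation h1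
    rw [h6, Pi.sub_apply, h3, h4]
    refine norm_sq_le_of_local hf hu hL (x := x + y) ht hκ hsum (funext h2) ?_
    rw [h5]
    refine Finset.sum_congr rfl fun m _ => ?_
    congr 1
    exact lp.ext (funext (h0 m))
  have hI := fun Φ : StateSpace L Λ => integrable_norm_sq Φ
  have hmono := integral_mono_ae (hI Ψ) ((((hI (translate y Ψ - Ψ)).const_mul 18).add
    ((((hI Y).const_mul 4).add ((hI Ψ).const_mul
      (2 * (∑ m : Mode L Λ, conjCoef ε 0 m ^ 2)))).const_mul (4 * t ^ 2))).add
    (((hI (translate y (B 0))).const_mul 8).div_const ((t * κ) ^ 2))) hpoint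
  simp only [Pi.add_apply] at hmono
  rw [integral_add, integral_add, integral_const_mul, integral_const_mul, integral_add,
    integral_const_mul, integral_const_mul, integral_div, integral_const_mul] at hmono
  · simp only [integral_norm_sq, norm_translate] at hmono
    refine hmono.trans ?_
    gcongr
  · exact (hI Y).const_mul 4
  · exact (hI Ψ).const_mul _
  · exact (hI _).const_mul 18
  · exact (((hI Y).const_mul 4).add ((hI Ψ).const_mul _)).const_mul _
  · exact ((hI _).const_mul 18).add
      ((((hI Y).const_mul 4).add ((hI Ψ).const_mul _)).const_mul _)
  · exact ((hI _).const_mul 8).div_const _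

end LowerBound

/-! ### Choice of scales in the lower bound -/

section LowerBoundEnergy

variable {L Λ : ℝ}

theorem norm_sq_le_of_hasEnergy (hL : 0 < L) (hΛ : 0 < Λ) {ε : Space → Fin 2 → Space}
    (hε : IsPolarization ε) {α ℓ q : ℝ} (hα : 0 < α) (hℓ : 0 < ℓ) (hℓL : ℓ ≤ L)
    (hLΛ : 40 ≤ Λ * L) (hscale : ℓ ^ 7 * α * Λ ^ 6 = 1) (hsmall : 8 * (ℓ ^ 5 * Λ ^ 4) ≤ 1)
    {Ψ : StateSpace L Λ} (h : HasEnergy α ε Ψ q) :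
    ‖Ψ‖ ^ 2 ≤ 32 * 128000 ^ 2 * ℓ ^ 2 * q := by
  have : Finite (WaveIndex L Λ) := finite_waveIndex hL Λ
  have : Fintype (WaveIndex L Λ) := Fintype.ofFinite _
  obtain ⟨P, B, D, hP, hB, hD, rfl⟩ := h
  rw [finsum_eq_sum_of_fintype]
  set κ : ℝ := ∑ m : Mode L Λ, (ε m.k m.2 0) ^ 2 / L ^ 3 with hκ
  have hκle : Λ ^ 3 / 128000 ≤ κ := by
    have := le_sum_polarization_sq hL hLΛ hε
    rw [hκ, sum_mode, ← mul_le_mul_iff_left₀ (by positivity : 0 < L ^ 3)]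
    calc Λ ^ 3 / 128000 * L ^ 3 = (Λ * L) ^ 3 / 128000 := by ring
      _ ≤ _ := this
      _ = _ := by
        simp only [← Finset.sum_div]
        rw [div_mul_cancel₀ _ (by positivity)]
        rfl
  have hκ0 : 0 < κ := lt_of_lt_of_le (by positivity) hκle
  -- The choice t² = ℓ^5 turns t²/ℓ³ in front of the field energy into ℓ². Since κ is at least of
  -- order Λ³, it also bounds 1/(tκ)² by a multiple of 1/(ℓ^5 Λ^6), which equals ℓ² α by `hscale`.
  have hmain := norm_sq_le_energy hL hε hP hB hD (t := √(ℓ ^ 5)) (by positivity) hκ0 hℓ hℓL rfl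
  rw [mul_pow, Real.sq_sqrt (by positivity)] at hmain
  have hG := sum_conjCoef_sq_le hL ((by norm_num : (2 : ℝ) ≤ 40).trans hLΛ) hε 0
  set G := ∑ m : Mode L Λ, conjCoef ε 0 m ^ 2
  set E := ∑ m, ‖m.k‖ * ‖D m‖ ^ 2 with hE
  have hE0 : 0 ≤ E := Finset.sum_nonneg fun m _ => by positivity
  have hB0 : ‖B 0‖ ^ 2 ≤ ∑ j, ‖B j‖ ^ 2 :=
    Finset.single_le_sum (f := fun j => ‖B j‖ ^ 2) (fun j _ => by positivity) (Finset.mem_univ 0)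
  have hP0 : 0 ≤ ∑ j, ‖P j‖ ^ 2 := Finset.sum_nonneg fun m _ => by positivity
  set SP := ∑ j, ‖P j‖ ^ 2
  set SB := ∑ j, ‖B j‖ ^ 2
  have h1 : 8 * ‖B 0‖ ^ 2 / (ℓ ^ 5 * κ ^ 2) ≤ 8 * 128000 ^ 2 * ℓ ^ 2 * (α * SB) := by
    rw [div_le_iff₀ (by positivity)]
    have h2 : (Λ ^ 3 / 128000) ^ 2 ≤ κ ^ 2 := by gcongr
    have hSB : 0 ≤ SB := (by positivity : 0 ≤ ‖B 0‖ ^ 2).trans hB0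
    calc 8 * ‖B 0‖ ^ 2 ≤ 8 * SB := by gcongr
      _ = 8 * 128000 ^ 2 * ℓ ^ 2 * (α * SB) * (ℓ ^ 5 * (Λ ^ 3 / 128000) ^ 2) := by
        linear_combination (-8 * SB) * hscale
      _ ≤ _ := by gcongr
  have h3 : 4 * ℓ ^ 5 * (4 * (E / (2 * ℓ ^ 3)) + 2 * G * ‖Ψ‖ ^ 2) ≤
      8 * ℓ ^ 2 * E + 1 / 2 * ‖Ψ‖ ^ 2 := by
    have h4 : 4 * ℓ ^ 5 * (4 * (E / (2 * ℓ ^ 3)) + 2 * G * ‖Ψ‖ ^ 2) =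
        8 * ℓ ^ 2 * E + 8 * ℓ ^ 5 * G * ‖Ψ‖ ^ 2 := by
      field_simp
      ring
    rw [h4]
    -- The vacuum term is at most half of ‖Ψ‖² and moves to the left-hand side.
    have h5 : 8 * ℓ ^ 5 * G ≤ 1 / 2 := by
      calc 8 * ℓ ^ 5 * G ≤ 8 * ℓ ^ 5 * (Λ ^ 4 / 2) := by gcongr
        _ ≤ 1 / 2 := by linarith
    gcongr
  have h6 : 0 ≤ ℓ ^ 2 * SP := by positivity
  have h7 : 0 ≤ ℓ ^ 2 * E := by positivity
  linarith

/-- Nonemptiness has to be assumed because `sInf ∅ = 0`; the trial state of the upper bound will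
supply it. -/
theorem le_groundStateEnergy (hL : 0 < L) (hΛ : 0 < Λ) {ε : Space → Fin 2 → Space}
    (hε : IsPolarization ε) {α ℓ : ℝ} (hα : 0 < α) (hℓ : 0 < ℓ) (hℓL : ℓ ≤ L)
    (hLΛ : 40 ≤ Λ * L) (hscale : ℓ ^ 7 * α * Λ ^ 6 = 1) (hsmall : 8 * (ℓ ^ 5 * Λ ^ 4) ≤ 1)
    (hne : {e : ℝ | ∃ Ψ : StateSpace L Λ, Ψ ≠ 0 ∧ ∃ q : ℝ, HasEnergy α ε Ψ q ∧
      e = q / ‖Ψ‖ ^ 2}.Nonempty) :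
    1 / (32 * 128000 ^ 2 * ℓ ^ 2) ≤ groundStateEnergy α L Λ ε := by
  refine le_csInf hne ?_
  rintro _ ⟨Ψ, hΨ, q, hq, rfl⟩
  have h := norm_sq_le_of_hasEnergy hL hΛ hε hα hℓ hℓL hLΛ hscale hsmall hq
  have hpos : 0 < ‖Ψ‖ := norm_pos_iff.2 hΨ
  rw [div_le_div_iff₀ (by positivity) (by positivity)]
  linarith

end LowerBoundEnergy

/-! ### Gaussian photon states -/

section GaussianState

variable {L Λ : ℝ}

theorem annihilate_sum {ι : Type*} (s : Finset ι) (m : Mode L Λ) (f : ι → Occ L Λ → ℂ) :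
    annihilate m (∑ i ∈ s, f i) = ∑ i ∈ s, annihilate m (f i) := by
  funext n
  simp [annihilate, Finset.mul_sum]

theorem create_zero (m : Mode L Λ) : create m (0 : Occ L Λ → ℂ) = 0 := by
  funext n
  simp [create]

variable [Fintype (Mode L Λ)]

/-- The operator `∑ K_ij a*_i a*_j` on families of coefficients. -/
def pairCreate (K : Mode L Λ → Mode L Λ → ℂ) (f : Occ L Λ → ℂ) : Occ L Λ → ℂ :=
  ∑ i, create i (field 0 (K i) f)

theorem pairCreate_smul (K : Mode L Λ → Mode L Λ → ℂ) (z : ℂ) (f : Occ L Λ → ℂ) :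
    pairCreate K (z • f) = z • pairCreate K f := by
  simp only [pairCreate, field_smul, create_smul, Finset.smul_sum]

theorem pairCreate_field (K : Mode L Λ → Mode L Λ → ℂ) (c : Mode L Λ → ℂ) (f : Occ L Λ → ℂ) :
    pairCreate K (field 0 c f) = field 0 c (pairCreate K f) := by
  rw [pairCreate, pairCreate, field_sum]
  refine Finset.sum_congr rfl fun i _ => ?_
  rw [field_comm, create_add, create_field]
  simp [create_zero]

theorem annihilate_pairCreate {K : Mode L Λ → Mode L Λ → ℂ} (hK : ∀ i j, K i j = K j i)
    (l : Mode L Λ) (f : Occ L Λ → ℂ) :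
    annihilate l (pairCreate K f) = pairCreate K (annihilate l f) + (2 : ℂ) • field 0 (K l) f := by
  classical
  have h : ∀ i, annihilate l (create i (field 0 (K i) f)) =
      create i (field 0 (K i) (annihilate l f)) + K l i • create i f +
        (if l = i then (1 : ℂ) else 0) • field 0 (K i) f := fun i => by
    rw [annihilate_create, annihilate_field, create_add, create_smul, hK l i]
  rw [pairCreate, annihilate_sum]
  simp only [h, Finset.sum_add_distrib, ite_smul, one_smul, zero_smul, Finset.sum_ite_eq,
    Finset.mem_univ, if_true]
  have h2 : ∑ i, K l i • create i f = field 0 (K l) f := by simp [field]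
  rw [h2, two_smul, ← add_assoc, pairCreate]

/-- The component with `2 n` photons of the Gaussian vector `exp (½ ∑ K_ij a*_i a*_j) |0⟩`. -/
def gaussianComponent (K : Mode L Λ → Mode L Λ → ℂ) : ℕ → Occ L Λ → ℂ
  | 0 => Pi.single 0 1
  | n + 1 => (1 / (2 * (n + 1)) : ℂ) • pairCreate K (gaussianComponent K n)

theorem annihilate_gaussianComponent_zero (K : Mode L Λ → Mode L Λ → ℂ) (i : Mode L Λ) :
    annihilate i (gaussianComponent K 0) = 0 := by
  funext n
  have h : n + Finsupp.single i 1 ≠ 0 := fun h => by simpa using DFunLike.congr_fun h i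
  rw [annihilate, gaussianComponent, Pi.single_eq_of_ne h, mul_zero, Pi.zero_apply]

/-- An annihilation operator acts on the exponential of a quadratic form in the a*_j as a
derivative. Degree by degree, the induction closes because (2(n + 1) + 2) / (2(n + 2)) = 1. -/
theorem annihilate_gaussianComponent_succ {K : Mode L Λ → Mode L Λ → ℂ}
    (hK : ∀ i j, K i j = K j i) (n : ℕ) (i : Mode L Λ) :
    annihilate i (gaussianComponent K (n + 1)) = field 0 (K i) (gaussianComponent K n) := by
  induction n with
  | zero =>
    have h0 : pairCreate K (0 : Occ L Λ → ℂ) = 0 := by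
      simpa using pairCreate_smul K 0 0
    have h1 : gaussianComponent K (0 + 1) =
        (1 / (2 * ((0 : ℕ) + 1)) : ℂ) • pairCreate K (gaussianComponent K 0) := rfl
    rw [h1, annihilate_smul, annihilate_pairCreate hK,
      annihilate_gaussianComponent_zero, h0, zero_add, smul_smul]
    norm_num
  | succ n ih =>
    have hn : (n + 1 : ℂ) ≠ 0 := by exact_mod_cast n.succ_ne_zero
    have hn' : (n + 1 + 1 : ℂ) ≠ 0 := by exact_mod_cast (n + 1).succ_ne_zero
    have h1 : pairCreate K (gaussianComponent K n) =
        (2 * (n + 1) : ℂ) • gaussianComponent K (n + 1) := by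
      rw [gaussianComponent, smul_smul]
      field_simp
      rw [one_smul]
    rw [gaussianComponent, annihilate_smul, annihilate_pairCreate hK, ih, pairCreate_field, h1,
      field_smul, ← add_smul, smul_smul]
    convert one_smul ℂ _
    push_cast
    field_simp

theorem gaussianComponent_eq_zero (K : Mode L Λ → Mode L Λ → ℂ) (n : ℕ) :
    ∀ o : Occ L Λ, o.degree ≠ 2 * n → gaussianComponent K n o = 0 := by
  have hc : ∀ (k : ℕ) (i : Mode L Λ) (f : Occ L Λ → ℂ), (∀ o : Occ L Λ, o.degree ≠ k → f o = 0) →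
      ∀ o : Occ L Λ, o.degree ≠ k + 1 → create i f o = 0 := by
    intro k i f hf o ho
    by_cases h : o i = 0
    · simp [create, h]
    · rw [create, hf _ (fun h1 => ho (by rw [← degree_sub_single o h, h1])), mul_zero]
  induction n with
  | zero =>
    intro o ho
    rw [gaussianComponent, Pi.single_eq_of_ne]
    rintro rfl
    simp at ho
  | succ n ih =>
    intro o ho
    rw [gaussianComponent, Pi.smul_apply, pairCreate, Finset.sum_apply, Finset.sum_eq_zero, smul_zero]
    intro i _
    refine hc (2 * n + 1) i _ (fun o ho => ?_) o (by omega)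
    rw [field_apply]
    refine Finset.sum_eq_zero fun j _ => ?_
    rw [hc (2 * n) j _ ih o ho]
    simp

theorem sum_occ_eq_degree (o : Occ L Λ) : ∑ i, (o i : ℝ) = o.degree := by
  rw [Finsupp.degree_eq_sum]
  push_cast
  rfl

/-- Let g_n be the components. The sum over i of ‖a_i g_{n+1}‖² is the photon number, (2n +
2)‖g_{n+1}‖². It also equals ∑_i ‖∑_j K_ij a*_j g_n‖², at most ρ ∑_j ‖a*_j g_n‖² = ρ(2n + d)‖g_n‖²
for d modes. -/
theorem hasSum_gaussianComponent_succ {K : Mode L Λ → Mode L Λ → ℂ}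
    (hK : ∀ i j, K i j = K j i) {ρ : ℝ}
    (hρ : ∀ x : Mode L Λ → ℂ, ∑ i, ‖∑ j, K i j * x j‖ ^ 2 ≤ ρ * ∑ j, ‖x j‖ ^ 2) {n : ℕ} {N : ℝ}
    (h : HasSum (fun o => ‖gaussianComponent K n o‖ ^ 2) N) :
    ∃ N', HasSum (fun o => ‖gaussianComponent K (n + 1) o‖ ^ 2) N' ∧
      (2 * n + 2) * N' ≤ ρ * ((2 * n + Fintype.card (Mode L Λ)) * N) := by
  have hcs : ∀ j, Summable fun o => ‖create j (gaussianComponent K n) o‖ ^ 2 := fun j => by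
    have : Summable fun o : Occ L Λ => ((o j : ℝ) + 1) * ‖gaussianComponent K n o‖ ^ 2 := by
      refine Summable.of_nonneg_of_le (fun o => by positivity) (fun o => ?_)
        (h.summable.mul_left (2 * n + 1 : ℝ))
      by_cases ho : o.degree = 2 * n
      · have h1 := Finsupp.le_degree j o
        have h2 : (o j : ℝ) ≤ 2 * n := by exact_mod_cast h1.trans ho.le
        gcongr
      · simp [gaussianComponent_eq_zero K n o ho]
    exact ((hasSum_norm_create_sq_iff j _ _).2 this.hasSum).summable
  have hsum : HasSum (fun o => ∑ j, ‖create j (gaussianComponent K n) o‖ ^ 2)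
      ((2 * n + Fintype.card (Mode L Λ)) * N) := by
    have h1 := hasSum_sum (s := Finset.univ) fun (j : Mode L Λ) _ => (hcs j).hasSum
    have h2 := hasSum_sum (s := Finset.univ) fun (j : Mode L Λ) _ =>
      (hasSum_norm_create_sq_iff j _ _).1 (hcs j).hasSum
    have h3 : (fun o : Occ L Λ => ∑ j, ((o j : ℝ) + 1) * ‖gaussianComponent K n o‖ ^ 2) =
        fun o => (2 * n + Fintype.card (Mode L Λ)) * ‖gaussianComponent K n o‖ ^ 2 := by
      funext o
      rw [← Finset.sum_mul, Finset.sum_add_distrib, sum_occ_eq_degree]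
      by_cases ho : o.degree = 2 * n
      · simp [ho]
      · simp [gaussianComponent_eq_zero K n o ho]
    rw [h3] at h2
    rwa [h2.unique (h.mul_left _)] at h1
  have hle : ∀ o, ∑ i, ‖annihilate i (gaussianComponent K (n + 1)) o‖ ^ 2 ≤
      ρ * ∑ j, ‖create j (gaussianComponent K n) o‖ ^ 2 := fun o => by
    refine le_trans (le_of_eq ?_) (hρ fun j => create j (gaussianComponent K n) o)
    refine Finset.sum_congr rfl fun i _ => ?_
    rw [annihilate_gaussianComponent_succ hK, field_apply]
    simp
  have has : ∀ i, Summable fun o => ‖annihilate i (gaussianComponent K (n + 1)) o‖ ^ 2 := fun i =>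
    Summable.of_nonneg_of_le (fun o => by positivity) (fun o =>
      (Finset.single_le_sum (f := fun i => ‖annihilate i (gaussianComponent K (n + 1)) o‖ ^ 2)
        (fun i _ => by positivity) (Finset.mem_univ i)).trans (hle o)) (hsum.summable.mul_left ρ)
  have h1 := hasSum_sum (s := Finset.univ) fun (i : Mode L Λ) _ => (has i).hasSum
  have h2 := hasSum_sum (s := Finset.univ) fun (i : Mode L Λ) _ =>
      (hasSum_norm_annihilate_sq_iff i _ _).1 (has i).hasSum
  have h3 : (fun o : Occ L Λ => ∑ i, (o i : ℝ) * ‖gaussianComponent K (n + 1) o‖ ^ 2) =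
      fun o => (2 * n + 2) * ‖gaussianComponent K (n + 1) o‖ ^ 2 := by
    funext o
    rw [← Finset.sum_mul, sum_occ_eq_degree]
    by_cases ho : o.degree = 2 * (n + 1)
    · rw [ho]; push_cast; ring
    · simp [gaussianComponent_eq_zero K (n + 1) o ho]
  rw [h3] at h2
  have hn : (0 : ℝ) < 2 * n + 2 := by positivity
  set T := ∑ i : Mode L Λ, ∑' o, ‖annihilate i (gaussianComponent K (n + 1)) o‖ ^ 2
  refine ⟨T / (2 * n + 2), ?_, ?_⟩
  · simpa only [mul_div_cancel_left₀ _ hn.ne'] using h2.div_const (2 * n + 2 : ℝ)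
  · rw [mul_div_cancel₀ _ hn.ne']
    exact hasSum_le hle h1 (hsum.mul_left ρ)

/-- Ratio test: the quotients are bounded by a sequence tending to ρ < 1. The weight 2n + 2 is
carried along so that the resulting vector lies in the domain of the annihilation operators. -/
theorem summable_gaussianComponent {K : Mode L Λ → Mode L Λ → ℂ}
    (hK : ∀ i j, K i j = K j i) {ρ : ℝ} (hρ0 : 0 ≤ ρ) (hρ1 : ρ < 1)
    (hρ : ∀ x : Mode L Λ → ℂ, ∑ i, ‖∑ j, K i j * x j‖ ^ 2 ≤ ρ * ∑ j, ‖x j‖ ^ 2) :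
    ∃ N : ℕ → ℝ, (∀ n, HasSum (fun o => ‖gaussianComponent K n o‖ ^ 2) (N n)) ∧
      Summable fun n => (2 * n + 2) * N n := by
  have hex : ∀ n, Summable fun o => ‖gaussianComponent K n o‖ ^ 2 := by
    intro n
    induction n with
    | zero =>
      refine summable_of_ne_finset_zero (s := {0}) fun o ho => ?_
      rw [gaussianComponent, Pi.single_eq_of_ne (by simpa using ho)]
      simp
    | succ n ih =>
      obtain ⟨N', h, -⟩ := hasSum_gaussianComponent_succ hK hρ ih.hasSum
      exact h.summable
  refine ⟨fun n => ∑' o, ‖gaussianComponent K n o‖ ^ 2, fun n => (hex n).hasSum, ?_⟩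
  set N : ℕ → ℝ := fun n => ∑' o, ‖gaussianComponent K n o‖ ^ 2 with hN
  have hN0 : ∀ n, 0 ≤ N n := fun n => tsum_nonneg fun o => by positivity
  have hstep : ∀ n : ℕ, (2 * n + 2) * N (n + 1) ≤
      ρ * ((2 * n + Fintype.card (Mode L Λ)) * N n) := fun n => by
    obtain ⟨N', h, h'⟩ := hasSum_gaussianComponent_succ hK hρ (hex n).hasSum
    have h1 : N (n + 1) = N' := h.tsum_eq
    rwa [h1]
  obtain ⟨r, hr1, hr2⟩ := exists_between hρ1
  refine summable_of_ratio_norm_eventually_le (r := r) hr2 ?_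
  have hlim : Filter.Tendsto (fun n : ℕ => ρ * ((1 + 1 / ((n : ℝ) + 1)) *
      (1 + (Fintype.card (Mode L Λ) : ℝ) / 2 * (1 / ((n : ℝ) + 1))))) Filter.atTop
      (nhds (ρ * ((1 + 0) * (1 + (Fintype.card (Mode L Λ) : ℝ) / 2 * 0)))) := by
    have := tendsto_one_div_add_atTop_nhds_zero_nat (𝕜 := ℝ)
    exact ((this.const_add 1).mul ((this.const_mul _).const_add 1)).const_mul ρ
  have hr1' : ρ * ((1 + 0) * (1 + (Fintype.card (Mode L Λ) : ℝ) / 2 * 0)) < r := by simpa using hr1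
  filter_upwards [hlim.eventually_lt_const hr1'] with n hn
  rw [Real.norm_of_nonneg (mul_nonneg (by positivity) (hN0 _)),
    Real.norm_of_nonneg (mul_nonneg (by positivity) (hN0 _))]
  have hn1 : (0 : ℝ) < n + 1 := by positivity
  set d : ℝ := (Fintype.card (Mode L Λ) : ℝ)
  have hd : 0 ≤ d := Nat.cast_nonneg _
  push_cast
  calc (2 * ((n : ℝ) + 1) + 2) * N (n + 1)
      = (1 + 1 / ((n : ℝ) + 1)) * ((2 * n + 2) * N (n + 1)) := by field_simp
    _ ≤ (1 + 1 / ((n : ℝ) + 1)) * (ρ * ((2 * n + d) * N n)) :=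
        mul_le_mul_of_nonneg_left (hstep n) (by positivity)
    _ ≤ (1 + 1 / ((n : ℝ) + 1)) * (ρ * ((2 * n + 2 + d) * N n)) := by
        have := hN0 n
        gcongr
        linarith
    _ = ρ * ((1 + 1 / ((n : ℝ) + 1)) * (1 + d / 2 * (1 / ((n : ℝ) + 1)))) *
          ((2 * n + 2) * N n) := by field_simp
    _ ≤ r * ((2 * n + 2) * N n) := by
        have := hN0 n
        gcongr

theorem exists_gaussianState {K : Mode L Λ → Mode L Λ → ℂ}
    (hK : ∀ i j, K i j = K j i) {ρ : ℝ} (hρ0 : 0 ≤ ρ) (hρ1 : ρ < 1)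
    (hρ : ∀ x : Mode L Λ → ℂ, ∑ i, ‖∑ j, K i j * x j‖ ^ 2 ≤ ρ * ∑ j, ‖x j‖ ^ 2) :
    ∃ Ω : Fock L Λ, Ω ≠ 0 ∧ InDomain Ω ∧
      ∀ i, annihilate i (Ω : Occ L Λ → ℂ) = field 0 (K i) (Ω : Occ L Λ → ℂ) := by
  obtain ⟨N, hN, hNs⟩ := summable_gaussianComponent hK hρ0 hρ1 hρ
  -- Each component lives on a single degree, so the full vector is read off from the component
  -- numbered by half the degree; at odd degrees that component vanishes.
  set w : Occ L Λ → ℂ := fun o => gaussianComponent K (o.degree / 2) o with hw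
  have hN0 : ∀ n, 0 ≤ N n := fun n => (hN n).nonneg fun o => by positivity
  have hsum : Summable fun o : Occ L Λ => ((o.degree : ℝ) + 1) * ‖w o‖ ^ 2 := by
    refine summable_of_sum_le (c := ∑' n : ℕ, (2 * n + 2) * N n) (fun o => by positivity) fun s => ?_
    set M := s.sup (fun o => o.degree / 2) + 1
    calc ∑ o ∈ s, ((o.degree : ℝ) + 1) * ‖w o‖ ^ 2
        ≤ ∑ o ∈ s, ∑ n ∈ Finset.range M, (2 * n + 2) * ‖gaussianComponent K n o‖ ^ 2 := by
          refine Finset.sum_le_sum fun o ho => ?_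
          have hmem : o.degree / 2 ∈ Finset.range M :=
            Finset.mem_range.2 (Nat.lt_succ_of_le (Finset.le_sup (f := fun o => o.degree / 2) ho))
          refine le_trans ?_ (Finset.single_le_sum
            (f := fun n : ℕ => (2 * n + 2 : ℝ) * ‖gaussianComponent K n o‖ ^ 2)
            (fun n _ => by positivity) hmem)
          have h1 : (o.degree : ℝ) + 1 ≤ 2 * ((o.degree / 2 : ℕ) : ℝ) + 2 := by
            have : o.degree + 1 ≤ 2 * (o.degree / 2) + 2 := by omega
            exact_mod_cast this
          gcongr
      _ = ∑ n ∈ Finset.range M, (2 * n + 2) * ∑ o ∈ s, ‖gaussianComponent K n o‖ ^ 2 := by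
          rw [Finset.sum_comm]
          simp only [Finset.mul_sum]
      _ ≤ ∑ n ∈ Finset.range M, (2 * n + 2) * N n := by
          gcongr with n hn
          exact sum_le_hasSum s (fun o _ => by positivity) (hN n)
      _ ≤ ∑' n : ℕ, (2 * n + 2) * N n :=
          hNs.sum_le_tsum _ fun n _ => mul_nonneg (by positivity) (hN0 n)
  have hw2 : Memℓp w 2 := memℓp_two_iff.2
    (Summable.of_nonneg_of_le (fun o => by positivity)
      (fun o => le_mul_of_one_le_left (by positivity) (by simp)) hsum)
  refine ⟨⟨w, hw2⟩, fun h => ?_, fun m => memℓp_two_iff.2 ?_, fun i => ?_⟩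
  · have h0 : w 0 = 0 := congrArg (fun v : Fock L Λ => (v : Occ L Λ → ℂ) 0) h
    simp [hw, gaussianComponent] at h0
  · have : Summable fun o : Occ L Λ => (o m : ℝ) * ‖w o‖ ^ 2 := by
      refine Summable.of_nonneg_of_le (fun o => by positivity) (fun o => ?_) hsum
      have h1 : (o m : ℝ) ≤ o.degree := by exact_mod_cast Finsupp.le_degree m o
      gcongr
      linarith
    exact ((hasSum_norm_annihilate_sq_iff m _ _).2 this.hasSum).summable
  · funext o
    have hc : ∀ j, create j w o =
        create j (gaussianComponent K ((o.degree + 1) / 2 - 1)) o := fun j => by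
      by_cases ho : o j = 0
      · simp [create, ho]
      · have h1 := degree_sub_single o ho
        rw [create, create, hw]
        dsimp only
        congr 3
        omega
    have ha : annihilate i w o = annihilate i (gaussianComponent K ((o.degree + 1) / 2)) o := by
      rw [annihilate, annihilate, hw]
      dsimp only
      rw [degree_add_single]
    show annihilate i w o = field 0 (K i) w o
    rw [ha, field_apply]
    simp only [hc]
    by_cases ho : o.degree = 0
    · have h0 : o = 0 := by rwa [Finsupp.degree_eq_zero_iff] at ho
      subst h0
      rw [ho, annihilate_gaussianComponent_zero]
      simp [create]
    · obtain ⟨k, hk⟩ : ∃ k, (o.degree + 1) / 2 = k + 1 := ⟨(o.degree + 1) / 2 - 1, by omega⟩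
      rw [hk, annihilate_gaussianComponent_succ hK, field_apply, Nat.add_sub_cancel]
      simp only [Pi.zero_apply, zero_mul]

end GaussianState

/-! ### Positive matrices commuting with an antiunitary involution -/

section Squeezing

open Matrix

variable {M : Type*} [Fintype M]

theorem sum_norm_sq_eq (x : M → ℂ) : ∑ i, ‖x i‖ ^ 2 = (star x ⬝ᵥ x).re := by
  rw [dotProduct, Complex.re_sum]
  refine Finset.sum_congr rfl fun i _ => ?_
  rw [Pi.star_apply, Complex.star_def, Complex.conj_mul', ← Complex.ofReal_pow, Complex.ofReal_re]

theorem re_star_dotProduct_comm (x y : M → ℂ) : (star x ⬝ᵥ y).re = (star y ⬝ᵥ x).re := by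
  have h : star x ⬝ᵥ y = star (star y ⬝ᵥ x) := star_dotProduct x y
  rw [h]
  exact Complex.conj_re _

theorem star_mulVec_dotProduct {Z : Matrix M M ℂ} (hZ : Zᴴ = Z) (x y : M → ℂ) :
    star (Z *ᵥ x) ⬝ᵥ y = star x ⬝ᵥ Z *ᵥ y := by
  rw [star_mulVec, hZ, dotProduct_mulVec]

theorem sum_norm_add_sq (x y : M → ℂ) :
    ∑ i, ‖(x + y) i‖ ^ 2 = ∑ i, ‖x i‖ ^ 2 + 2 * (star x ⬝ᵥ y).re + ∑ i, ‖y i‖ ^ 2 := by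
  simp only [sum_norm_sq_eq, star_add, add_dotProduct, dotProduct_add, Complex.add_re]
  rw [re_star_dotProduct_comm y x]
  ring

theorem sum_norm_smul_sq (c : ℂ) (x : M → ℂ) :
    ∑ i, ‖(c • x) i‖ ^ 2 = ‖c‖ ^ 2 * ∑ i, ‖x i‖ ^ 2 := by
  simp only [Pi.smul_apply, norm_smul, mul_pow, Finset.mul_sum]

theorem sum_norm_mulVec_sq_le (Z : Matrix M M ℂ) (x : M → ℂ) :
    ∑ i, ‖(Z *ᵥ x) i‖ ^ 2 ≤ (∑ i, ∑ j, ‖Z i j‖ ^ 2) * ∑ j, ‖x j‖ ^ 2 := by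
  rw [Finset.sum_mul]
  refine Finset.sum_le_sum fun i _ => ?_
  calc ‖(Z *ᵥ x) i‖ ^ 2 ≤ (∑ j, ‖Z i j‖ * ‖x j‖) ^ 2 := by
        gcongr
        refine (norm_sum_le _ _).trans (le_of_eq ?_)
        simp only [norm_mul]
    _ ≤ _ := Finset.sum_mul_sq_le_sq_mul_sq _ _ _

/-- The antilinear map `x ↦ S x̄`. -/
def conjBy (S : Matrix M M ℂ) (x : M → ℂ) : M → ℂ := S *ᵥ star x

theorem conjBy_add (S : Matrix M M ℂ) (x y : M → ℂ) :
    conjBy S (x + y) = conjBy S x + conjBy S y := by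
  rw [conjBy, star_add, mulVec_add]; rfl

theorem conjBy_neg (S : Matrix M M ℂ) (x : M → ℂ) : conjBy S (-x) = -conjBy S x := by
  rw [conjBy, star_neg, mulVec_neg]; rfl

theorem conjBy_smul (S : Matrix M M ℂ) (a : ℝ) (x : M → ℂ) :
    conjBy S ((a : ℂ) • x) = (a : ℂ) • conjBy S x := by
  rw [conjBy, star_smul, Complex.star_def, Complex.conj_ofReal, mulVec_smul]; rfl

theorem conjBy_mulVec {S Z : Matrix M M ℂ} (hZ : Zᴴ = Z) (hSZ : S * Zᵀ = Z * S) (x : M → ℂ) :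
    conjBy S (Z *ᵥ x) = Z *ᵥ conjBy S x := by
  rw [conjBy, conjBy, star_mulVec, hZ, mulVec_mulVec, ← hSZ, ← mulVec_mulVec, mulVec_transpose]

variable [DecidableEq M]

theorem isUnit_smul_one_add {Z : Matrix M M ℂ} (hpos : ∀ x, 0 ≤ (star x ⬝ᵥ Z *ᵥ x).re) {a : ℝ}
    (ha : 0 < a) : IsUnit ((a : ℂ) • (1 : Matrix M M ℂ) + Z) := by
  rw [← mulVec_injective_iff_isUnit, ← coe_mulVecLin, injective_iff_map_eq_zero]
  intro x hx
  have h1 : (a : ℂ) • x + Z *ᵥ x = 0 := by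
    simpa [add_mulVec, smul_mulVec] using hx
  have h2 := congrArg (fun v => (star x ⬝ᵥ v).re) h1
  simp only [dotProduct_add, dotProduct_smul, Complex.add_re, dotProduct_zero, Complex.zero_re,
    smul_eq_mul, Complex.re_ofReal_mul, ← sum_norm_sq_eq] at h2
  have h3 := hpos x
  have h4 : 0 ≤ ∑ i, ‖x i‖ ^ 2 := Finset.sum_nonneg fun i _ => by positivity
  have h5 : ∑ i, ‖x i‖ ^ 2 = 0 := by nlinarith
  funext i
  have := (Finset.sum_eq_zero_iff_of_nonneg fun i _ => by positivity).1 h5 i (Finset.mem_univ i)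
  simpa using this

theorem exists_inverse_smul_one_add {Z : Matrix M M ℂ} (hpos : ∀ x, 0 ≤ (star x ⬝ᵥ Z *ᵥ x).re)
    {a : ℝ} (ha : 0 < a) : ∃ R : Matrix M M ℂ, R * ((a : ℂ) • (1 : Matrix M M ℂ) + Z) = 1 ∧
      ((a : ℂ) • (1 : Matrix M M ℂ) + Z) * R = 1 := by
  obtain ⟨u, hu⟩ := isUnit_smul_one_add hpos ha
  exact ⟨↑u⁻¹, by rw [← hu, Units.inv_mul], by rw [← hu, Units.mul_inv]⟩

theorem conjBy_conjBy {S : Matrix M M ℂ} (hS : Sᵀ = S) (hS1 : S * Sᴴ = 1) (x : M → ℂ) :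
    conjBy S (conjBy S x) = x := by
  have h : star (S *ᵥ star x) = Sᴴ *ᵥ x := by
    rw [star_mulVec, star_star, ← mulVec_transpose]
    congr 1
    rw [conjTranspose, hS, ← transpose_map, hS]
  rw [conjBy, conjBy, h, mulVec_mulVec, hS1, one_mulVec]

theorem sum_norm_mulVec_unitary {S : Matrix M M ℂ} (hS1 : S * Sᴴ = 1) (x : M → ℂ) :
    ∑ i, ‖(S *ᵥ x) i‖ ^ 2 = ∑ i, ‖x i‖ ^ 2 := by
  rw [sum_norm_sq_eq, sum_norm_sq_eq, star_mulVec, ← dotProduct_mulVec, mulVec_mulVec,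
    mul_eq_one_comm.1 hS1, one_mulVec]

theorem sum_norm_conjBy {S : Matrix M M ℂ} (hS1 : S * Sᴴ = 1) (x : M → ℂ) :
    ∑ i, ‖conjBy S x i‖ ^ 2 = ∑ i, ‖x i‖ ^ 2 := by
  rw [conjBy, sum_norm_mulVec_unitary hS1]
  simp

/-- With y = QF and q = ⟨y, F⟩ one has q = ‖y‖² + ⟨y, Zy⟩ ≥ c q². So a rank-one lower bound c|F⟩⟨F|
on Z caps the variance of the field of F in the squeezed state at 1/c. -/
theorem re_dotProduct_le_of_le {Z Q : Matrix M M ℂ} (hpos : ∀ x, 0 ≤ (star x ⬝ᵥ Z *ᵥ x).re)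
    (hQ : (1 + Z) * Q = 1) {F : M → ℂ} {c : ℝ} (hc : 0 < c)
    (hF : ∀ x, c * ‖star F ⬝ᵥ x‖ ^ 2 ≤ (star x ⬝ᵥ Z *ᵥ x).re) :
    (star (Q *ᵥ F) ⬝ᵥ F).re ≤ 1 / c := by
  set y := Q *ᵥ F with hy
  have h1 : F = y + Z *ᵥ y := by
    rw [hy, mulVec_mulVec, ← add_mulVec]
    conv_lhs => rw [← one_mulVec F, ← hQ, add_mul, one_mul]
  have h2 : (star y ⬝ᵥ F).re = ∑ i, ‖y i‖ ^ 2 + (star y ⬝ᵥ Z *ᵥ y).re := by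
    conv_lhs => rw [h1, dotProduct_add, Complex.add_re, ← sum_norm_sq_eq]
  have h3 : 0 ≤ ∑ i, ‖y i‖ ^ 2 := Finset.sum_nonneg fun i _ => by positivity
  have h4 := hF y
  have h5 : (star y ⬝ᵥ F).re ≤ ‖star F ⬝ᵥ y‖ := by
    rw [re_star_dotProduct_comm]
    exact Complex.re_le_norm _
  have h0 : 0 ≤ (star y ⬝ᵥ F).re := by
    have := hpos y
    linarith
  have h6 : c * (star y ⬝ᵥ F).re ^ 2 ≤ (star y ⬝ᵥ F).re := by
    have : (star y ⬝ᵥ F).re ^ 2 ≤ ‖star F ⬝ᵥ y‖ ^ 2 := by gcongr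
    have := mul_le_mul_of_nonneg_left this hc.le
    linarith
  rw [le_div_iff₀ hc]
  by_contra hcon
  push Not at hcon
  nlinarith

end Squeezing

/-! ### The squeezed state belonging to a positive matrix -/

section SqueezedState

open Matrix

variable {L Λ : ℝ} [Fintype (Mode L Λ)]

theorem field_add_coeff (b c b' c' : Mode L Λ → ℂ) (f : Occ L Λ → ℂ) :
    field (b + b') (c + c') f = field b c f + field b' c' f := by
  simp only [field, ← Finset.sum_add_distrib]
  refine Finset.sum_congr rfl fun m _ => ?_
  simp only [Pi.add_apply, add_smul]
  abel

variable [DecidableEq (Mode L Λ)]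

theorem field_single_zero (m : Mode L Λ) (f : Occ L Λ → ℂ) :
    field (Pi.single m 1) 0 f = annihilate m f := by
  rw [field, Finset.sum_eq_single m]
  · simp
  · intro i _ hi
    simp [Pi.single_eq_of_ne hi]
  · simp

/-- Let J be the antiunitary involution `conjBy S`, which commutes with Z, and let B = Z(2 + Z)⁻¹.
The Gaussian state with K = -BS is annihilated by a(u) + a*(BJu) for all u (`hkill`). By the
commutation relations the adjoint combinations then have explicit norms (`hnorm`), and any field is
reduced to such a combination by subtracting one that annihilates Ω. For JF = F the vacuum variance
‖F‖² becomes ⟨(1 + Z)⁻¹F, F⟩. The photon number in mode m is the diagonal entry of B²(1 - B²)⁻¹ =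
Z²(1 + Z)⁻¹/4, which is at most that of Z/4. -/
theorem exists_squeezedState {S Z : Matrix (Mode L Λ) (Mode L Λ) ℂ} (hS : Sᵀ = S)
    (hS1 : S * Sᴴ = 1) (hZ : Zᴴ = Z) (hpos : ∀ x, 0 ≤ (star x ⬝ᵥ Z *ᵥ x).re)
    (hSZ : S * Zᵀ = Z * S) :
    ∃ (Ω : Fock L Λ) (hΩ : InDomain Ω) (Q : Matrix (Mode L Λ) (Mode L Λ) ℂ), Ω ≠ 0 ∧
      (1 + Z) * Q = 1 ∧ (∀ m, ‖hΩ.ann m‖ ^ 2 ≤ 1 / 4 * (Z m m).re * ‖Ω‖ ^ 2) ∧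
      ∀ F, conjBy S F = F →
        ‖hΩ.field (star F) F‖ ^ 2 = (star (Q *ᵥ F) ⬝ᵥ F).re * ‖Ω‖ ^ 2 := by
  obtain ⟨R, hR1, hR2⟩ := exists_inverse_smul_one_add hpos (a := 2) two_pos
  obtain ⟨Q, hQ1, hQ2⟩ := exists_inverse_smul_one_add hpos (a := 1) one_pos
  rw [Complex.ofReal_one, one_smul] at hQ1 hQ2
  set B := Z * R with hB
  have hBmul : ∀ x : Mode L Λ → ℂ, B *ᵥ ((2 : ℂ) • x + Z *ᵥ x) = Z *ᵥ x := fun x => by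
    have : (2 : ℂ) • x + Z *ᵥ x = (((2 : ℝ) : ℂ) • (1 : Matrix (Mode L Λ) (Mode L Λ) ℂ) + Z) *ᵥ x := by
      rw [add_mulVec, smul_mulVec, one_mulVec]
      push_cast
      rfl
    rw [this, mulVec_mulVec, hB, mul_assoc, hR1, mul_one]
  have hRS : S * Rᵀ = R * S := by
    set W := ((2 : ℝ) : ℂ) • (1 : Matrix (Mode L Λ) (Mode L Λ) ℂ) + Z with hW
    have h1 : S * Wᵀ = W * S := by
      rw [hW, transpose_add, transpose_smul, transpose_one, mul_add, add_mul, hSZ]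
      simp
    have h2 : Wᵀ * Rᵀ = 1 := by rw [← transpose_mul, hR1, transpose_one]
    calc S * Rᵀ = R * W * S * Rᵀ := by rw [hR1, one_mul]
      _ = R * (S * Wᵀ) * Rᵀ := by rw [h1]; simp only [mul_assoc]
      _ = R * S * (Wᵀ * Rᵀ) := by simp only [mul_assoc]
      _ = R * S := by rw [h2, mul_one]
  have hZR : Z * R = R * Z := by
    have h1 := hR1.trans hR2.symm
    rw [mul_add, add_mul, mul_smul_comm, smul_mul_assoc, mul_one, one_mul] at h1
    exact (add_left_cancel h1).symm
  have hRh : Rᴴ = R := by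
    have h1 : Rᴴ * (((2 : ℝ) : ℂ) • (1 : Matrix (Mode L Λ) (Mode L Λ) ℂ) + Z) = 1 := by
      have := congrArg conjTranspose hR2
      rw [conjTranspose_mul, conjTranspose_add, conjTranspose_smul, conjTranspose_one, hZ,
        Complex.star_def, Complex.conj_ofReal] at this
      exact this
    calc Rᴴ = Rᴴ * ((((2 : ℝ) : ℂ) • (1 : Matrix (Mode L Λ) (Mode L Λ) ℂ) + Z) * R) := by
          rw [hR2, mul_one]
      _ = R := by rw [← mul_assoc, h1, one_mul]
  have hBh : Bᴴ = B := by rw [hB, conjTranspose_mul, hRh, hZ, hZR]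
  have hSB : S * Bᵀ = B * S := by
    rw [hB, hZR, transpose_mul, ← mul_assoc, hSZ, mul_assoc, hRS, ← mul_assoc, hZR]
  have hBsym : (B * S)ᵀ = B * S := by rw [transpose_mul, hS, hSB]
  set C := ∑ i, ∑ j, ‖Z i j‖ ^ 2 with hC
  have hC0 : 0 ≤ C := Finset.sum_nonneg fun i _ => Finset.sum_nonneg fun j _ => by positivity
  -- B is a strict contraction, as the Gaussian state requires. For v = (2 + Z)u one has Bv = Zu,
  -- ‖v‖² ≥ 4‖u‖² + ‖Zu‖² and ‖Zu‖² ≤ C‖u‖².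
  have hBle : ∀ v : Mode L Λ → ℂ, ∑ i, ‖(B *ᵥ v) i‖ ^ 2 ≤ C / (4 + C) * ∑ i, ‖v i‖ ^ 2 := by
    intro v
    set u := R *ᵥ v with hu
    have hv : v = (2 : ℂ) • u + Z *ᵥ u := by
      have : (((2 : ℝ) : ℂ) • (1 : Matrix (Mode L Λ) (Mode L Λ) ℂ) + Z) *ᵥ u = v := by
        rw [hu, mulVec_mulVec, hR2, one_mulVec]
      rw [← this, add_mulVec, smul_mulVec, one_mulVec]
      push_cast
      rfl
    rw [hv, hBmul, sum_norm_add_sq, sum_norm_smul_sq]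
    have h1 := sum_norm_mulVec_sq_le Z u
    have h2 := hpos u
    have h3 : (star ((2 : ℂ) • u) ⬝ᵥ Z *ᵥ u).re = 2 * (star u ⬝ᵥ Z *ᵥ u).re := by
      rw [star_smul, smul_dotProduct]
      simp
    rw [h3, div_mul_eq_mul_div, le_div_iff₀ (by positivity), ← hC] at *
    have h4 : ‖(2 : ℂ)‖ = 2 := by simp
    rw [h4]
    nlinarith [mul_nonneg hC0 h2]
  obtain ⟨Ω, hΩ0, hΩ, hK⟩ := exists_gaussianState (L := L) (Λ := Λ) (K := fun i j => -(B * S) i j)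
    (fun i j => by rw [← hBsym, transpose_apply, hBsym]) (ρ := C / (4 + C)) (by positivity)
    (by rw [div_lt_one (by positivity)]; linarith) (fun x => by
      have h1 : ∀ i, ∑ j, -(B * S) i j * x j = -((B *ᵥ (S *ᵥ x)) i) := fun i => by
        rw [mulVec_mulVec, mulVec, dotProduct, ← Finset.sum_neg_distrib]
        exact Finset.sum_congr rfl fun j _ => neg_mul _ _
      simp only [h1, norm_neg]
      rw [← sum_norm_mulVec_unitary hS1 x]
      exact hBle _)
  have hkill : ∀ u : Mode L Λ → ℂ, hΩ.field (star u) (B *ᵥ conjBy S u) = 0 := by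
    intro u
    apply lp.ext
    rw [hΩ.coe_field]
    have h1 : field (star u) (B *ᵥ conjBy S u) (Ω : Occ L Λ → ℂ) =
        ∑ j, (∑ i, star (u i) * -(B * S) i j + (B *ᵥ conjBy S u) j) • create j (Ω : Occ L Λ → ℂ) := by
      have h2 : ∀ i, star (u i) • annihilate i (Ω : Occ L Λ → ℂ) =
          ∑ j, (star (u i) * -(B * S) i j) • create j (Ω : Occ L Λ → ℂ) := fun i => by
        rw [hK, field, Finset.smul_sum]
        refine Finset.sum_congr rfl fun j _ => ?_
        rw [Pi.zero_apply, zero_smul, zero_add, smul_smul]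
      rw [field, Finset.sum_add_distrib]
      simp only [Pi.star_apply]
      rw [Finset.sum_congr rfl fun i _ => h2 i, Finset.sum_comm, ← Finset.sum_add_distrib]
      simp only [add_smul, Finset.sum_smul]
    rw [h1]
    refine Finset.sum_eq_zero fun j _ => ?_
    have h2 : (B *ᵥ conjBy S u) j = ∑ i, star (u i) * (B * S) i j := by
      rw [conjBy, mulVec_mulVec, ← hBsym, mulVec, dotProduct]
      refine Finset.sum_congr rfl fun i _ => ?_
      rw [transpose_apply, hBsym, mul_comm, Pi.star_apply]
    rw [h2, ← Finset.sum_add_distrib]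
    simp
  have hnorm : ∀ u : Mode L Λ → ℂ, ‖hΩ.field (star (B *ᵥ conjBy S u)) u‖ ^ 2 =
      (∑ i, ‖u i‖ ^ 2 - ∑ i, ‖(B *ᵥ conjBy S u) i‖ ^ 2) * ‖Ω‖ ^ 2 := by
    intro u
    have h1 := hΩ.norm_field_star_sq (star u) (B *ᵥ conjBy S u)
    rw [hkill, norm_zero] at h1
    simp only [Pi.star_apply, star_star, norm_star] at h1
    rw [Finset.sum_sub_distrib, zero_pow two_ne_zero, zero_add] at h1
    exact h1
  have hadd : ∀ b c b' c' : Mode L Λ → ℂ, hΩ.field (b + b') (c + c') =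
      hΩ.field b c + hΩ.field b' c' := by
    intro b c b' c'
    apply lp.ext
    rw [lp.coeFn_add, hΩ.coe_field, hΩ.coe_field, hΩ.coe_field, field_add_coeff]
  refine ⟨Ω, hΩ, Q, hΩ0, hQ2, fun m => ?_, fun F hF => ?_⟩
  · set δ : Mode L Λ → ℂ := Pi.single m 1 with hδ
    set y := Q *ᵥ δ with hy
    have hyδ : y + Z *ᵥ y = δ := by
      have : (1 + Z) *ᵥ y = δ := by rw [hy, mulVec_mulVec, hQ2, one_mulVec]
      rwa [add_mulVec, one_mulVec] at this
    set Zy := Z *ᵥ y with hZy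
    set ZZy := Z *ᵥ Zy with hZZy
    -- This is w = (1 - B²)⁻¹δ, because (2 + Z)²/(4(1 + Z)) = 1 + Z²/(4(1 + Z)). It is chosen so
    -- that, with z = -BJw, the creation parts cancel and the annihilation parts add up to a_m.
    set w := δ + (1 / 4 : ℂ) • ZZy with hw
    have hBw : B *ᵥ w = (1 / 2 : ℂ) • Zy + (1 / 4 : ℂ) • ZZy := by
      have h1 := hBmul ((1 / 2 : ℂ) • y + (1 / 4 : ℂ) • Zy)
      have h2 : (2 : ℂ) • ((1 / 2 : ℂ) • y + (1 / 4 : ℂ) • Zy) +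
          Z *ᵥ ((1 / 2 : ℂ) • y + (1 / 4 : ℂ) • Zy) = w := by
        rw [hw, ← hyδ, mulVec_add, mulVec_smul, mulVec_smul, ← hZy, ← hZZy]
        module
      rw [h2] at h1
      rw [h1, mulVec_add, mulVec_smul, mulVec_smul]
    have hBBw : B *ᵥ (B *ᵥ w) = (1 / 4 : ℂ) • ZZy := by
      have h1 := hBmul ((1 / 4 : ℂ) • Zy)
      have h2 : (2 : ℂ) • ((1 / 4 : ℂ) • Zy) + Z *ᵥ ((1 / 4 : ℂ) • Zy) = B *ᵥ w := by
        rw [hBw, mulVec_smul, ← hZZy]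
        module
      rw [h2, mulVec_smul] at h1
      exact h1
    set z := -(B *ᵥ conjBy S w) with hz
    have hBz : B *ᵥ conjBy S z = -((1 / 4 : ℂ) • ZZy) := by
      rw [hz, conjBy_neg, conjBy_mulVec hBh hSB, conjBy_conjBy hS hS1, mulVec_neg, hBBw]
    have h1 : hΩ.ann m = hΩ.field (star (B *ᵥ conjBy S z)) z := by
      have h2 := hadd (star (B *ᵥ conjBy S z)) z (star w) (B *ᵥ conjBy S w)
      rw [hkill, add_zero] at h2
      have h3 : star (B *ᵥ conjBy S z) + star w = δ := by
        rw [← star_add, hBz, hw, neg_add_cancel_comm_assoc, hδ, Pi.star_single, star_one]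
      rw [← h2, h3, hz, neg_add_cancel]
      apply lp.ext
      rw [hΩ.coe_field, field_single_zero, hΩ.coe_ann]
    have h4 : ∑ i, ‖z i‖ ^ 2 = ∑ i, ‖(B *ᵥ w) i‖ ^ 2 := by
      rw [hz, ← conjBy_mulVec hBh hSB]
      simp only [Pi.neg_apply, norm_neg]
      exact sum_norm_conjBy hS1 _
    rw [h1, hnorm, h4, hBz, hBw]
    gcongr
    have h5 : ∑ i, ‖(-((1 / 4 : ℂ) • ZZy)) i‖ ^ 2 = 1 / 16 * ∑ i, ‖ZZy i‖ ^ 2 := by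
      simp only [Pi.neg_apply, norm_neg]
      rw [sum_norm_smul_sq]
      norm_num
    have h6 : (star ((1 / 2 : ℂ) • Zy) ⬝ᵥ ((1 / 4 : ℂ) • ZZy)).re = 1 / 8 * (star Zy ⬝ᵥ ZZy).re := by
      have : star ((1 / 2 : ℂ) • Zy) = ((1 / 2 : ℝ) : ℂ) • star Zy := by
        rw [star_smul]; simp
      rw [this, smul_dotProduct, dotProduct_smul, smul_eq_mul, smul_eq_mul, ← mul_assoc]
      have h7 : (((1 / 2 : ℝ) : ℂ) * (1 / 4)) = ((1 / 8 : ℝ) : ℂ) := by norm_num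
      rw [h7, Complex.re_ofReal_mul]
    rw [h5, sum_norm_add_sq, h6, sum_norm_smul_sq, sum_norm_smul_sq]
    have h8 : (Z m m).re = (star y ⬝ᵥ Zy).re + ∑ i, ‖Zy i‖ ^ 2 +
        (∑ i, ‖Zy i‖ ^ 2 + (star Zy ⬝ᵥ ZZy).re) := by
      have h9 : (Z m m) = star δ ⬝ᵥ Z *ᵥ δ := by
        rw [hδ, Pi.star_single, star_one]
        simp
      have h10 : star Zy ⬝ᵥ Zy = star y ⬝ᵥ ZZy := star_mulVec_dotProduct hZ _ _
      rw [h9, ← hyδ, mulVec_add, ← hZy, ← hZZy, star_add, add_dotProduct, dotProduct_add,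
        dotProduct_add, sum_norm_sq_eq, Complex.add_re, Complex.add_re, Complex.add_re, ← h10]
    have h11 : 0 ≤ (star y ⬝ᵥ Zy).re := hpos y
    have h12 : 0 ≤ ∑ i, ‖Zy i‖ ^ 2 := Finset.sum_nonneg fun i _ => by positivity
    rw [h8]
    norm_num
    linarith
  · set y := Q *ᵥ F with hy
    have hyF : y + Z *ᵥ y = F := by
      have : (1 + Z) *ᵥ y = F := by rw [hy, mulVec_mulVec, hQ2, one_mulVec]
      rwa [add_mulVec, one_mulVec] at this
    have hyJ : conjBy S y = y := by
      have h1 : conjBy S y + Z *ᵥ conjBy S y = F := by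
        rw [← conjBy_mulVec hZ hSZ, ← conjBy_add, hyF, hF]
      have h2 : (1 + Z) *ᵥ conjBy S y = (1 + Z) *ᵥ y := by
        rw [add_mulVec, one_mulVec, h1, add_mulVec, one_mulVec, hyF]
      have h3 := congrArg (Q *ᵥ ·) h2
      simpa only [mulVec_mulVec, hQ1, one_mulVec] using h3
    -- This is z = (1 + B)⁻¹F, because (1 + B)⁻¹ = (1 + Z/2)(1 + Z)⁻¹. Thus z + Bz = F, and ‖z‖² -
    -- ‖Bz‖² = ‖y‖² + ⟨y, Zy⟩.
    set z := y + (1 / 2 : ℂ) • Z *ᵥ y with hz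
    have hzJ : conjBy S z = z := by
      have h1 : ((1 / 2 : ℂ)) = ((1 / 2 : ℝ) : ℂ) := by norm_num
      rw [hz, conjBy_add, h1, conjBy_smul, conjBy_mulVec hZ hSZ, hyJ]
    have hBz : B *ᵥ conjBy S z = (1 / 2 : ℂ) • Z *ᵥ y := by
      rw [hzJ]
      have h1 := hBmul ((1 / 2 : ℂ) • y)
      have h2 : (2 : ℂ) • ((1 / 2 : ℂ) • y) + Z *ᵥ ((1 / 2 : ℂ) • y) = z := by
        rw [hz, mulVec_smul]
        module
      rw [h2, mulVec_smul] at h1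
      exact h1
    have h1 : hΩ.field (star F) F = hΩ.field (star (B *ᵥ conjBy S z)) z := by
      have h2 := hadd (star (B *ᵥ conjBy S z)) z (star z) (B *ᵥ conjBy S z)
      rw [hkill, add_zero] at h2
      have h3 : B *ᵥ conjBy S z + z = F := by
        rw [hBz, hz, ← hyF]
        module
      rw [← h2, ← star_add, h3, add_comm z, h3]
    rw [h1, hnorm, hBz, hz, sum_norm_add_sq]
    congr 1
    have h2 : (star y ⬝ᵥ (1 / 2 : ℂ) • Z *ᵥ y).re = 1 / 2 * (star y ⬝ᵥ Z *ᵥ y).re := by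
      have h3 : ((1 / 2 : ℂ)) = ((1 / 2 : ℝ) : ℂ) := by norm_num
      rw [h3, dotProduct_smul, smul_eq_mul, Complex.re_ofReal_mul]
    rw [h2, ← hyF, dotProduct_add, Complex.add_re, sum_norm_sq_eq]
    ring

end SqueezedState

/-! ### The common real structure of the vector potentials -/

section Reflection

open Matrix

variable {L Λ : ℝ}

theorem waveVector_neg (L : ℝ) (n : Fin 3 → ℤ) : waveVector L (-n) = -waveVector L n := by
  ext i
  simp only [PiLp.neg_apply, waveVector_apply, Pi.neg_apply]
  push_cast
  ring

theorem planeWave_neg (L : ℝ) (n : Fin 3 → ℤ) (y : Fin 3 → ℝ) :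
    planeWave L (-n) y = star (planeWave L n y) := by
  simp only [planeWave, Complex.star_def, map_prod, ← Complex.exp_conj, map_mul, Complex.conj_I,
    Complex.conj_ofReal]
  refine Finset.prod_congr rfl fun i _ => ?_
  congr 1
  push_cast [Pi.neg_apply]
  ring

/-- The wave vector `-k` as an index. -/
def reflectIndex (n : WaveIndex L Λ) : WaveIndex L Λ :=
  ⟨-n.1, neg_ne_zero.2 n.2.1, by rw [waveVector_neg, norm_neg]; exact n.2.2⟩

theorem reflectIndex_reflectIndex (n : WaveIndex L Λ) : reflectIndex (reflectIndex n) = n :=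
  Subtype.ext (neg_neg _)

theorem eq_reflectIndex_iff {n n' : WaveIndex L Λ} : n' = reflectIndex n ↔ n = reflectIndex n' :=
  ⟨fun h => by rw [h, reflectIndex_reflectIndex], fun h => by rw [h, reflectIndex_reflectIndex]⟩

open scoped Classical in
/-- The matrix of the antiunitary map `a_m ↦ ∑ (ε(k) · ε(-k)) a_m'` on one-photon states which fixes
the coefficient vectors of the vector potential. -/
def reflection (ε : Space → Fin 2 → Space) : Matrix (Mode L Λ) (Mode L Λ) ℂ :=
  Matrix.of fun m m' => if m'.1 = reflectIndex m.1 then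
    ((inner ℝ (ε m.k m.2) (ε m'.k m'.2) : ℝ) : ℂ) else 0

theorem reflection_transpose (ε : Space → Fin 2 → Space) :
    (reflection (L := L) (Λ := Λ) ε)ᵀ = reflection ε := by
  ext m m'
  simp only [reflection, transpose_apply, of_apply, eq_reflectIndex_iff (n := m'.1),
    real_inner_comm]

variable [Fintype (WaveIndex L Λ)]

theorem sum_reflection_mul (ε : Space → Fin 2 → Space) (m : Mode L Λ) (v : Mode L Λ → ℂ) :
    ∑ m', reflection ε m m' * v m' = ∑ s, ((inner ℝ (ε m.k m.2) (ε (-m.k) s) : ℝ) : ℂ) *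
      v (reflectIndex m.1, s) := by
  rw [Fintype.sum_prod_type, Finset.sum_eq_single (reflectIndex m.1)]
  · refine Finset.sum_congr rfl fun s _ => ?_
    simp only [reflection, of_apply, if_true, Mode.k, reflectIndex, waveVector_neg]
  · intro n _ hn
    refine Finset.sum_eq_zero fun s _ => ?_
    simp [reflection, hn]
  · simp

/-- The polarization vectors at -k are complete in the plane perpendicular to k, which contains
those at k. -/
theorem reflection_mul_conjTranspose [DecidableEq (Mode L Λ)] (hL : 0 < L)
    {ε : Space → Fin 2 → Space} (hε : IsPolarization ε) :
    reflection (L := L) (Λ := Λ) ε * (reflection ε)ᴴ = 1 := by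
  ext m m'
  rw [mul_apply]
  simp only [conjTranspose_apply]
  rw [sum_reflection_mul ε m fun j => star (reflection ε m' j)]
  have hk : m.k ≠ 0 := waveVector_ne_zero hL m.1.2.1
  by_cases h : m.1 = m'.1
  · have hk' : m'.k = m.k := by simp only [Mode.k, h]
    have h1 : ∀ s, star (reflection ε m' (reflectIndex m.1, s)) =
        ((inner ℝ (ε m.k m'.2) (ε (-m.k) s) : ℝ) : ℂ) := fun s => by
      have h2 : Mode.k ((reflectIndex m.1, s) : Mode L Λ) = -m.k := waveVector_neg _ _
      simp only [reflection, of_apply, h, if_true, Complex.star_def, Complex.conj_ofReal]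
      rw [← h, h2, hk']
    simp only [h1]
    have h3 := polarization_completeness hε (neg_ne_zero.2 hk) (ε m.k m.2) (ε m.k m'.2)
    rw [inner_neg_left, real_inner_comm, (hε _ hk).2, neg_zero, zero_mul, zero_div, add_zero] at h3
    have h4 := orthonormal_iff_ite.1 (hε _ hk).1 m.2 m'.2
    rw [h4] at h3
    have h5 := congrArg (fun r : ℝ => (r : ℂ)) h3
    simp only [Complex.ofReal_sum, Complex.ofReal_mul] at h5
    simp only [real_inner_comm (ε (-m.k) _)] at h5 ⊢
    simp only [real_inner_comm] at h5 ⊢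
    rw [h5, one_apply]
    have : m = m' ↔ m.2 = m'.2 := ⟨fun h => by rw [h], fun h' => Prod.ext h h'⟩
    simp only [this]
    split_ifs <;> simp
  · rw [one_apply_ne (fun h' => h (by rw [h']))]
    refine Finset.sum_eq_zero fun s _ => ?_
    have : reflectIndex m.1 ≠ reflectIndex m'.1 := fun h' => h (by
      rw [← reflectIndex_reflectIndex m.1, h', reflectIndex_reflectIndex])
    simp [reflection, this]

/-- Passing from k to -k conjugates the phase and keeps |k|, while the change of polarization basis
is undone by completeness. One involution fixes the vectors of all points x and all components j,
hence it commutes with every Z built from them. -/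
theorem conjBy_reflection_potVec (hL : 0 < L) {ε : Space → Fin 2 → Space} (hε : IsPolarization ε)
    (j : Fin 3) (x : Space) :
    conjBy (reflection ε) (potVec ε j x : Mode L Λ → ℂ) = potVec ε j x := by
  funext m
  have hk : m.k ≠ 0 := waveVector_ne_zero hL m.1.2.1
  rw [conjBy, mulVec, dotProduct, sum_reflection_mul]
  have h3 := polarization_completeness hε (neg_ne_zero.2 hk) (ε m.k m.2)
    (EuclideanSpace.single j (1 : ℝ))
  rw [inner_neg_left, real_inner_comm, (hε _ hk).2, neg_zero, zero_mul, zero_div, add_zero] at h3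
  simp only [EuclideanSpace.inner_single_right] at h3
  have h5 := congrArg (fun r : ℝ => (r : ℂ)) h3
  simp only [Complex.ofReal_sum, Complex.ofReal_mul] at h5
  have h1 : ∀ s, star (potVec ε j x : Mode L Λ → ℂ) (reflectIndex m.1, s) =
      ((1 / Real.sqrt (2 * L ^ 3) * (1 / Real.sqrt ‖m.k‖) : ℝ) : ℂ) * star (planeWave L m.1.1 x) *
        (ε (-m.k) s j : ℂ) := fun s => by
    have h2 : Mode.k ((reflectIndex m.1, s) : Mode L Λ) = -m.k := waveVector_neg _ _
    have h4 : planeWave L (reflectIndex m.1).1 x = star (planeWave L m.1.1 x) :=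
      planeWave_neg _ _ _
    rw [Pi.star_apply, potVec, potCoef, h2, norm_neg, star_mul', star_star, h4, Complex.star_def,
      Complex.conj_ofReal]
    push_cast
    ring
  simp only [h1]
  rw [potVec, potCoef]
  have h6 : ∀ s, ((inner ℝ (ε m.k m.2) (ε (-m.k) s) : ℝ) : ℂ) *
      (((1 / Real.sqrt (2 * L ^ 3) * (1 / Real.sqrt ‖m.k‖) : ℝ) : ℂ) * star (planeWave L m.1.1 x) *
        (ε (-m.k) s j : ℂ)) = ((1 / Real.sqrt (2 * L ^ 3) * (1 / Real.sqrt ‖m.k‖) : ℝ) : ℂ) *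
        star (planeWave L m.1.1 x) * (((inner ℝ (ε (-m.k) s) (ε m.k m.2) : ℝ) : ℂ) *
          (ε (-m.k) s j : ℂ)) := fun s => by
    rw [real_inner_comm]
    ring
  simp only [h6]
  rw [← Finset.mul_sum]
  have h7 : ∑ s, (((inner ℝ (ε (-m.k) s) (ε m.k m.2) : ℝ) : ℂ) * (ε (-m.k) s j : ℂ)) =
      (ε m.k m.2 j : ℂ) := by
    simpa using h5
  rw [h7]
  push_cast
  ring

end Reflection

/-! ### Infinite sums of rank-one matrices -/

section PositiveSeries

open Matrix

variable {M T : Type*} [Fintype M]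

/-- Z is the sum of c_t |F_t⟩⟨F_t|. The series is infinite although the space is finite dimensional,
since the sample points fill a whole lattice. Each single term bounds Z from below, and each
commutes with any antilinear involution fixing F_t. -/
theorem exists_tsum_rankOne {c : T → ℝ} (hc0 : ∀ t, 0 ≤ c t) (hc : Summable c) {F : T → M → ℂ}
    {C : ℝ} (hF : ∀ t m, ‖F t m‖ ≤ C) :
    ∃ Z : Matrix M M ℂ, Zᴴ = Z ∧ (∀ x, 0 ≤ (star x ⬝ᵥ Z *ᵥ x).re) ∧
      (∀ t x, c t * ‖star (F t) ⬝ᵥ x‖ ^ 2 ≤ (star x ⬝ᵥ Z *ᵥ x).re) ∧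
      (∀ m, HasSum (fun t => c t * ‖F t m‖ ^ 2) (Z m m).re) ∧
      ∀ S : Matrix M M ℂ, Sᵀ = S → (∀ t, conjBy S (F t) = F t) → S * Zᵀ = Z * S := by
  have hs : ∀ m l, Summable fun t => (c t : ℂ) * (F t m * star (F t l)) := fun m l => by
    refine Summable.of_norm_bounded (hc.mul_right (C * C)) fun t => ?_
    have h0 : 0 ≤ C := (norm_nonneg _).trans (hF t m)
    rw [norm_mul, norm_mul, norm_star, Complex.norm_real, Real.norm_of_nonneg (hc0 t)]
    have := hF t m
    have := hF t l
    have := hc0 t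
    gcongr
  set Z : Matrix M M ℂ := Matrix.of fun m l => ∑' t, (c t : ℂ) * (F t m * star (F t l)) with hZ
  have hZs : ∀ m l, HasSum (fun t => (c t : ℂ) * (F t m * star (F t l))) (Z m l) :=
    fun m l => (hs m l).hasSum
  have hquad : ∀ x, HasSum (fun t => c t * ‖star (F t) ⬝ᵥ x‖ ^ 2) (star x ⬝ᵥ Z *ᵥ x).re := by
    intro x
    have h1 : HasSum (fun t => ∑ m, star (x m) * ∑ l, (c t : ℂ) * (F t m * star (F t l)) * x l)
        (star x ⬝ᵥ Z *ᵥ x) :=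
      hasSum_sum fun m _ => (hasSum_sum fun l _ => (hZs m l).mul_right (x l)).mul_left (star (x m))
    have h2 := Complex.hasSum_re h1
    convert h2 using 2 with t
    have h3 : ∑ m, star (x m) * ∑ l, (c t : ℂ) * (F t m * star (F t l)) * x l =
        (c t : ℂ) * (star (star (F t) ⬝ᵥ x) * (star (F t) ⬝ᵥ x)) := by
      rw [← star_dotProduct]
      rw [dotProduct, dotProduct, Finset.sum_mul_sum, Finset.mul_sum]
      refine Finset.sum_congr rfl fun m _ => ?_
      rw [Finset.mul_sum, Finset.mul_sum]
      refine Finset.sum_congr rfl fun l _ => ?_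
      simp only [Pi.star_apply]
      ring
    rw [h3, Complex.star_def, Complex.conj_mul', Complex.re_ofReal_mul, ← Complex.ofReal_pow,
      Complex.ofReal_re]
  refine ⟨Z, ?_, fun x => (hquad x).nonneg fun t => mul_nonneg (hc0 t) (by positivity),
    fun t x => le_hasSum (hquad x) t fun t _ => mul_nonneg (hc0 t) (by positivity), fun m => ?_,
    fun S hS hSF => ?_⟩
  · ext m l
    rw [conjTranspose_apply]
    refine (hZs l m).star.unique ?_
    convert hZs m l using 2 with t
    simp only [star_mul', Complex.star_def, Complex.conj_ofReal, Complex.conj_conj]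
    ring
  · convert Complex.hasSum_re (hZs m m) using 2 with t
    rw [Complex.star_def, Complex.mul_conj', Complex.re_ofReal_mul, ← Complex.ofReal_pow,
      Complex.ofReal_re]
  · ext m l
    rw [mul_apply, mul_apply]
    have hSF' : ∀ t m, ∑ p, S m p * star (F t p) = F t m := fun t m => congrFun (hSF t) m
    have h1 : HasSum (fun t => ∑ p, S m p * ((c t : ℂ) * (F t l * star (F t p))))
        (∑ p, S m p * Zᵀ p l) := hasSum_sum fun p _ => (hZs l p).mul_left _
    have h2 : HasSum (fun t => ∑ p, (c t : ℂ) * (F t m * star (F t p)) * S p l)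
        (∑ p, Z m p * S p l) := hasSum_sum fun p _ => (hZs m p).mul_right _
    refine h1.unique ?_
    convert h2 using 2 with t
    have h3 : ∑ p, S m p * ((c t : ℂ) * (F t l * star (F t p))) = c t * F t l * F t m := by
      rw [← hSF' t m, Finset.mul_sum]
      exact Finset.sum_congr rfl fun p _ => by ring
    have h4 : ∑ p, (c t : ℂ) * (F t m * star (F t p)) * S p l = c t * F t m * F t l := by
      rw [← hSF' t l, Finset.mul_sum]
      refine Finset.sum_congr rfl fun p _ => ?_
      rw [← hS, transpose_apply, hS]
      ring
    rw [h3, h4]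
    ring

end PositiveSeries

/-! ### Band-limited functions and Poisson summation -/

section Sampling

open scoped SchwartzMap FourierTransform InnerProductSpace

theorem fourier_comp_sub (f : ℝ → ℂ) (a w : ℝ) :
    𝓕 (fun v => f (v - a)) w = Complex.exp (((-(2 * Real.pi * (a * w)) : ℝ) : ℂ) * Complex.I) * 𝓕 f w := by
  rw [Real.fourier_real_eq_integral_exp_smul, Real.fourier_real_eq_integral_exp_smul,
    ← integral_add_right_eq_self _ a, ← integral_const_mul]
  congr 1
  funext v
  rw [add_sub_cancel_right, smul_eq_mul, smul_eq_mul, ← mul_assoc, ← Complex.exp_add]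
  congr 2
  push_cast
  ring

/-- A Schwartz function whose squared modulus has a Fourier transform supported in `[-1, 1]`. -/
theorem exists_bandlimited : ∃ G : 𝓢(ℝ, ℂ), 0 < ∫ t, ‖G t‖ ^ 2 ∧
    ∀ ξ : ℝ, 1 ≤ |ξ| →
      ∫ t, Complex.exp (((2 * Real.pi * (ξ * t) : ℝ) : ℂ) * Complex.I) * ((‖G t‖ ^ 2 : ℝ) : ℂ) = 0 := by
  let b : ContDiffBump (0 : ℝ) := ⟨1 / 4, 1 / 2, by norm_num, by norm_num⟩
  have h1 : ContDiff ℝ ∞ fun t => (b t : ℂ) := Complex.ofRealCLM.contDiff.comp b.contDiff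
  have h2 : HasCompactSupport fun t => (b t : ℂ) := b.hasCompactSupport.comp_left (g := Complex.ofReal) rfl
  let φ : 𝓢(ℝ, ℂ) := h2.toSchwartzMap h1
  have hφ : ∀ t, φ t = (b t : ℂ) := fun t => rfl
  refine ⟨𝓕 φ, ?_, fun ξ hξ => ?_⟩
  · rw [SchwartzMap.integral_norm_sq_fourier]
    refine Continuous.integral_pos_of_hasCompactSupport_nonneg_nonzero (x := 0)
      (φ.continuous.norm.pow 2) ?_ (fun t => by positivity) ?_
    · exact h2.norm.comp_left (g := fun r : ℝ => r ^ 2) (by simp)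
    · rw [hφ, b.one_of_mem_closedBall (by simp [b.rIn_pos.le])]
      simp
  -- The exponential is a translation of φ by -ξ on the Fourier side, so by Plancherel the integral
  -- is the overlap of φ with a translate. Both are supported in balls of radius 1/2, which are
  -- disjoint for |ξ| ≥ 1.
  · have h3 := SchwartzMap.integral_inner_fourier_fourier φ (φ.compSubConstCLM ℂ (-ξ))
    have h4 : ∀ t, ⟪φ t, φ.compSubConstCLM ℂ (-ξ) t⟫_ℂ = 0 := by
      intro t
      rw [SchwartzMap.compSubConstCLM_apply, hφ, hφ]
      by_cases ht : b t = 0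
      · simp [ht]
      · have h5 : t ∈ Function.support b := ht
        rw [b.support_eq, Metric.mem_ball, Real.dist_eq, sub_zero] at h5
        have h6 : t - -ξ ∉ Function.support b := by
          rw [b.support_eq, Metric.mem_ball, Real.dist_eq, sub_zero, sub_neg_eq_add, not_lt]
          have h7 : |t| < 1 / 2 := h5
          have h8 := abs_add_le (t + ξ) (-t)
          rw [add_neg_cancel_comm, abs_neg] at h8
          show (1 / 2 : ℝ) ≤ |t + ξ|
          linarith
        rw [Function.notMem_support.1 h6]
        simp
    simp only [h4, integral_zero] at h3
    rw [← h3]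
    congr 1
    funext t
    have h5 : 𝓕 (φ.compSubConstCLM ℂ (-ξ)) t =
        Complex.exp (((2 * Real.pi * (ξ * t) : ℝ) : ℂ) * Complex.I) * 𝓕 φ t := by
      rw [SchwartzMap.fourier_coe, SchwartzMap.fourier_coe]
      have h6 : ⇑(φ.compSubConstCLM ℂ (-ξ)) = fun v => φ (v - -ξ) := rfl
      rw [h6, fourier_comp_sub]
      congr 4
      ring
    rw [h5, RCLike.inner_apply, mul_assoc (Complex.exp _), Complex.mul_conj', Complex.ofReal_pow]

/-- The weight `(1 + |t|)⁻²`. -/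
def weight (t : ℝ) : ℝ := ((1 + |t|) ^ 2)⁻¹

theorem weight_pos (t : ℝ) : 0 < weight t := by
  unfold weight
  positivity

theorem weight_le_one (t : ℝ) : weight t ≤ 1 :=
  inv_le_one_of_one_le₀ (one_le_pow₀ (by linarith [abs_nonneg t]))

theorem weight_neg (t : ℝ) : weight (-t) = weight t := by rw [weight, abs_neg, weight]

/-- Telescoping: the n-th term is at most 1/((1 + σn)(1 + σ(n + 1))), which is 1/σ times the
decrease of 1/(1 + σn). -/
theorem sum_weight_le {σ : ℝ} (hσ : 0 < σ) (N : ℕ) :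
    ∑ n ∈ Finset.range N, weight (σ * ((n : ℝ) + 1)) ≤ 1 / σ := by
  have h : ∀ N : ℕ, ∑ n ∈ Finset.range N, weight (σ * ((n : ℝ) + 1)) ≤
      1 / σ * (1 - 1 / (1 + σ * N)) := by
    intro N
    induction N with
    | zero => simp
    | succ N ih =>
      rw [Finset.sum_range_succ]
      have h1 : 1 / σ * (1 - 1 / (1 + σ * (N + 1))) - 1 / σ * (1 - 1 / (1 + σ * N)) =
          1 / ((1 + σ * N) * (1 + σ * (N + 1))) := by
        have : 1 + σ * N ≠ 0 := by positivity
        have : 1 + σ * (N + 1) ≠ 0 := by positivity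
        field_simp
        ring
      have h2 : weight (σ * ((N : ℝ) + 1)) ≤ 1 / ((1 + σ * N) * (1 + σ * (N + 1))) := by
        rw [weight, abs_of_nonneg (by positivity), one_div]
        refine inv_anti₀ (by positivity) ?_
        rw [sq]
        gcongr
        linarith
      push_cast
      linarith
  refine (h N).trans ?_
  have : 0 ≤ 1 / (1 + σ * N) := by positivity
  calc 1 / σ * (1 - 1 / (1 + σ * N)) ≤ 1 / σ * 1 := by gcongr; linarith
    _ = 1 / σ := mul_one _

theorem exists_hasSum_weight {σ : ℝ} (hσ : 0 < σ) (hσ1 : σ ≤ 1) :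
    ∃ s, HasSum (fun n : ℤ => weight (σ * n)) s ∧ s ≤ 3 / σ := by
  have h0 : ∀ n : ℕ, 0 ≤ weight (σ * ((n : ℝ) + 1)) := fun n => (weight_pos _).le
  have hs := summable_of_sum_range_le h0 (sum_weight_le hσ)
  have hle := Real.tsum_le_of_sum_range_le h0 (sum_weight_le hσ)
  have h1 : HasSum (fun n : ℕ => weight (σ * ((n : ℤ) : ℝ)))
      (weight 0 + ∑' n : ℕ, weight (σ * ((n : ℝ) + 1))) := by
    rw [add_comm, ← hasSum_nat_add_iff' (f := fun n : ℕ => weight (σ * ((n : ℤ) : ℝ))) 1]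
    simpa using hs.hasSum
  have h2 : HasSum (fun n : ℕ => weight (σ * ((-(n + 1 : ℤ) : ℤ) : ℝ)))
      (∑' n : ℕ, weight (σ * ((n : ℝ) + 1))) := by
    convert hs.hasSum using 2 with n
    rw [← weight_neg]
    congr 1
    push_cast
    ring
  refine ⟨_, HasSum.of_nat_of_neg_add_one (f := fun n : ℤ => weight (σ * n)) h1 h2, ?_⟩
  have h3 := weight_le_one 0
  have h4 : 1 ≤ 1 / σ := by rw [le_div_iff₀ hσ]; linarith
  have h5 : 3 / σ = 1 / σ + 1 / σ + 1 / σ := by ring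
  linarith

theorem exists_norm_le_weight (f : 𝓢(ℝ, ℂ)) : ∃ C : ℝ, 0 ≤ C ∧ ∀ t, ‖f t‖ ≤ C * weight t := by
  have h := SchwartzMap.one_add_le_sup_seminorm_apply (𝕜 := ℝ) (m := (2, 0)) le_rfl le_rfl f
  refine ⟨_, le_trans (by positivity) (h 0), fun t => ?_⟩
  have h1 := h t
  rw [norm_iteratedFDeriv_zero, Real.norm_eq_abs] at h1
  rw [weight, ← div_eq_mul_inv, le_div_iff₀ (by positivity), mul_comm]
  exact h1

/-- Poisson summation. At an integer m ≠ 0 the Fourier transform of the summand is, up to scaling,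
that of ‖G‖² at (θ - m)/σ, and |(θ - m)/σ| ≥ (1 - 1/2)/(1/2) = 1. Only m = 0 survives, and it is the
integral. -/
theorem hasSum_sampling {G : 𝓢(ℝ, ℂ)} (hG : ∀ ξ : ℝ, 1 ≤ |ξ| →
      ∫ t, Complex.exp (((2 * Real.pi * (ξ * t) : ℝ) : ℂ) * Complex.I) * ((‖G t‖ ^ 2 : ℝ) : ℂ) = 0)
    {σ θ : ℝ} (hσ : 0 < σ) (hσ2 : σ ≤ 1 / 2) (hθ : |θ| ≤ 1 / 2) :
    HasSum (fun n : ℤ => Complex.exp (((2 * Real.pi * (θ * n) : ℝ) : ℂ) * Complex.I) *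
        ((‖G (σ * n)‖ ^ 2 : ℝ) : ℂ))
      (∫ s : ℝ, Complex.exp (((2 * Real.pi * (θ * s) : ℝ) : ℂ) * Complex.I) *
        ((‖G (σ * s)‖ ^ 2 : ℝ) : ℂ)) := by
  set u : ℝ → ℂ := fun s => Complex.exp (((2 * Real.pi * (θ * s) : ℝ) : ℂ) * Complex.I) *
        ((‖G (σ * s)‖ ^ 2 : ℝ) : ℂ) with hu
  obtain ⟨C, hC0, hC⟩ := exists_norm_le_weight G
  have hnorm : ∀ s, ‖u s‖ ≤ C ^ 2 * weight (σ * s) := fun s => by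
    rw [hu]
    dsimp only
    rw [norm_mul, Complex.norm_exp_ofReal_mul_I, one_mul, Complex.norm_real,
      Real.norm_of_nonneg (by positivity)]
    have h1 := weight_pos (σ * s)
    have h2 := weight_le_one (σ * s)
    calc ‖G (σ * s)‖ ^ 2 ≤ (C * weight (σ * s)) ^ 2 := by gcongr; exact hC _
      _ = C ^ 2 * (weight (σ * s) * weight (σ * s)) := by ring
      _ ≤ C ^ 2 * (weight (σ * s) * 1) := by gcongr
      _ = _ := by ring
  have hc : Continuous u := by
    have := G.continuous
    fun_prop
  have hbig : u =O[Filter.cocompact ℝ] fun x : ℝ => |x| ^ (-2 : ℝ) := by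
    refine Asymptotics.IsBigO.of_bound (C ^ 2 * (σ ^ 2)⁻¹) ?_
    have hne : ∀ᶠ s : ℝ in Filter.cocompact ℝ, s ≠ 0 := by
      filter_upwards [(isCompact_singleton (x := (0 : ℝ))).compl_mem_cocompact] with s hs using hs
    filter_upwards [hne] with s hs
    have hs' : 0 < |s| := abs_pos.2 hs
    refine (hnorm s).trans ?_
    rw [Real.norm_of_nonneg (by positivity), Real.rpow_neg hs'.le, Real.rpow_two, mul_assoc,
      ← mul_inv, ← mul_pow, weight, abs_mul, abs_of_pos hσ]
    gcongr
    linarith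
  have hF : ∀ m : ℤ, m ≠ 0 → 𝓕 u m = 0 := by
    intro m hm
    rw [Real.fourier_real_eq_integral_exp_smul]
    have h1 : 1 ≤ |(θ - m) / σ| := by
      rw [abs_div, abs_of_pos hσ, le_div_iff₀ hσ, one_mul]
      have h2 : (1 : ℝ) ≤ |(m : ℝ)| := by exact_mod_cast Int.one_le_abs hm
      have h3 := abs_sub_abs_le_abs_sub (m : ℝ) θ
      rw [abs_sub_comm (m : ℝ)] at h3
      linarith
    have h4 := hG _ h1
    have h5 := Measure.integral_comp_mul_left (fun t : ℝ =>
      Complex.exp (((2 * Real.pi * ((θ - m) / σ * t) : ℝ) : ℂ) * Complex.I) *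
        ((‖G t‖ ^ 2 : ℝ) : ℂ)) σ
    rw [h4, smul_zero] at h5
    rw [← h5]
    congr 1
    funext s
    rw [hu, smul_eq_mul]
    dsimp only
    rw [← mul_assoc, ← Complex.exp_add]
    congr 2
    have : (σ : ℂ) ≠ 0 := by exact_mod_cast hσ.ne'
    push_cast
    field_simp
    ring
  have hF0 : 𝓕 u 0 = ∫ s, u s := by
    rw [Real.fourier_real_eq_integral_exp_smul]
    simp
  have hP := Real.tsum_eq_tsum_fourier_of_rpow_decay_of_summable hc one_lt_two hbig
    (summable_of_ne_finset_zero (s := {0}) fun m hm => hF m (by simpa using hm)) 0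
  have hP0 : ∑' m : ℤ, 𝓕 u m * fourier m ((0 : ℝ) : UnitAddCircle) =
      𝓕 u ((0 : ℤ) : ℝ) * fourier 0 ((0 : ℝ) : UnitAddCircle) :=
    tsum_eq_single 0 fun m hm => by rw [hF m hm, zero_mul]
  rw [hP0, Int.cast_zero, hF0] at hP
  simp only [zero_add, fourier_zero, mul_one] at hP
  rw [← hP]
  obtain ⟨s, hs, -⟩ := exists_hasSum_weight hσ (by linarith)
  exact (Summable.of_norm_bounded (hs.summable.mul_left (C ^ 2)) fun n : ℤ => hnorm n).hasSum

end Sampling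

/-! ### Product wave packets and lattice sums in three dimensions -/

section Packet

open scoped SchwartzMap

theorem hasSum_prod_fin {k : ℕ} {u : Fin k → ℤ → ℂ} {s : Fin k → ℂ}
    (h : ∀ i, HasSum (u i) (s i)) :
    HasSum (fun n : Fin k → ℤ => ∏ i, u i (n i)) (∏ i, s i) := by
  induction k with
  | zero => simp
  | succ k ih =>
    have h1 := ih fun i => h i.succ
    have h2 : Summable fun x : ℤ × (Fin k → ℤ) => u 0 x.1 * ∏ i : Fin k, u i.succ (x.2 i) :=
      summable_mul_of_summable_norm (f := u 0) (g := fun n : Fin k → ℤ => ∏ i : Fin k, u i.succ (n i))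
        (h 0).summable.norm h1.summable.norm
    have h3 := HasSum.mul (f := u 0) (g := fun n : Fin k → ℤ => ∏ i : Fin k, u i.succ (n i))
      (h 0) h1 h2
    have h4 : (fun x : ℤ × (Fin k → ℤ) => u 0 x.1 * ∏ i : Fin k, u i.succ (x.2 i)) =
        (fun n : Fin (k + 1) → ℤ => ∏ i, u i (n i)) ∘ Fin.consEquiv fun _ : Fin (k + 1) => ℤ := by
      funext x
      simp [Fin.prod_univ_succ, Fin.consEquiv]
    rw [h4] at h3
    rw [Fin.prod_univ_succ]
    exact (Equiv.hasSum_iff _).1 h3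

theorem integral_space_prod (u : Fin 3 → ℝ → ℂ) :
    ∫ x : Space, ∏ i, u i (x i) = ∏ i, ∫ t, u i t := by
  rw [← integral_fintype_prod_volume_eq_prod]
  exact (PiLp.volume_preserving_ofLp (Fin 3)).integral_comp
    (MeasurableEquiv.toLp 2 (Fin 3 → ℝ)).symm.measurableEmbedding
    (fun y : Fin 3 → ℝ => ∏ i, u i (y i))

theorem integrable_space_prod {u : Fin 3 → ℝ → ℂ} (h : ∀ i, Integrable (u i)) :
    Integrable fun x : Space => ∏ i, u i (x i) :=
  (PiLp.volume_preserving_ofLp (Fin 3)).integrable_comp_of_integrable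
    (g := fun y : Fin 3 → ℝ => ∏ i, u i (y i)) (Integrable.fintype_prod h)

/-- The product wave packet `∏ G (x_i / r)`. -/
def packet (G : 𝓢(ℝ, ℂ)) (r : ℝ) (x : Space) : ℂ := ∏ i, G (x i / r)

/-- The point `h n` of the lattice `h ℤ³`. -/
def latticePoint (h : ℝ) (n : Fin 3 → ℤ) : Space := WithLp.toLp 2 fun i => h * n i

theorem continuous_packet (G : 𝓢(ℝ, ℂ)) (r : ℝ) : Continuous (packet G r) := by
  have := G.continuous
  unfold packet
  fun_prop

theorem integrable_norm_sq_schwartz (G : 𝓢(ℝ, ℂ)) : Integrable fun t => ‖G t‖ ^ 2 :=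
  (memLp_two_iff_integrable_sq_norm G.continuous.aestronglyMeasurable).1 (G.memLp 2 volume)

theorem integral_norm_sq_scaled (G : 𝓢(ℝ, ℂ)) {r : ℝ} (hr : 0 < r) :
    ∫ t, ‖G (t / r)‖ ^ 2 = r * ∫ t, ‖G t‖ ^ 2 := by
  rw [Measure.integral_comp_div (fun t => ‖G t‖ ^ 2) r, abs_of_pos hr, smul_eq_mul]

theorem integrable_prod_norm_sq (G : Fin 3 → 𝓢(ℝ, ℂ)) {r : ℝ} (hr : 0 < r) :
    Integrable fun x : Space => ‖∏ i, G i (x i / r)‖ ^ 2 := by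
  have h := integrable_space_prod (u := fun i t => ((‖G i (t / r)‖ ^ 2 : ℝ) : ℂ)) fun i =>
    ((integrable_norm_sq_schwartz (G i)).comp_div hr.ne').ofReal
  have h2 := h.norm
  refine h2.congr (Filter.Eventually.of_forall fun x => ?_)
  simp [norm_prod, Finset.prod_pow]

theorem integral_prod_norm_sq (G : Fin 3 → 𝓢(ℝ, ℂ)) {r : ℝ} (hr : 0 < r) :
    ∫ x : Space, ‖∏ i, G i (x i / r)‖ ^ 2 = r ^ 3 * ∏ i, ∫ t, ‖G i t‖ ^ 2 := by
  have h := integral_space_prod fun i t => ((‖G i (t / r)‖ ^ 2 : ℝ) : ℂ)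
  simp only [integral_complex_ofReal, ← Complex.ofReal_prod, integral_norm_sq_scaled _ hr] at h
  rw [Complex.ofReal_inj, Finset.prod_mul_distrib, Finset.prod_const, Finset.card_univ,
    Fintype.card_fin] at h
  rw [← h]
  simp only [norm_prod, Finset.prod_pow]

theorem hasSum_packet {G : 𝓢(ℝ, ℂ)} (hG : ∀ ξ : ℝ, 1 ≤ |ξ| →
      ∫ t, Complex.exp (((2 * Real.pi * (ξ * t) : ℝ) : ℂ) * Complex.I) * ((‖G t‖ ^ 2 : ℝ) : ℂ) = 0)
    {h r L : ℝ} (hh : 0 < h) (hr : 0 < r) (hhr : h ≤ r / 2) (hL : 0 < L) {N : Fin 3 → ℤ}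
    (hN : ∀ i, |(N i : ℝ)| * h ≤ L / 2) :
    HasSum (fun n => planeWave L N (latticePoint h n) * ((‖packet G r (latticePoint h n)‖ ^ 2 : ℝ) : ℂ))
      (((h⁻¹ ^ 3 : ℝ) : ℂ) * ∫ x : Space, planeWave L N x * ((‖packet G r x‖ ^ 2 : ℝ) : ℂ)) := by
  -- In each coordinate σ = h/r, and θ = N_i h/L is the phase gained per lattice step in units of
  -- 2π.
  have h1 := hasSum_prod_fin fun i => hasSum_sampling hG (σ := h / r) (θ := N i * h / L)
    (by positivity) (by rw [div_le_iff₀ hr]; linarith)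
    (by rw [abs_div, abs_mul, abs_of_pos hh, abs_of_pos hL, div_le_iff₀ hL]; linarith [hN i])
  have e1 : (fun n => planeWave L N (latticePoint h n) *
      ((‖packet G r (latticePoint h n)‖ ^ 2 : ℝ) : ℂ)) = fun n : Fin 3 → ℤ =>
      ∏ i, Complex.exp (((2 * Real.pi * (N i * h / L * n i) : ℝ) : ℂ) * Complex.I) *
        ((‖G (h / r * n i)‖ ^ 2 : ℝ) : ℂ) := by
    funext n
    rw [planeWave, packet, norm_prod, ← Finset.prod_pow, Complex.ofReal_prod,
      ← Finset.prod_mul_distrib]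
    refine Finset.prod_congr rfl fun i _ => ?_
    simp only [latticePoint]
    congr 2
    · push_cast
      ring
    · congr 4
      ring
  have e2 : ((h⁻¹ ^ 3 : ℝ) : ℂ) * ∫ x : Space, planeWave L N x * ((‖packet G r x‖ ^ 2 : ℝ) : ℂ) =
      ∏ i, ∫ s : ℝ, Complex.exp (((2 * Real.pi * (N i * h / L * s) : ℝ) : ℂ) * Complex.I) *
        ((‖G (h / r * s)‖ ^ 2 : ℝ) : ℂ) := by
    have h2 := integral_space_prod fun i t => Complex.exp (Complex.I *
      ((t * (2 * Real.pi * N i / L) : ℝ) : ℂ)) * ((‖G (t / r)‖ ^ 2 : ℝ) : ℂ)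
    have h3 : ∀ x : Space, planeWave L N x * ((‖packet G r x‖ ^ 2 : ℝ) : ℂ) =
        ∏ i, Complex.exp (Complex.I * ((x i * (2 * Real.pi * N i / L) : ℝ) : ℂ)) *
          ((‖G (x i / r)‖ ^ 2 : ℝ) : ℂ) := fun x => by
      rw [planeWave, packet, norm_prod, ← Finset.prod_pow, Complex.ofReal_prod,
        ← Finset.prod_mul_distrib]
    simp only [h3]
    rw [h2, Complex.ofReal_pow]
    have h4 : ((h⁻¹ : ℝ) : ℂ) ^ 3 = ∏ _i : Fin 3, ((h⁻¹ : ℝ) : ℂ) := by simp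
    rw [h4, ← Finset.prod_mul_distrib]
    refine Finset.prod_congr rfl fun i _ => ?_
    have h5 := Measure.integral_comp_mul_left (fun t : ℝ => Complex.exp (Complex.I *
      ((t * (2 * Real.pi * N i / L) : ℝ) : ℂ)) * ((‖G (t / r)‖ ^ 2 : ℝ) : ℂ)) h
    rw [abs_of_pos (by positivity), Complex.real_smul] at h5
    rw [← h5]
    congr 1
    funext t
    congr 2
    · push_cast
      ring
    · congr 4
      ring
  rw [e1, e2]
  exact h1

end Packet

/-! ### Sampling the variance of the vector potential -/

section QuadraticSampling

open Matrix
open scoped SchwartzMap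

variable {L Λ : ℝ} [Fintype (WaveIndex L Λ)]

theorem star_mulVec_potVec_dotProduct (Q : Matrix (Mode L Λ) (Mode L Λ) ℂ) (ε : Space → Fin 2 → Space)
    (j : Fin 3) (x : Space) :
    star (Q *ᵥ potVec ε j x) ⬝ᵥ potVec ε j x = ∑ m, ∑ l, (star (Q m l) * potCoef ε j l *
      potCoef ε j m : ℂ) * planeWave L (l.1.1 - m.1.1) x := by
  refine Finset.sum_congr rfl fun m _ => ?_
  rw [Pi.star_apply, mulVec, dotProduct, star_sum, Finset.sum_mul]
  refine Finset.sum_congr rfl fun l _ => ?_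
  rw [← star_planeWave_mul, potVec, potVec, star_mul', star_mul', star_star, Complex.star_def,
    Complex.conj_ofReal]
  ring

theorem integrable_planeWave_mul_packet (G : 𝓢(ℝ, ℂ)) {r : ℝ} (hr : 0 < r) (N : Fin 3 → ℤ) :
    Integrable fun x : Space => planeWave L N x * ((‖packet G r x‖ ^ 2 : ℝ) : ℂ) := by
  refine ((integrable_prod_norm_sq (fun _ => G) hr).ofReal (𝕜 := ℂ)).bdd_mul (c := 1)
    ((continuous_planeWave L N).comp (PiLp.continuous_ofLp 2 _)).aestronglyMeasurable
    (Filter.Eventually.of_forall fun x => (norm_planeWave L N x).le)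

/-- A quadratic expression in the coefficient vectors contains only plane waves of differences of
two wave vectors. Their indices are below ΛL/π in each coordinate, within the limit ΛL/2 that
sampling on Λ⁻¹ℤ³ tolerates. -/
theorem hasSum_quadratic {G : 𝓢(ℝ, ℂ)} (hG : ∀ ξ : ℝ, 1 ≤ |ξ| →
      ∫ t, Complex.exp (((2 * Real.pi * (ξ * t) : ℝ) : ℂ) * Complex.I) * ((‖G t‖ ^ 2 : ℝ) : ℂ) = 0)
    {r : ℝ} (hΛ : 0 < Λ) (hr : 0 < r) (hr2 : 2 ≤ r * Λ) (hL : 0 < L)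
    (Q : Matrix (Mode L Λ) (Mode L Λ) ℂ) (ε : Space → Fin 2 → Space) (j : Fin 3) :
    HasSum (fun n => (star (Q *ᵥ potVec ε j (latticePoint Λ⁻¹ n)) ⬝ᵥ
        potVec ε j (latticePoint Λ⁻¹ n)).re * ‖packet G r (latticePoint Λ⁻¹ n)‖ ^ 2)
      (Λ ^ 3 * ∫ x : Space, (star (Q *ᵥ potVec ε j x) ⬝ᵥ potVec ε j x).re * ‖packet G r x‖ ^ 2) := by
  have hN : ∀ (l m : Mode L Λ) i, |(((l.1.1 - m.1.1) i : ℤ) : ℝ)| * Λ⁻¹ ≤ L / 2 := by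
    intro l m i
    have h1 := abs_waveIndex_lt hL l.1 i
    have h2 := abs_waveIndex_lt hL m.1 i
    have h3 := abs_sub (l.1.1 i : ℝ) (m.1.1 i : ℝ)
    have h4 := Real.pi_gt_three
    rw [← div_eq_mul_inv, div_le_iff₀ hΛ, Pi.sub_apply]
    push_cast
    nlinarith [abs_nonneg (l.1.1 i : ℝ), abs_nonneg (m.1.1 i : ℝ)]
  have hterm := fun l m : Mode L Λ => hasSum_packet hG (inv_pos.2 hΛ) hr
    (by rw [inv_le_iff_one_le_mul₀ hΛ]; linarith) hL (hN l m)
  have hsum := hasSum_sum (s := Finset.univ) fun (m : Mode L Λ) _ => hasSum_sum (s := Finset.univ)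
    fun (l : Mode L Λ) _ => (hterm l m).mul_left (star (Q m l) * potCoef ε j l * potCoef ε j m : ℂ)
  have hre := Complex.hasSum_re hsum
  have hpt : ∀ x : Space, (star (Q *ᵥ potVec ε j x) ⬝ᵥ potVec ε j x).re * ‖packet G r x‖ ^ 2 =
      (∑ m, ∑ l, (star (Q m l) * potCoef ε j l * potCoef ε j m : ℂ) *
        (planeWave L (l.1.1 - m.1.1) x * ((‖packet G r x‖ ^ 2 : ℝ) : ℂ))).re := fun x => by
    rw [← Complex.re_mul_ofReal, star_mulVec_potVec_dotProduct]
    simp only [Finset.sum_mul, mul_assoc]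
  have hint : ∀ m l, Integrable fun x : Space =>
      (star (Q m l) * potCoef ε j l * potCoef ε j m : ℂ) *
        (planeWave L (l.1.1 - m.1.1) x * ((‖packet G r x‖ ^ 2 : ℝ) : ℂ)) := fun m l =>
    (integrable_planeWave_mul_packet G hr _).const_mul _
  convert hre using 1
  · exact funext fun n => hpt _
  · simp only [hpt]
    rw [← RCLike.re_eq_complex_re, integral_re, integral_finsetSum]
    · simp only [integral_finsetSum _ fun l _ => hint _ l, integral_const_mul]
      rw [RCLike.re_eq_complex_re, ← Complex.re_ofReal_mul, Finset.mul_sum]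
      congr 1
      refine Finset.sum_congr rfl fun m _ => ?_
      rw [Finset.mul_sum]
      refine Finset.sum_congr rfl fun l _ => ?_
      rw [inv_inv]
      ring
    · exact fun m _ => integrable_finsetSum _ fun l _ => hint m l
    · exact integrable_finsetSum _ fun m _ => integrable_finsetSum _ fun l _ => hint m l

theorem hasSum_prod_weight {σ s : ℝ} (hs : HasSum (fun n : ℤ => weight (σ * n)) s) :
    HasSum (fun n : Fin 3 → ℤ => ∏ i, weight (σ * n i)) (s ^ 3) := by
  have h1 := hasSum_prod_fin (k := 3) fun _ => Complex.hasSum_ofReal.2 hs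
  rw [← Complex.hasSum_ofReal]
  simpa using h1

/-- With W the product of the weights at a lattice point, the quadratic form there is at most 1/(cW)
and the density at most C^6 W². The product C^6 W/c is still summable, the sum of W is at most
27(rΛ)³, and a lattice cell has volume Λ⁻³. -/
theorem integral_quadratic_le {G : 𝓢(ℝ, ℂ)} (hG : ∀ ξ : ℝ, 1 ≤ |ξ| →
      ∫ t, Complex.exp (((2 * Real.pi * (ξ * t) : ℝ) : ℂ) * Complex.I) * ((‖G t‖ ^ 2 : ℝ) : ℂ) = 0)
    {C : ℝ} (hC : ∀ t, ‖G t‖ ≤ C * weight t)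
    {r c : ℝ} (hΛ : 0 < Λ) (hr : 0 < r) (hr2 : 2 ≤ r * Λ) (hL : 0 < L) (hc : 0 < c)
    (Q : Matrix (Mode L Λ) (Mode L Λ) ℂ) (ε : Space → Fin 2 → Space) (j : Fin 3)
    (hQ : ∀ n : Fin 3 → ℤ, (star (Q *ᵥ potVec ε j (latticePoint Λ⁻¹ n)) ⬝ᵥ
        potVec ε j (latticePoint Λ⁻¹ n)).re ≤ 1 / (c * ∏ i, weight ((r * Λ)⁻¹ * n i))) :
    ∫ x : Space, (star (Q *ᵥ potVec ε j x) ⬝ᵥ potVec ε j x).re * ‖packet G r x‖ ^ 2 ≤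
      27 * C ^ 6 * r ^ 3 / c := by
  have hsum := hasSum_quadratic hG hΛ hr hr2 hL Q ε j
  obtain ⟨s, hs, hs3⟩ := exists_hasSum_weight (σ := (r * Λ)⁻¹) (by positivity)
    (inv_le_one_of_one_le₀ (by linarith))
  have hs0 : 0 ≤ s := hs.nonneg fun n => (weight_pos _).le
  have hW := hasSum_prod_weight hs
  have hle : ∀ n : Fin 3 → ℤ, (star (Q *ᵥ potVec ε j (latticePoint Λ⁻¹ n)) ⬝ᵥ
        potVec ε j (latticePoint Λ⁻¹ n)).re * ‖packet G r (latticePoint Λ⁻¹ n)‖ ^ 2 ≤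
      C ^ 6 / c * ∏ i, weight ((r * Λ)⁻¹ * n i) := by
    intro n
    set W := ∏ i, weight ((r * Λ)⁻¹ * n i) with hWdef
    have hW0 : 0 < W := Finset.prod_pos fun i _ => weight_pos _
    have h1 : ‖packet G r (latticePoint Λ⁻¹ n)‖ ≤ C ^ 3 * W := by
      rw [packet, norm_prod, hWdef]
      calc ∏ i, ‖G (latticePoint Λ⁻¹ n i / r)‖ ≤ ∏ i, (C * weight ((r * Λ)⁻¹ * n i)) := by
            refine Finset.prod_le_prod (fun i _ => norm_nonneg _) fun i _ => ?_
            have : latticePoint Λ⁻¹ n i / r = (r * Λ)⁻¹ * n i := by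
              simp only [latticePoint]
              field_simp
            rw [this]
            exact hC _
        _ = _ := by rw [Finset.prod_mul_distrib]; simp
    calc _ ≤ 1 / (c * W) * ‖packet G r (latticePoint Λ⁻¹ n)‖ ^ 2 := by gcongr; exact hQ n
      _ ≤ 1 / (c * W) * (C ^ 3 * W) ^ 2 := by gcongr
      _ = _ := by field_simp
  have h1 := hasSum_le hle hsum (hW.mul_left _)
  have h2 : Λ ^ 3 * ∫ x : Space, (star (Q *ᵥ potVec ε j x) ⬝ᵥ potVec ε j x).re * ‖packet G r x‖ ^ 2 ≤
      Λ ^ 3 * (27 * C ^ 6 * r ^ 3 / c) := by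
    refine h1.trans ?_
    calc C ^ 6 / c * s ^ 3 ≤ C ^ 6 / c * (3 / (r * Λ)⁻¹) ^ 3 := by gcongr
      _ = _ := by field_simp; ring
  exact le_of_mul_le_mul_left h2 (by positivity)

end QuadraticSampling

/-! ### Wave packets with a squeezed photon state -/

section TrialState

open Matrix
open scoped SchwartzMap

variable {L Λ : ℝ}

theorem exists_state {f : Space → ℂ} (hf : Continuous f) (hf2 : Integrable fun x => ‖f x‖ ^ 2)
    {v : Space → Fock L Λ} (hv : Continuous v) {K : ℝ} (hK : ∀ x, ‖v x‖ ≤ K) :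
    ∃ Ψ : StateSpace L Λ, (∀ᵐ x, Ψ x = f x • v x) ∧ ‖Ψ‖ ^ 2 = ∫ x, ‖v x‖ ^ 2 * ‖f x‖ ^ 2 := by
  have hc : Continuous fun x => f x • v x := hf.smul hv
  have hm : MemLp (fun x => f x • v x) 2 (volume : Measure Space) := by
    rw [memLp_two_iff_integrable_sq_norm hc.aestronglyMeasurable]
    refine (hf2.const_mul (K ^ 2)).mono' (hc.norm.pow 2).aestronglyMeasurable
      (Filter.Eventually.of_forall fun x => ?_)
    rw [Real.norm_of_nonneg (by positivity), norm_smul, mul_pow, mul_comm]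
    gcongr
    exact hK x
  refine ⟨hm.toLp _, hm.coeFn_toLp, ?_⟩
  rw [← integral_norm_sq]
  refine integral_congr_ae ?_
  filter_upwards [hm.coeFn_toLp] with x hx
  rw [hx, norm_smul, mul_pow, mul_comm]

theorem isMomentum_of_differentiable {j : Fin 3} {f f' : Space → ℂ} (hf : Differentiable ℝ f)
    (hf' : ∀ x, fderiv ℝ f x (EuclideanSpace.single j 1) = f' x) (hc : Continuous f')
    {v : Fock L Λ} {Ψ Φ : StateSpace L Λ} (hΨ : ∀ᵐ x, Ψ x = f x • v)
    (hΦ : ∀ᵐ x, Φ x = (-Complex.I * f' x) • v) : IsMomentum j Ψ Φ := by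
  intro φ hφ hφc
  have hd : Continuous fun x => fderiv ℝ φ x (EuclideanSpace.single j (1 : ℝ)) :=
    (hφ.continuous_fderiv (by simp)).clm_apply continuous_const
  have hdc : HasCompactSupport fun x => fderiv ℝ φ x (EuclideanSpace.single j (1 : ℝ)) :=
    hφc.fderiv_apply (𝕜 := ℝ) _
  have h1 : ∫ x, φ x • Φ x = (∫ x, φ x * (-Complex.I * f' x)) • v := by
    rw [← integral_smul_const]
    refine integral_congr_ae ?_
    filter_upwards [hΦ] with x hx
    rw [hx, smul_smul]
  have h2 : ∫ x, fderiv ℝ φ x (EuclideanSpace.single j (1 : ℝ)) • Ψ x =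
      (∫ x, fderiv ℝ φ x (EuclideanSpace.single j (1 : ℝ)) * f x) • v := by
    rw [← integral_smul_const]
    refine integral_congr_ae ?_
    filter_upwards [hΨ] with x hx
    rw [hx, smul_smul]
  have h3 : ∫ x, φ x * f' x = -∫ x, fderiv ℝ φ x (EuclideanSpace.single j (1 : ℝ)) * f x := by
    have := integral_mul_fderiv_eq_neg_fderiv_mul_of_integrable (μ := (volume : Measure Space))
      (f := φ) (g := f) (v := EuclideanSpace.single j (1 : ℝ))
      ((hd.mul hf.continuous).integrable_of_hasCompactSupport hdc.mul_right)
      (by simp only [hf']; exact (hφ.continuous.mul hc).integrable_of_hasCompactSupport hφc.mul_right)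
      ((hφ.continuous.mul hf.continuous).integrable_of_hasCompactSupport hφc.mul_right)
      (fun x _ => (hφ.differentiable (by simp)).differentiableAt) (fun x _ => hf.differentiableAt)
    simpa only [hf'] using this
  rw [h1, h2, smul_smul]
  congr 1
  have h4 : ∀ x, φ x * (-Complex.I * f' x) = -Complex.I * (φ x * f' x) := fun x => by ring
  simp only [h4]
  rw [integral_const_mul, h3]
  ring

theorem hasFDerivAt_coord (G : 𝓢(ℝ, ℂ)) (r : ℝ) (i : Fin 3) (x : Space) :
    HasFDerivAt (fun x : Space => G (x i / r))
      ((r⁻¹ • EuclideanSpace.proj (𝕜 := ℝ) i : Space →L[ℝ] ℝ).smulRight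
        (SchwartzMap.derivCLM ℂ ℂ G (x i / r))) x := by
  have h1 : HasFDerivAt (fun x : Space => x i / r)
      (r⁻¹ • EuclideanSpace.proj (𝕜 := ℝ) i : Space →L[ℝ] ℝ) x := by
    convert (r⁻¹ • EuclideanSpace.proj (𝕜 := ℝ) i : Space →L[ℝ] ℝ).hasFDerivAt using 1
    funext y
    simp [div_eq_inv_mul]
  refine ((G.differentiableAt (x := x i / r)).hasFDerivAt.comp x h1).congr_fderiv ?_
  apply ContinuousLinearMap.ext
  intro v
  rw [ContinuousLinearMap.comp_apply, fderiv_eq_smul_deriv]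
  rfl

/-- The partial derivative of the wave packet, up to the factor `1 / r`. -/
def packetFactors (G : 𝓢(ℝ, ℂ)) (j : Fin 3) : Fin 3 → 𝓢(ℝ, ℂ) :=
  Function.update (fun _ => G) j (SchwartzMap.derivCLM ℂ ℂ G)

theorem hasFDerivAt_packet (G : 𝓢(ℝ, ℂ)) (r : ℝ) (x : Space) :
    HasFDerivAt (packet G r) (∑ i, (∏ l ∈ Finset.univ.erase i, G (x l / r)) •
      ((r⁻¹ • EuclideanSpace.proj (𝕜 := ℝ) i : Space →L[ℝ] ℝ).smulRight
        (SchwartzMap.derivCLM ℂ ℂ G (x i / r)))) x :=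
  HasFDerivAt.finsetProd fun i _ => hasFDerivAt_coord G r i x

theorem fderiv_packet (G : 𝓢(ℝ, ℂ)) (r : ℝ) (j : Fin 3) (x : Space) :
    fderiv ℝ (packet G r) x (EuclideanSpace.single j 1) =
      (r⁻¹ : ℝ) * ∏ i, packetFactors G j i (x i / r) := by
  rw [(hasFDerivAt_packet G r x).fderiv, _root_.sum_apply, Finset.sum_eq_single j]
  · rw [← Finset.mul_prod_erase _ _ (Finset.mem_univ j)]
    have h1 : ∏ i ∈ Finset.univ.erase j, packetFactors G j i (x i / r) =
        ∏ i ∈ Finset.univ.erase j, G (x i / r) := by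
      refine Finset.prod_congr rfl fun i hi => ?_
      rw [packetFactors, Function.update_of_ne (Finset.ne_of_mem_erase hi)]
    rw [h1]
    simp [packetFactors]
    ring
  · intro i _ hi
    simp [hi]
  · simp

theorem prod_packetFactors (G : 𝓢(ℝ, ℂ)) (j : Fin 3) :
    ∏ i, ∫ t, ‖packetFactors G j i t‖ ^ 2 =
      (∫ t, ‖SchwartzMap.derivCLM ℂ ℂ G t‖ ^ 2) * (∫ t, ‖G t‖ ^ 2) ^ 2 := by
  rw [← Finset.mul_prod_erase _ _ (Finset.mem_univ j)]
  have h1 : ∏ i ∈ Finset.univ.erase j, ∫ t, ‖packetFactors G j i t‖ ^ 2 =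
      ∏ i ∈ Finset.univ.erase j, ∫ t, ‖G t‖ ^ 2 := by
    refine Finset.prod_congr rfl fun i hi => ?_
    rw [packetFactors, Function.update_of_ne (Finset.ne_of_mem_erase hi)]
  rw [h1]
  simp [packetFactors]

/-- Z collects all lattice points and all three components of A, with weights cW. The product |k|
Z_mm is the same for all modes, because the factor 1/|k| cancels and the polarization vectors have
length 1. Multiplying it by 1/4 and by at most 2(ΛL)³ modes bounds the field energy. -/
theorem exists_weighted_squeezedState [Fintype (WaveIndex L Λ)] {G : 𝓢(ℝ, ℂ)}
    (hG : ∀ ξ : ℝ, 1 ≤ |ξ| →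
      ∫ t, Complex.exp (((2 * Real.pi * (ξ * t) : ℝ) : ℂ) * Complex.I) * ((‖G t‖ ^ 2 : ℝ) : ℂ) = 0)
    {C : ℝ} (hC : ∀ t, ‖G t‖ ≤ C * weight t) {r c : ℝ} (hΛ : 0 < Λ) (hr : 0 < r)
    (hr2 : 2 ≤ r * Λ) (hL : 0 < L) (hLΛ : 2 ≤ Λ * L) (hc : 0 < c) {ε : Space → Fin 2 → Space}
    (hε : IsPolarization ε) :
    ∃ (Ω : Fock L Λ) (hΩ : InDomain Ω), Ω ≠ 0 ∧
      ∑ m : Mode L Λ, ‖m.k‖ * ‖hΩ.ann m‖ ^ 2 ≤ 27 / 4 * c * r ^ 3 * Λ ^ 6 * ‖Ω‖ ^ 2 ∧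
      ∀ j, ∫ x : Space, ‖hΩ.field (star (potVec ε j x)) (potVec ε j x)‖ ^ 2 * ‖packet G r x‖ ^ 2 ≤
        27 * C ^ 6 * r ^ 3 / c * ‖Ω‖ ^ 2 := by
  classical
  obtain ⟨s, hs, hs3⟩ := exists_hasSum_weight (σ := (r * Λ)⁻¹) (by positivity)
    (inv_le_one_of_one_le₀ (by linarith))
  have hs0 : 0 ≤ s := hs.nonneg fun n => (weight_pos _).le
  set W : (Fin 3 → ℤ) → ℝ := fun n => ∏ i, weight ((r * Λ)⁻¹ * n i) with hWdef
  have hW0 : ∀ n, 0 < W n := fun n => Finset.prod_pos fun i _ => weight_pos _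
  have hW : HasSum W (s ^ 3) := hasSum_prod_weight hs
  have hprod : ∀ v : Fin 3 → ℝ, (∀ j, 0 ≤ v j) →
      HasSum (fun t : (Fin 3 → ℤ) × Fin 3 => c * W t.1 * v t.2) (c * s ^ 3 * ∑ j, v j) := by
    intro v hv
    have h1 := HasSum.mul (f := fun n => c * W n) (g := v) (hW.mul_left c) (hasSum_fintype v)
      (Summable.mul_of_nonneg (hW.mul_left c).summable (hasSum_fintype v).summable
        (fun n => (mul_pos hc (hW0 n)).le) hv)
    exact h1
  obtain ⟨Z, hZ, hpos, hrank, hdiag, hcomm⟩ := exists_tsum_rankOne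
    (c := fun t : (Fin 3 → ℤ) × Fin 3 => c * W t.1) (fun t => (mul_pos hc (hW0 _)).le)
    (by simpa using (hprod 1 fun _ => zero_le_one).summable)
    (F := fun t => (potVec ε t.2 (latticePoint Λ⁻¹ t.1) : Mode L Λ → ℂ))
    (C := ∑ j, ∑ m : Mode L Λ, |potCoef ε j m|) (fun t m => by
      rw [potVec, norm_mul, norm_star, norm_planeWave, mul_one, Complex.norm_real, Real.norm_eq_abs]
      exact (Finset.single_le_sum (f := fun m : Mode L Λ => |potCoef ε t.2 m|)
        (fun m _ => abs_nonneg _) (Finset.mem_univ m)).trans (Finset.single_le_sum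
        (f := fun j => ∑ m : Mode L Λ, |potCoef ε j m|)
        (fun j _ => Finset.sum_nonneg fun m _ => abs_nonneg _) (Finset.mem_univ t.2)))
  obtain ⟨Ω, hΩ, Q, hΩ0, hQ, hann, hfield⟩ := exists_squeezedState (reflection_transpose ε)
    (reflection_mul_conjTranspose hL hε) hZ hpos
    (hcomm _ (reflection_transpose ε) fun t => conjBy_reflection_potVec hL hε _ _)
  have hZm : ∀ m, (Z m m).re = c * s ^ 3 * ∑ j, potCoef ε j m ^ 2 := fun m => by
    refine (hdiag m).unique ?_
    convert hprod (fun j => potCoef ε j m ^ 2) (fun j => sq_nonneg _) using 2 with t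
    rw [potVec, norm_mul, norm_star, norm_planeWave, mul_one, Complex.norm_real, Real.norm_eq_abs,
      sq_abs]
  have hs27 : s ^ 3 ≤ 27 * (r ^ 3 * Λ ^ 3) := by
    calc s ^ 3 ≤ (3 / (r * Λ)⁻¹) ^ 3 := by gcongr
      _ = _ := by field_simp; ring
  refine ⟨Ω, hΩ, hΩ0, ?_, fun j => ?_⟩
  · have h1 : ∀ m : Mode L Λ, ‖m.k‖ * (Z m m).re = c * s ^ 3 / (2 * L ^ 3) := fun m => by
      rw [hZm]
      calc ‖m.k‖ * (c * s ^ 3 * ∑ j, potCoef ε j m ^ 2)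
          = c * s ^ 3 * ∑ j, ‖m.k‖ * potCoef ε j m ^ 2 := by rw [← Finset.mul_sum]; ring
        _ = c * s ^ 3 * ∑ j, (ε m.k m.2 j) ^ 2 / (2 * L ^ 3) := by simp only [potCoef_sq hL]
        _ = _ := by
          rw [← Finset.sum_div,
            sum_polarization_sq_all hε (k := m.k) (waveVector_ne_zero hL m.1.2.1)]
          ring
    have hcard : (Fintype.card (Mode L Λ) : ℝ) ≤ 2 * (Λ * L) ^ 3 := by
      rw [Fintype.card_prod, Fintype.card_fin]
      push_cast
      have := card_waveIndex_le hL hLΛ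
      linarith
    calc ∑ m : Mode L Λ, ‖m.k‖ * ‖hΩ.ann m‖ ^ 2
        ≤ ∑ m : Mode L Λ, ‖m.k‖ * (1 / 4 * (Z m m).re * ‖Ω‖ ^ 2) := by
          refine Finset.sum_le_sum fun m _ => ?_
          exact mul_le_mul_of_nonneg_left (hann m) (norm_nonneg _)
      _ = ∑ _m : Mode L Λ, 1 / 4 * (c * s ^ 3 / (2 * L ^ 3)) * ‖Ω‖ ^ 2 := by
          refine Finset.sum_congr rfl fun m _ => ?_
          rw [← h1 m]
          ring
      _ = Fintype.card (Mode L Λ) * (1 / 4 * (c * s ^ 3 / (2 * L ^ 3)) * ‖Ω‖ ^ 2) := by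
          rw [Finset.sum_const, Finset.card_univ, nsmul_eq_mul]
      _ ≤ 2 * (Λ * L) ^ 3 * (1 / 4 * (c * (27 * (r ^ 3 * Λ ^ 3)) / (2 * L ^ 3)) * ‖Ω‖ ^ 2) := by
          gcongr
      _ = _ := by field_simp
  · have h1 := integral_quadratic_le hG hC hΛ hr hr2 hL hc Q ε j fun n =>
      re_dotProduct_le_of_le hpos hQ (mul_pos hc (hW0 n)) fun x => hrank (n, j) x
    have h2 : ∀ x : Space, ‖hΩ.field (star (potVec ε j x)) (potVec ε j x)‖ ^ 2 *
        ‖packet G r x‖ ^ 2 = ((star (Q *ᵥ potVec ε j x) ⬝ᵥ potVec ε j x).re * ‖packet G r x‖ ^ 2) *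
        ‖Ω‖ ^ 2 := fun x => by
      rw [hfield _ (conjBy_reflection_potVec hL hε j x)]
      ring
    simp only [h2]
    rw [integral_mul_const]
    gcongr

end TrialState

/-! ### Energy of the trial state and choice of scales -/

section UpperBoundEnergy

open Matrix
open scoped SchwartzMap

theorem continuous_potVec {L Λ : ℝ} (ε : Space → Fin 2 → Space) (j : Fin 3) (m : Mode L Λ) :
    Continuous fun x : Space => potVec ε j x m := by
  have := (continuous_planeWave L m.1.1).comp (PiLp.continuous_ofLp 2 fun _ : Fin 3 => ℝ)
  exact continuous_const.mul (continuous_star.comp this)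

theorem norm_potVec {L Λ : ℝ} (ε : Space → Fin 2 → Space) (j : Fin 3) (x : Space) (m : Mode L Λ) :
    ‖potVec ε j x m‖ = |potCoef ε j m| := by
  rw [potVec, norm_mul, norm_star, norm_planeWave, mul_one, Complex.norm_real, Real.norm_eq_abs]

theorem exists_trialState : ∃ K : ℝ, 0 < K ∧ ∀ α L Λ r : ℝ, 0 < α → 0 < L → 0 < Λ → 0 < r →
    2 ≤ r * Λ → 2 ≤ Λ * L → r ^ 7 * α * Λ ^ 6 = 1 → ∀ ε : Space → Fin 2 → Space, IsPolarization ε →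
      ∃ Ψ : StateSpace L Λ, Ψ ≠ 0 ∧ ∃ q, HasEnergy α ε Ψ q ∧ q / ‖Ψ‖ ^ 2 ≤ K / r ^ 2 := by
  obtain ⟨G, hG0, hG⟩ := exists_bandlimited
  obtain ⟨C, hC0, hC⟩ := exists_norm_le_weight G
  set γ := ∫ t, ‖G t‖ ^ 2 with hγ
  set γ' := ∫ t, ‖SchwartzMap.derivCLM ℂ ℂ G t‖ ^ 2 with hγ'
  have hγ'0 : 0 ≤ γ' := integral_nonneg fun t => by positivity
  refine ⟨3 / 2 * (γ' / γ) + 81 / 2 * (C ^ 6 / γ ^ 3) + 27 / 4, by positivity, ?_⟩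
  intro α L Λ r hα hL hΛ hr hr2 hLΛ hscale ε hε
  have : Finite (WaveIndex L Λ) := finite_waveIndex hL Λ
  have : Fintype (WaveIndex L Λ) := Fintype.ofFinite _
  -- The choice c = r²α balances the two costs: per unit norm the potential term is of order α/c =
  -- r⁻², and the field energy of order c r³ Λ^6 = r^5 α Λ^6 = r⁻² by `hscale`.
  obtain ⟨Ω, hΩ, hΩ0, hann, hfield⟩ := exists_weighted_squeezedState hG hC (c := r ^ 2 * α) hΛ hr hr2
    hL hLΛ (by positivity) hε
  have hG2 : Integrable fun x => ‖packet G r x‖ ^ 2 := integrable_prod_norm_sq (fun _ => G) hr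
  have hI : ∫ x, ‖packet G r x‖ ^ 2 = r ^ 3 * γ ^ 3 := by
    have := integral_prod_norm_sq (fun _ => G) hr
    rw [Finset.prod_const, Finset.card_univ, Fintype.card_fin] at this
    exact this
  have hpc := continuous_packet G r
  obtain ⟨Ψ, hΨ, hΨn⟩ := exists_state hpc hG2 (v := fun _ => Ω) continuous_const (fun _ => le_rfl)
  rw [integral_const_mul, hI] at hΨn
  have hP : ∀ j, ∃ P : StateSpace L Λ, IsMomentum j Ψ P ∧
      ‖P‖ ^ 2 = ‖Ω‖ ^ 2 * (r * (γ' * γ ^ 2)) := by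
    intro j
    set f' : Space → ℂ := fun x => (r⁻¹ : ℝ) * ∏ i, packetFactors G j i (x i / r) with hf'
    have hfc : Continuous f' := by
      have := fun i => (packetFactors G j i).continuous
      fun_prop
    have hn : ∀ x, ‖-Complex.I * f' x‖ ^ 2 = (r⁻¹) ^ 2 * ‖∏ i, packetFactors G j i (x i / r)‖ ^ 2 := by
      intro x
      rw [hf', norm_mul, norm_neg, Complex.norm_I, one_mul, norm_mul, Complex.norm_real,
        Real.norm_of_nonneg (by positivity), mul_pow]
    obtain ⟨P, hP, hPn⟩ := exists_state (f := fun x => -Complex.I * f' x)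
      (continuous_const.mul hfc) (by
        simp only [hn]
        exact (integrable_prod_norm_sq _ hr).const_mul _)
      (v := fun _ => Ω) continuous_const (fun _ => le_rfl)
    refine ⟨P, isMomentum_of_differentiable
      (fun x => (hasFDerivAt_packet G r x).differentiableAt) (fderiv_packet G r j) hfc hΨ hP, ?_⟩
    rw [hPn]
    simp only [hn]
    rw [integral_const_mul, integral_const_mul, integral_prod_norm_sq _ hr, prod_packetFactors]
    field_simp
    rfl
  have hB : ∀ j, ∃ B : StateSpace L Λ, IsPotential ε j Ψ B ∧
      ‖B‖ ^ 2 ≤ 27 * C ^ 6 * r ^ 3 / (r ^ 2 * α) * ‖Ω‖ ^ 2 := by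
    intro j
    obtain ⟨B, hB, hBn⟩ := exists_state hpc hG2
      (v := fun x => hΩ.field (star (potVec ε j x)) (potVec ε j x))
      (continuous_finsetSum _ fun m _ => ((continuous_star.comp (continuous_potVec ε j m)).smul
        continuous_const).add ((continuous_potVec ε j m).smul continuous_const))
      (K := ∑ m, (|potCoef ε j m| * ‖hΩ.ann m‖ + |potCoef ε j m| * ‖hΩ.cre m‖)) (fun x => by
        refine (norm_sum_le _ _).trans (Finset.sum_le_sum fun m _ => ?_)
        refine (norm_add_le _ _).trans (le_of_eq ?_)
        rw [norm_smul, norm_smul, Pi.star_apply, norm_star, norm_potVec])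
    refine ⟨B, ?_, by rw [hBn]; exact hfield j⟩
    filter_upwards [hΨ, hB] with x h1 h2 n
    rw [h1, h2, vectorPotential_eq_field, lp.coeFn_smul, lp.coeFn_smul, field_smul, hΩ.coe_field]
    rfl
  have hD : ∀ m, ∃ D : StateSpace L Λ, IsAnnihilation m Ψ D ∧
      ‖D‖ ^ 2 = r ^ 3 * γ ^ 3 * ‖hΩ.ann m‖ ^ 2 := by
    intro m
    obtain ⟨D, hD, hDn⟩ := exists_state hpc hG2 (v := fun _ => hΩ.ann m) continuous_const
      (fun _ => le_rfl)
    rw [integral_const_mul, hI] at hDn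
    refine ⟨D, ?_, by rw [hDn]; ring⟩
    filter_upwards [hΨ, hD] with x h1 h2 n
    rw [h1, h2, lp.coeFn_smul, lp.coeFn_smul, annihilate_smul, hΩ.coe_ann]
  choose P hPm hPn using hP
  choose B hBp hBn using hB
  choose D hDa hDn using hD
  have hΩn : 0 < ‖Ω‖ := norm_pos_iff.2 hΩ0
  have hΨ0 : 0 < ‖Ψ‖ ^ 2 := by rw [hΨn]; positivity
  refine ⟨Ψ, fun h => by simp [h] at hΨ0, _, ⟨P, B, D, hPm, hBp, hDa, rfl⟩, ?_⟩
  rw [finsum_eq_sum_of_fintype, div_le_div_iff₀ hΨ0 (by positivity), hΨn]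
  have h1 : ∑ j, ‖P j‖ ^ 2 = 3 * (‖Ω‖ ^ 2 * (r * (γ' * γ ^ 2))) := by
    simp [hPn]
  have h2 : ∑ j, ‖B j‖ ^ 2 ≤ 3 * (27 * C ^ 6 * r ^ 3 / (r ^ 2 * α) * ‖Ω‖ ^ 2) := by
    refine (Finset.sum_le_sum fun j _ => hBn j).trans (le_of_eq ?_)
    simp
  have h3 : ∑ m, ‖m.k‖ * ‖D m‖ ^ 2 ≤
      r ^ 3 * γ ^ 3 * (27 / 4 * (r ^ 2 * α) * r ^ 3 * Λ ^ 6 * ‖Ω‖ ^ 2) := by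
    calc ∑ m, ‖m.k‖ * ‖D m‖ ^ 2 = r ^ 3 * γ ^ 3 * ∑ m, ‖m.k‖ * ‖hΩ.ann m‖ ^ 2 := by
          rw [Finset.mul_sum]
          refine Finset.sum_congr rfl fun m _ => ?_
          rw [hDn]
          ring
      _ ≤ _ := by gcongr
  have h4 : α * ∑ j, ‖B j‖ ^ 2 ≤ 81 * C ^ 6 * r * ‖Ω‖ ^ 2 := by
    calc α * ∑ j, ‖B j‖ ^ 2 ≤ α * (3 * (27 * C ^ 6 * r ^ 3 / (r ^ 2 * α) * ‖Ω‖ ^ 2)) := by gcongr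
      _ = _ := by field_simp; ring
  have h5 : r ^ 3 * γ ^ 3 * (27 / 4 * (r ^ 2 * α) * r ^ 3 * Λ ^ 6 * ‖Ω‖ ^ 2) =
      27 / 4 * γ ^ 3 * r * ‖Ω‖ ^ 2 := by
    linear_combination (27 / 4 * γ ^ 3 * r * ‖Ω‖ ^ 2) * hscale
  rw [h5] at h3
  rw [h1]
  calc (1 / 2 * (3 * (‖Ω‖ ^ 2 * (r * (γ' * γ ^ 2))) + α * ∑ j, ‖B j‖ ^ 2) +
        ∑ m, ‖m.k‖ * ‖D m‖ ^ 2) * r ^ 2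
      ≤ (1 / 2 * (3 * (‖Ω‖ ^ 2 * (r * (γ' * γ ^ 2))) + 81 * C ^ 6 * r * ‖Ω‖ ^ 2) +
        27 / 4 * γ ^ 3 * r * ‖Ω‖ ^ 2) * r ^ 2 := by gcongr
    _ = _ := by field_simp

theorem hasEnergy_nonneg {L Λ α q : ℝ} (hα : 0 < α) {ε : Space → Fin 2 → Space}
    {Ψ : StateSpace L Λ} (h : HasEnergy α ε Ψ q) : 0 ≤ q := by
  obtain ⟨P, B, D, -, -, -, rfl⟩ := h
  have h1 : 0 ≤ ∑ᶠ m : Mode L Λ, ‖m.k‖ * ‖D m‖ ^ 2 := finsum_nonneg fun m => by positivity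
  have h2 : 0 ≤ ∑ j, ‖P j‖ ^ 2 + α * ∑ j, ‖B j‖ ^ 2 := by positivity
  linarith

theorem groundStateEnergy_le {L Λ α e q : ℝ} (hα : 0 < α) {ε : Space → Fin 2 → Space}
    {Ψ : StateSpace L Λ} (hΨ : Ψ ≠ 0) (h : HasEnergy α ε Ψ q) (he : q / ‖Ψ‖ ^ 2 ≤ e) :
    groundStateEnergy α L Λ ε ≤ e := by
  have hmem : q / ‖Ψ‖ ^ 2 ∈ {e : ℝ | ∃ Ψ : StateSpace L Λ, Ψ ≠ 0 ∧
      ∃ q : ℝ, HasEnergy α ε Ψ q ∧ e = q / ‖Ψ‖ ^ 2} := ⟨Ψ, hΨ, q, h, rfl⟩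
  refine (csInf_le ?_ hmem).trans he
  refine ⟨0, ?_⟩
  rintro _ ⟨Φ, -, p, hp, rfl⟩
  have := hasEnergy_nonneg hα hp
  positivity

/-- The witness is ℓ = α^(-1/7) Λ^(-6/7), so that ℓΛ grows like Λ^(1/7) and ℓ^5 Λ^4 decays like
Λ^(-2/7). The conditions involving L₀ persist for every L ≥ L₀, which makes the threshold uniform in
L. -/
theorem eventually_scale {α L₀ : ℝ} (hα : 0 < α) (hL₀ : 0 < L₀) :
    ∀ᶠ Λ in Filter.atTop, ∃ ℓ : ℝ, 0 < ℓ ∧ ℓ ≤ L₀ ∧ 40 ≤ Λ * L₀ ∧ ℓ ^ 7 * α * Λ ^ 6 = 1 ∧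
      8 * (ℓ ^ 5 * Λ ^ 4) ≤ 1 ∧ 2 ≤ ℓ * Λ ∧ 1 / ℓ ^ 2 = α ^ (2 / 7 : ℝ) * Λ ^ (12 / 7 : ℝ) := by
  have t1 : Filter.Tendsto (fun Λ : ℝ => α ^ (-(1 / 7) : ℝ) * Λ ^ (-(6 / 7) : ℝ)) Filter.atTop
      (nhds (α ^ (-(1 / 7) : ℝ) * 0)) :=
    (tendsto_rpow_neg_atTop (by norm_num)).const_mul _
  have t2 : Filter.Tendsto (fun Λ : ℝ => 8 * (α ^ (-(5 / 7) : ℝ) * Λ ^ (-(2 / 7) : ℝ))) Filter.atTop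
      (nhds (8 * (α ^ (-(5 / 7) : ℝ) * 0))) :=
    ((tendsto_rpow_neg_atTop (by norm_num)).const_mul _).const_mul _
  have t3 : Filter.Tendsto (fun Λ : ℝ => α ^ (-(1 / 7) : ℝ) * Λ ^ (1 / 7 : ℝ)) Filter.atTop
      Filter.atTop :=
    (tendsto_rpow_atTop (by norm_num)).const_mul_atTop (by positivity)
  rw [mul_zero] at t1 t2
  rw [mul_zero] at t2
  have t4 : Filter.Tendsto (fun Λ : ℝ => Λ * L₀) Filter.atTop Filter.atTop :=
    Filter.tendsto_id.atTop_mul_const hL₀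
  filter_upwards [t1.eventually_le_const hL₀, t2.eventually_le_const one_pos,
    t3.eventually_ge_atTop 2, t4.eventually_ge_atTop 40, Filter.eventually_gt_atTop 0]
    with Λ h1 h2 h3 h4 hΛ
  have hpow : ∀ n : ℕ, (α ^ (-(1 / 7) : ℝ) * Λ ^ (-(6 / 7) : ℝ)) ^ n =
      α ^ (-(1 / 7) * n : ℝ) * Λ ^ (-(6 / 7) * n : ℝ) := fun n => by
    rw [mul_pow, ← Real.rpow_natCast, ← Real.rpow_natCast, ← Real.rpow_mul hα.le,
      ← Real.rpow_mul hΛ.le]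
  refine ⟨_, by positivity, h1, h4, ?_, ?_, ?_, ?_⟩
  · rw [hpow, ← Real.rpow_natCast Λ 6]
    calc α ^ (-(1 / 7) * (7 : ℕ) : ℝ) * Λ ^ (-(6 / 7) * (7 : ℕ) : ℝ) * α * Λ ^ ((6 : ℕ) : ℝ)
        = (α ^ (-(1 / 7) * (7 : ℕ) : ℝ) * α ^ (1 : ℝ)) *
          (Λ ^ (-(6 / 7) * (7 : ℕ) : ℝ) * Λ ^ ((6 : ℕ) : ℝ)) := by rw [Real.rpow_one]; ring
      _ = 1 := by
        rw [← Real.rpow_add hα, ← Real.rpow_add hΛ]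
        norm_num
  · refine le_trans (le_of_eq ?_) h2
    rw [hpow, ← Real.rpow_natCast Λ 4, mul_assoc (α ^ _), ← Real.rpow_add hΛ]
    norm_num
  · refine h3.trans (le_of_eq ?_)
    rw [mul_assoc]
    nth_rewrite 3 [← Real.rpow_one Λ]
    rw [← Real.rpow_add hΛ]
    norm_num
  · rw [hpow, one_div, mul_inv, ← Real.rpow_neg hα.le, ← Real.rpow_neg hΛ.le]
    norm_num

end UpperBoundEnergy

end RadiationField

end

theorem theorem2 :
    ∃ C₁ C₂ : ℝ, 0 < C₁ ∧ 0 < C₂ ∧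
      ∀ α : ℝ, 0 < α → ∀ L₀ : ℝ, 0 < L₀ → ∃ Λ₀ : ℝ, 0 < Λ₀ ∧
        ∀ Λ : ℝ, Λ₀ ≤ Λ → ∀ L : ℝ, L₀ ≤ L →
          ∀ ε : RadiationField.Space → Fin 2 → RadiationField.Space, RadiationField.IsPolarization ε →
            C₁ * α ^ (2 / 7 : ℝ) * Λ ^ (12 / 7 : ℝ) ≤ RadiationField.groundStateEnergy α L Λ ε ∧
              RadiationField.groundStateEnergy α L Λ ε ≤ C₂ * α ^ (2 / 7 : ℝ) * Λ ^ (12 / 7 : ℝ) := by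
  obtain ⟨K, hK, htrial⟩ := RadiationField.exists_trialState
  refine ⟨1 / (32 * 128000 ^ 2), K, by norm_num, hK, fun α hα L₀ hL₀ => ?_⟩
  obtain ⟨Λ₁, hΛ₁⟩ := Filter.eventually_atTop.1 (RadiationField.eventually_scale hα hL₀)
  refine ⟨max Λ₁ 1, by positivity, fun Λ hΛ L hL ε hε => ?_⟩
  have hΛ0 : 0 < Λ := one_pos.trans_le ((le_max_right _ _).trans hΛ)
  have hL0 : 0 < L := hL₀.trans_le hL
  obtain ⟨ℓ, hℓ, hℓL, h40, hscale, hsmall, h2, hpow⟩ := hΛ₁ Λ ((le_max_left _ _).trans hΛ)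
  have h40' : 40 ≤ Λ * L := h40.trans (by gcongr)
  -- The packet has the width r = ℓ of the lower bound. Its state also shows that the infimum runs
  -- over a nonempty set.
  obtain ⟨Ψ, hΨ, q, hq, hle⟩ := htrial α L Λ ℓ hα hL0 hΛ0 hℓ h2 (by linarith) hscale ε hε
  rw [mul_assoc, mul_assoc, ← hpow]
  refine ⟨?_, RadiationField.groundStateEnergy_le hα hΨ hq (hle.trans (le_of_eq (by ring)))⟩
  have h1 := RadiationField.le_groundStateEnergy hL0 hΛ0 hε hα hℓ (hℓL.trans hL) h40' hscale hsmall
    ⟨_, Ψ, hΨ, q, hq, rfl⟩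
  refine le_trans (le_of_eq ?_) h1
  field_simp
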